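/- **Conventions.** A *prederivator* is a 2-functor $\mathscr D\colon \mathrm{Cat}^{\mathrm{op}}\to\mathrm{CAT}$; its morphisms are pseudonatural transformations and its 2-cells are modifications. A *derivator* is a prederivator satisfying the axioms (Der1)–(Der4), and for a small category $B$ we write $\mathscr D^B$ for the shifted derivator $\mathscr D^B(A)=\mathscr D(B\times A)$. A square $Q\in\mathscr D^{\square}(A)$ is *cocartesian* (*cartesian*) if it lies in the essential image of the left Kan extension along $\ulcorner\subset\square$ (of the right Kan extension along $\lrcorner\subset\square$), and *bicartesian* if it is both. A derivator is *stable* if it is pointed and its cartesian and cocartesian squares coincide. A morphism is *exact* if it preserves initial objects and cocartesian squares, and terminal objects and cartesian squares. Let $n\ge 0$ and let $A_n=(1<\dots<n)$. Let $M_n$ be the mesh category: it has objects $(k,l)$ with $k\in\mathbb Z$ and $0\le l\le n+1$, and is generated by arrows $(k,l)\to(k,l+1)$ and $(k,l+1)\to(k+1,l)$ for $0\le l\le n$, subject to the relations that all squares with vertices $(k,l),(k,l+1),(k+1,l-1),(k+1,l)$, $1\le l\le n$, commute. (It is a poset, with $(k,l)\le(k',l')$ iff $k\le k'$ and $k+l\le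 k'+l'$.) The functor $i\colon A_n\to M_n$, $l\mapsto(0,l)$, factors through full subcategories $$A_n\xrightarrow{\,i_1\,}K_1\xrightarrow{\,i_2\,}K_2\xrightarrow{\,i_3\,}K_3\xrightarrow{\,i_4\,}M_n,$$ where $K_1$ is obtained from $A_n$ by adding $(k,n+1)$ for $k\ge 0$ and $(k,0)$ for $k>0$; $K_2$ from $K_1$ by adding all $(k,l)$ with $k>0$; and $K_3$ from $K_2$ by adding $(k,n+1)$ for $k<0$ and $(k,0)$ for $k\le 0$. For a stable derivator $\mathscr D$ let $\mathscr D^{M_n,\mathrm{ex}}\subseteq\mathscr D^{M_n}$ be the full sub-prederivator spanned by the coherent diagrams that vanish at $(k,0)$ and $(k,n+1)$ for all $k\in\mathbb Z$ and make all squares $(k,l),(k,l+1),(k+1,l-1),(k+1,l)$, $k\in\mathbb Z$, $1\le l\le n$, bicartesian. **Theorem.** For every stable derivator $\mathscr D$, the prederivator $\mathscr D^{M_n,\mathrm{ex}}$ is well defined (its defining conditions are stable under restriction) and is a stable derivator, as is $\mathscr D^{A_n}$, and the inclusion $\mathscr D^{M_n,\mathrm{ex}}\to\mathscr D^{M_n}$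 is exact. The composite $$\mathscr D^{A_n}\xrightarrow{(i_1)_*}\mathscr D^{K_1}\xrightarrow{(i_2)_!}\mathscr D^{K_2}\xrightarrow{(i_3)_!}\mathscr D^{K_3}\xrightarrow{(i_4)_*}\mathscr D^{M_n}$$ factors, up to isomorphism, through $\mathscr D^{M_n,\mathrm{ex}}$ as a morphism $F\colon\mathscr D^{A_n}\to\mathscr D^{M_n,\mathrm{ex}}$, and $$(F,i^*)\colon\mathscr D^{A_n}\rightleftarrows\mathscr D^{M_n,\mathrm{ex}}$$ is an equivalence of stable derivators. It is natural with respect to exact morphisms: the morphisms $F$ and $i^*$ are the components at $\mathscr D$ of mutually inverse pseudonatural equivalences between the 2-functors $\mathscr D\mapsto\mathscr D^{A_n}$ and $\mathscr D\mapsto\mathscr D^{M_n,\mathrm{ex}}$ from the 2-category of stable derivators, exact morphisms and all 2-cells to the 2-category of prederivators, where $i^*$ carries its canonical naturality isomorphisms. -/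

import Mathlib

open CategoryTheory Bicategory Opposite
open scoped Pseudofunctor.StrongTrans

universe w₁ w₂ w₃ v₁ v₂ v₃ u₁ u₂ u₃ u v w

set_option linter.checkUnivs false
set_option linter.unusedVariables false
noncomputable section

namespace DerivatorAR

section Generic

variable {B : Type u₁} [Bicategory.{w₁, v₁} B] {C : Type u₂} [Bicategory.{w₂, v₂} C]
  {E : Type u₃} [Bicategory.{w₃, v₃} E]

/-- Composition of pseudofunctors (reducible). -/
abbrev compPs (P : B ⥤ᵖ C) (F : C ⥤ᵖ E) : B ⥤ᵖ E where
  obj b := F.obj (P.obj b)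
  map f := F.map (P.map f)
  map₂ θ := F.map₂ (P.map₂ θ)
  mapId b := F.map₂Iso (P.mapId b) ≪≫ F.mapId (P.obj b)
  mapComp f g := F.map₂Iso (P.mapComp f g) ≪≫ F.mapComp (P.map f) (P.map g)

/-- Precomposition of a pseudonatural transformation with a pseudofunctor. -/
abbrev precompTrans (P : B ⥤ᵖ C) {F G : C ⥤ᵖ E} (η : F ⟶ G) : compPs P F ⟶ compPs P G where
  app b := η.app (P.obj b)
  naturality f := η.naturality (P.map f)
  naturality_id b := by
    have := η.naturality_naturality (P.mapId b).hom
    simp [← reassoc_of% this]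
  naturality_comp f g := by
    have := η.naturality_naturality (P.mapComp f g).hom
    simp [← reassoc_of% this]

lemma map_whiskerLeft_map₂ (F : C ⥤ᵖ E) {a b c : C} (f : a ⟶ b) {g h : b ⟶ c} (η : g ⟶ h) :
    F.map f ◁ F.map₂ η = (F.mapComp f g).inv ≫ F.map₂ (f ◁ η) ≫ (F.mapComp f h).hom := by
  simp

lemma map₂_whiskerRight_map (F : C ⥤ᵖ E) {a b c : C} {f g : a ⟶ b} (η : f ⟶ g) (h : b ⟶ c) :
    F.map₂ η ▷ F.map h = (F.mapComp f h).inv ≫ F.map₂ (η ▷ h) ≫ (F.mapComp g h).hom := by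
  simp

lemma map₂_associator_inv' (F : C ⥤ᵖ E) {a b c d : C} (f : a ⟶ b) (g : b ⟶ c) (h : c ⟶ d) :
    F.map₂ (α_ f g h).inv = (F.mapComp f (g ≫ h)).hom ≫ F.map f ◁ (F.mapComp g h).hom ≫
      (α_ (F.map f) (F.map g) (F.map h)).inv ≫ (F.mapComp f g).inv ▷ F.map h ≫
      (F.mapComp (f ≫ g) h).inv := by
  rw [← cancel_epi (F.map₂ (α_ f g h).hom), F.map₂_hom_inv, F.map₂_associator]
  simp

/-- Postcomposition of a pseudonatural transformation with a pseudofunctor. -/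
abbrev postcompTrans {P Q : B ⥤ᵖ C} (η : P ⟶ Q) (F : C ⥤ᵖ E) : compPs P F ⟶ compPs Q F where
  app b := F.map (η.app b)
  naturality f := (F.mapComp _ _).symm ≪≫ F.map₂Iso (η.naturality f) ≪≫ F.mapComp _ _
  naturality_naturality θ := by
    have := congrArg F.map₂ (η.naturality_naturality θ)
    simp only [PrelaxFunctor.map₂_comp] at this
    dsimp only
    rw [map₂_whiskerRight_map, map_whiskerLeft_map₂]
    simp [-Pseudofunctor.map₂_whisker_left, -Pseudofunctor.map₂_whisker_right, reassoc_of% this]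
  naturality_id b := by
    have := congrArg F.map₂ (η.naturality_id b)
    simp only [PrelaxFunctor.map₂_comp] at this
    simp only [Iso.trans_hom, whiskerLeft_comp, comp_whiskerRight,
      PrelaxFunctor.map₂Iso_hom, Iso.symm_hom, Category.assoc]
    rw [map₂_whiskerRight_map, map_whiskerLeft_map₂, F.whiskerLeft_mapId_hom,
      F.whiskerRight_mapId_hom]
    simp only [Category.assoc, Iso.hom_inv_id_assoc, reassoc_of% this, Iso.inv_hom_id_assoc,
       F.map₂_inv_hom_assoc]
  naturality_comp f g := by
    have := congrArg F.map₂ (η.naturality_comp f g)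
    simp only [PrelaxFunctor.map₂_comp] at this
    simp only [Iso.trans_hom, whiskerLeft_comp, comp_whiskerRight,
      PrelaxFunctor.map₂Iso_hom, Iso.symm_hom, Category.assoc]
    simp only [map₂_whiskerRight_map, map_whiskerLeft_map₂]
    simp only [Category.assoc, Iso.hom_inv_id_assoc, reassoc_of% this]
    rw [F.mapComp_assoc_right_hom, F.map₂_hom_inv_assoc, map₂_associator_inv',
      F.map₂_associator (P.map f) (P.map g)]
    simp only [Category.assoc]



lemma whisker_id_comp_eq {a b c d : B} {f : a ⟶ b} {g : b ⟶ d} {h : a ⟶ c} {k : c ⟶ d}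
    (x : f ≫ g ⟶ h ≫ k) : f ◁ 𝟙 g ≫ x = x ≫ 𝟙 h ▷ k := by simp

/-- Precomposition with `P`, as a pseudofunctor. -/
abbrev precompPs (P : B ⥤ᵖ C) : (C ⥤ᵖ E) ⥤ᵖ (B ⥤ᵖ E) where
  obj F := compPs P F
  map η := precompTrans P η
  map₂ Γ := ⟨{ app := fun b => Γ.as.app (P.obj b) }⟩
  mapId F := Pseudofunctor.StrongTrans.isoMk (fun b => Iso.refl (𝟙 (F.obj (P.obj b))))
    (fun f => whisker_id_comp_eq _)
  mapComp η θ := Pseudofunctor.StrongTrans.isoMk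
    (fun b => Iso.refl (η.app (P.obj b) ≫ θ.app (P.obj b)))
    (fun f => whisker_id_comp_eq _)
  map₂_whisker_left η _ _ Γ := Pseudofunctor.StrongTrans.homCategory.ext fun b => by
    change η.app (P.obj b) ◁ Γ.as.app (P.obj b) =
      𝟙 _ ≫ η.app (P.obj b) ◁ Γ.as.app (P.obj b) ≫ 𝟙 _
    simp
  map₂_whisker_right Γ η := Pseudofunctor.StrongTrans.homCategory.ext fun b => by
    change Γ.as.app (P.obj b) ▷ η.app (P.obj b) =
      𝟙 _ ≫ Γ.as.app (P.obj b) ▷ η.app (P.obj b) ≫ 𝟙 _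
    simp
  map₂_associator η θ ι := Pseudofunctor.StrongTrans.homCategory.ext fun b => by
    change (α_ (η.app (P.obj b)) (θ.app (P.obj b)) (ι.app (P.obj b))).hom =
      𝟙 _ ≫ 𝟙 _ ▷ ι.app (P.obj b) ≫ (α_ _ _ _).hom ≫ η.app (P.obj b) ◁ 𝟙 _ ≫ 𝟙 _
    simp
  map₂_left_unitor η := Pseudofunctor.StrongTrans.homCategory.ext fun b => by
    change (λ_ (η.app (P.obj b))).hom = 𝟙 _ ≫ 𝟙 _ ▷ η.app (P.obj b) ≫ (λ_ _).hom
    simp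
  map₂_right_unitor η := Pseudofunctor.StrongTrans.homCategory.ext fun b => by
    change (ρ_ (η.app (P.obj b))).hom = 𝟙 _ ≫ η.app (P.obj b) ◁ 𝟙 _ ≫ (ρ_ _).hom
    simp

end Generic

/-- The product `K × A` of small categories. -/
abbrev prodCat (K A : Cat.{u, u}) : Cat.{u, u} := Cat.of (K × A)

/-- The functor `f × g : K × A ⥤ L × B`. -/
abbrev prodMap {K L A B : Cat.{u, u}} (f : K ⟶ L) (g : A ⟶ B) : prodCat K A ⟶ prodCat L B :=
  (f.toFunctor.prod g.toFunctor).toCatHom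

lemma hom2_ext {A B : Cat.{u, u}ᵒᵖ} {f g : A ⟶ B} {α β : f ⟶ g}
    (h : ∀ X, α.unop2.toNatTrans.app X = β.unop2.toNatTrans.app X) : α = β :=
  congrArg Bicategory.Opposite.op2 (Cat.Hom₂.ext (NatTrans.ext (funext h)))

/-- The 2-functor `K × - : Catᵒᵖ → Catᵒᵖ`. -/
abbrev prodPs (K : Cat.{u, u}) : Cat.{u, u}ᵒᵖ ⥤ᵖ Cat.{u, u}ᵒᵖ where
  obj A := op (prodCat K A.unop)
  map f := (prodMap (𝟙 K) f.unop).op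
  map₂ θ := Bicategory.Opposite.op2 (NatTrans.prod (𝟙 (𝟭 K)) θ.unop2.toNatTrans).toCatHom₂
  mapId A := Iso.op2 (Cat.Hom.isoMk (NatIso.ofComponents (fun X => Iso.refl _)))
  mapComp f g := Iso.op2 (Cat.Hom.isoMk (NatIso.ofComponents (fun X => Iso.refl _)))
  map₂_id f := rfl
  map₂_comp f g := hom2_ext fun ⟨k, a⟩ => Prod.ext (Category.id_comp (𝟙 k)).symm rfl
  map₂_whisker_left f g h η := hom2_ext fun ⟨k, a⟩ => by
    refine Prod.ext ?_ ?_
    · change 𝟙 k = 𝟙 k ≫ 𝟙 k ≫ 𝟙 k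
      simp
    · change f.unop.toFunctor.map (η.unop2.toNatTrans.app a) =
        𝟙 _ ≫ f.unop.toFunctor.map (η.unop2.toNatTrans.app a) ≫ 𝟙 _
      simp
  map₂_whisker_right {A B C f g} η h := hom2_ext fun ⟨k, a⟩ => by
    refine Prod.ext ?_ ?_
    · change 𝟙 k = 𝟙 k ≫ 𝟙 k ≫ 𝟙 k
      simp
    · change η.unop2.toNatTrans.app (h.unop.toFunctor.obj a) =
        𝟙 _ ≫ η.unop2.toNatTrans.app (h.unop.toFunctor.obj a) ≫ 𝟙 _
      simp
  map₂_associator f g h := hom2_ext fun ⟨k, a⟩ => by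
    refine Prod.ext ?_ ?_
    · change 𝟙 k = 𝟙 k ≫ 𝟙 k ≫ 𝟙 k ≫ 𝟙 k ≫ 𝟙 k
      simp
    · change 𝟙 (f.unop.toFunctor.obj (g.unop.toFunctor.obj (h.unop.toFunctor.obj a))) =
        𝟙 _ ≫ 𝟙 _ ≫ 𝟙 _ ≫ f.unop.toFunctor.map (𝟙 _) ≫ 𝟙 _
      simp
  map₂_left_unitor f := hom2_ext fun ⟨k, a⟩ => by
    refine Prod.ext ?_ ?_
    · change 𝟙 k = 𝟙 k ≫ 𝟙 k ≫ 𝟙 k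
      simp
    · change 𝟙 (f.unop.toFunctor.obj a) = 𝟙 _ ≫ 𝟙 _ ≫ 𝟙 _
      simp
  map₂_right_unitor f := hom2_ext fun ⟨k, a⟩ => by
    refine Prod.ext ?_ ?_
    · change 𝟙 k = 𝟙 k ≫ 𝟙 k ≫ 𝟙 k
      simp
    · change 𝟙 (f.unop.toFunctor.obj a) = 𝟙 _ ≫ f.unop.toFunctor.map (𝟙 _) ≫ 𝟙 _
      simp

abbrev prodTrans {K L : Cat.{u, u}} (f : K ⟶ L) : prodPs L ⟶ prodPs K where
  app A := (prodMap f (𝟙 A.unop)).op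
  naturality {A B} g := Iso.op2 (Cat.Hom.isoMk (NatIso.ofComponents (fun X => Iso.refl _)
    (fun _ => (Category.comp_id _).trans (Category.id_comp _).symm)))
  naturality_naturality θ := hom2_ext fun ⟨k, a⟩ => by
    refine Prod.ext ?_ ?_
    · change 𝟙 (f.toFunctor.obj k) ≫ 𝟙 _ = 𝟙 _ ≫ f.toFunctor.map (𝟙 k)
      simp
    · change θ.unop2.toNatTrans.app a ≫ 𝟙 _ = 𝟙 _ ≫ θ.unop2.toNatTrans.app a
      simp
  naturality_id A := hom2_ext fun ⟨k, a⟩ => by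
    refine Prod.ext ?_ ?_
    · change 𝟙 (f.toFunctor.obj k) ≫ f.toFunctor.map (𝟙 k) = 𝟙 _ ≫ 𝟙 _ ≫ 𝟙 _
      simp
    · change 𝟙 a ≫ 𝟙 a = 𝟙 _ ≫ 𝟙 _ ≫ 𝟙 _
      simp
  naturality_comp g h := hom2_ext fun ⟨k, a⟩ => by
    refine Prod.ext ?_ ?_
    · change 𝟙 (f.toFunctor.obj k) ≫ f.toFunctor.map (𝟙 k) =
        𝟙 _ ≫ 𝟙 _ ≫ 𝟙 _ ≫ 𝟙 _ ≫ 𝟙 _ ≫ 𝟙 _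
      simp
    · change 𝟙 (g.unop.toFunctor.obj (h.unop.toFunctor.obj a)) ≫ 𝟙 _ =
        𝟙 _ ≫ 𝟙 _ ≫ g.unop.toFunctor.map (𝟙 _) ≫ 𝟙 _ ≫ 𝟙 _ ≫ 𝟙 _
      simp

section Full

open Pseudofunctor

lemma full_hom2_ext {A : Cat.{v, u}} {C : Type u} [Category.{v} C] {Q : ObjectProperty C}
    {f g : A ⟶ Cat.of Q.FullSubcategory} {α β : f ⟶ g}
    (h : ∀ M, (α.toNatTrans.app M).hom = (β.toNatTrans.app M).hom) : α = β :=
  Cat.Hom₂.ext (NatTrans.ext (funext fun M => ObjectProperty.hom_ext _ (h M)))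

variable {B : Type u₁} [Bicategory.{w₁, v₁} B] {F G : B ⥤ᵖ Cat.{v, u}}
  {P : F.ObjectProperty} [P.IsClosedUnderMapObj] {Q : G.ObjectProperty} [Q.IsClosedUnderMapObj]

/-- Restriction of a pseudonatural transformation to full subpseudofunctors. -/
abbrev fullMap (η : F ⟶ G)
    (h : ∀ X (M : F.obj X), P.prop X M → Q.prop X ((η.app X).toFunctor.obj M)) :
    P.fullsubcategory ⟶ Q.fullsubcategory where
  app X := ((Q.prop X).lift ((P.prop X).ι ⋙ (η.app X).toFunctor)
    (fun M => h X M.obj M.property)).toCatHom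
  naturality {X Y} f := Cat.Hom.isoMk (((Q.prop Y).fullyFaithfulι.whiskeringRight _).preimageIso
    (Functor.isoWhiskerLeft (P.prop X).ι (Cat.Hom.toNatIso (η.naturality f))))
  naturality_naturality θ := full_hom2_ext fun M =>
    congr($(η.naturality_naturality θ).toNatTrans.app M.obj)
  naturality_id X := full_hom2_ext fun M =>
    congr($(η.naturality_id X).toNatTrans.app M.obj)
  naturality_comp f g := full_hom2_ext fun M =>
    congr($(η.naturality_comp f g).toNatTrans.app M.obj)

end Full

section Full2

open Pseudofunctor

variable {B : Type u₁} [Bicategory.{w₁, v₁} B] {F G H K : B ⥤ᵖ Cat.{v, u}}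
  {P : F.ObjectProperty} [P.IsClosedUnderMapObj] {Q : G.ObjectProperty} [Q.IsClosedUnderMapObj]
  {R : H.ObjectProperty} [R.IsClosedUnderMapObj]

/-- Restriction of a modification to full subpseudofunctors. -/
abbrev fullMap₂ {η θ : F ⟶ G} (Γ : η ⟶ θ)
    (h : ∀ X (M : F.obj X), P.prop X M → Q.prop X ((η.app X).toFunctor.obj M))
    (h' : ∀ X (M : F.obj X), P.prop X M → Q.prop X ((θ.app X).toFunctor.obj M)) :
    fullMap (P := P) (Q := Q) η h ⟶ fullMap θ h' :=
  ⟨{ app := fun X => Cat.Hom₂.ofNatTrans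
      { app := fun M => ObjectProperty.homMk ((Γ.as.app X).toNatTrans.app M.obj)
        naturality := fun _ _ f => ObjectProperty.hom_ext _
          ((Γ.as.app X).toNatTrans.naturality f.hom) }
     naturality := fun f => full_hom2_ext fun M =>
        congr($(Γ.as.naturality f).toNatTrans.app M.obj) }⟩

lemma fullTrans_ext {η θ : P.fullsubcategory ⟶ Q.fullsubcategory} {Γ Γ' : η ⟶ θ}
    (h : ∀ X (M : (P.prop X).FullSubcategory), ((Γ.as.app X).toNatTrans.app M).hom =
      ((Γ'.as.app X).toNatTrans.app M).hom) : Γ = Γ' :=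
  Pseudofunctor.StrongTrans.homCategory.ext fun X => full_hom2_ext (h X)

/-- Restriction of an invertible modification to full subpseudofunctors. -/
abbrev fullMapIso {η θ : F ⟶ G} (e : η ≅ θ)
    (h : ∀ X (M : F.obj X), P.prop X M → Q.prop X ((η.app X).toFunctor.obj M))
    (h' : ∀ X (M : F.obj X), P.prop X M → Q.prop X ((θ.app X).toFunctor.obj M)) :
    fullMap (P := P) (Q := Q) η h ≅ fullMap θ h' where
  hom := fullMap₂ e.hom h h'
  inv := fullMap₂ e.inv h' h
  hom_inv_id := fullTrans_ext fun X M => congr(($(e.hom_inv_id).as.app X).toNatTrans.app M.obj)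
  inv_hom_id := fullTrans_ext fun X M => congr(($(e.inv_hom_id).as.app X).toNatTrans.app M.obj)

/-- `fullMap` preserves identities. -/
abbrev fullMapId (h : ∀ X (M : F.obj X), P.prop X M → P.prop X M) :
    fullMap (P := P) (Q := P) (𝟙 F) h ≅ 𝟙 P.fullsubcategory :=
  Pseudofunctor.StrongTrans.isoMk (fun X => Iso.refl (𝟙 (P.fullsubcategory.obj X))) fun f =>
    full_hom2_ext fun M => by
      change 𝟙 ((F.map f).toFunctor.obj M.obj) ≫ 𝟙 _ ≫ 𝟙 _ =
        (𝟙 _ ≫ 𝟙 _) ≫ (F.map f).toFunctor.map (𝟙 M.obj)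
      simp

abbrev fullMapComp (η : F ⟶ G) (θ : G ⟶ H)
    (h : ∀ X (M : F.obj X), P.prop X M → Q.prop X ((η.app X).toFunctor.obj M))
    (h' : ∀ X (M : G.obj X), Q.prop X M → R.prop X ((θ.app X).toFunctor.obj M))
    (h'' : ∀ X (M : F.obj X), P.prop X M → R.prop X (((η ≫ θ).app X).toFunctor.obj M)) :
    fullMap (P := P) (Q := R) (η ≫ θ) h'' ≅ fullMap (P := P) (Q := Q) η h ≫ fullMap θ h' :=
  Pseudofunctor.StrongTrans.isoMk (fun X => Iso.refl
    ((fullMap (P := P) (Q := Q) η h).app X ≫ (fullMap (P := Q) (Q := R) θ h').app X)) fun f =>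
    full_hom2_ext fun M => by
      change 𝟙 ((θ.app _).toFunctor.obj ((η.app _).toFunctor.obj ((F.map f).toFunctor.obj M.obj))) ≫
          𝟙 _ ≫ (θ.app _).toFunctor.map ((η.naturality f).hom.toNatTrans.app M.obj) ≫ 𝟙 _ ≫
          (θ.naturality f).hom.toNatTrans.app ((η.app _).toFunctor.obj M.obj) ≫ 𝟙 _ =
        (𝟙 _ ≫ (θ.app _).toFunctor.map ((η.naturality f).hom.toNatTrans.app M.obj) ≫ 𝟙 _ ≫
          (θ.naturality f).hom.toNatTrans.app ((η.app _).toFunctor.obj M.obj) ≫ 𝟙 _) ≫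
          (H.map f).toFunctor.map (𝟙 _)
      simp

/-- The restriction of `η` is compatible with the inclusions. -/
abbrev fullMapι (η : F ⟶ G)
    (h : ∀ X (M : F.obj X), P.prop X M → Q.prop X ((η.app X).toFunctor.obj M)) :
    fullMap (P := P) (Q := Q) η h ≫ Q.ι ≅ P.ι ≫ η :=
  Pseudofunctor.StrongTrans.isoMk (fun X => Iso.refl ((P.ι.app X ≫ η.app X))) fun f =>
    Cat.Hom₂.ext <| NatTrans.ext <| funext fun M => by
      change 𝟙 ((η.app _).toFunctor.obj ((F.map f).toFunctor.obj M.obj)) ≫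
          𝟙 _ ≫ (η.app _).toFunctor.map (𝟙 _) ≫ 𝟙 _ ≫
          (η.naturality f).hom.toNatTrans.app M.obj ≫ 𝟙 _ =
        (𝟙 _ ≫ (η.naturality f).hom.toNatTrans.app M.obj ≫ 𝟙 _ ≫ 𝟙 _ ≫ 𝟙 _) ≫
          (G.map f).toFunctor.map (𝟙 _)
      simp

end Full2
section Generic
variable {B : Type u₁} [Bicategory.{w₁, v₁} B] {C : Type u₂} [Bicategory.{w₂, v₂} C]
  {E : Type u₃} [Bicategory.{w₃, v₃} E]

abbrev precompPsMap {P Q : B ⥤ᵖ C} (α : P ⟶ Q) :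
    (precompPs P : (C ⥤ᵖ E) ⥤ᵖ (B ⥤ᵖ E)) ⟶ precompPs Q where
  app F := postcompTrans α F
  naturality {F G} η := (Pseudofunctor.StrongTrans.isoMk
    (η := postcompTrans α F ≫ precompTrans Q η) (θ := precompTrans P η ≫ postcompTrans α G)
    (fun b => η.naturality (α.app b))
    (fun {a b} f => by
      have h1 := η.naturality_comp (P.map f) (α.app b)
      have h2 := η.naturality_naturality (α.naturality f).hom
      have h3 := η.naturality_comp (α.app a) (Q.map f)
      have h1' : F.map (P.map f) ◁ (η.naturality (α.app b)).hom ≫ (α_ _ _ _).inv ≫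
          (η.naturality (P.map f)).hom ▷ G.map (α.app b) ≫ (α_ _ _ _).hom =
          (α_ _ _ _).inv ≫ (F.mapComp (P.map f) (α.app b)).inv ▷ η.app (Q.obj b) ≫
          (η.naturality (P.map f ≫ α.app b)).hom ≫
          η.app (P.obj a) ◁ (G.mapComp (P.map f) (α.app b)).hom := by
        rw [h1]; simp
      change F.map (P.map f) ◁ (η.naturality (α.app b)).hom ≫ (α_ _ _ _).inv ≫
          (η.naturality (P.map f)).hom ▷ G.map (α.app b) ≫ (α_ _ _ _).hom ≫
          η.app (P.obj a) ◁ ((G.mapComp (P.map f) (α.app b)).inv ≫ G.map₂ (α.naturality f).hom ≫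
            (G.mapComp (α.app a) (Q.map f)).hom) ≫ (α_ _ _ _).inv =
        ((α_ _ _ _).inv ≫ ((F.mapComp (P.map f) (α.app b)).inv ≫ F.map₂ (α.naturality f).hom ≫
            (F.mapComp (α.app a) (Q.map f)).hom) ▷ η.app (Q.obj b) ≫ (α_ _ _ _).hom ≫
          F.map (α.app a) ◁ (η.naturality (Q.map f)).hom ≫ (α_ _ _ _).inv) ≫
          (η.naturality (α.app a)).hom ▷ G.map (Q.map f)
      rw [reassoc_of% h1']
      simp only [whiskerLeft_comp, comp_whiskerRight, Category.assoc]
      rw [whiskerLeft_hom_inv_assoc, ← reassoc_of% h2, reassoc_of% h3]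
      simp only [Iso.hom_inv_id, Category.comp_id])).symm
  naturality_naturality {F G η θ} Γ := Pseudofunctor.StrongTrans.homCategory.ext fun b => by
    change Γ.as.app (P.obj b) ▷ G.map (α.app b) ≫ (θ.naturality (α.app b)).inv =
      (η.naturality (α.app b)).inv ≫ F.map (α.app b) ◁ Γ.as.app (Q.obj b)
    rw [Iso.comp_inv_eq, Category.assoc, Γ.as.naturality, Iso.inv_hom_id_assoc]
  naturality_id F := Pseudofunctor.StrongTrans.homCategory.ext fun b => by
    change (Pseudofunctor.StrongTrans.naturality (𝟙 F) (α.app b)).inv ≫ _ ◁ 𝟙 _ = 𝟙 _ ▷ _ ≫ (λ_ _).hom ≫ (ρ_ _).inv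
    simp
    exact Category.comp_id _
  naturality_comp {F G H} η θ := Pseudofunctor.StrongTrans.homCategory.ext fun b => by
    change (((((α_ _ _ _).hom ≫ η.app (P.obj b) ◁ (θ.naturality (α.app b)).inv) ≫
      (α_ _ _ _).inv) ≫ (η.naturality (α.app b)).inv ▷ θ.app (Q.obj b)) ≫ (α_ _ _ _).hom) ≫
      F.map (α.app b) ◁ 𝟙 (η.app (Q.obj b) ≫ θ.app (Q.obj b)) =
      𝟙 _ ▷ _ ≫ (α_ _ _ _).hom ≫ η.app (P.obj b) ◁ (θ.naturality (α.app b)).inv ≫ (α_ _ _ _).inv ≫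
       (η.naturality (α.app b)).inv ▷ θ.app (Q.obj b) ≫ (α_ _ _ _).hom
    simp
end Generic

/-! ### Prederivators -/

/-- A prederivator: a 2-functor `Catᵒᵖ → CAT`, reversing 1-cells and preserving 2-cells.
Morphisms are pseudonatural transformations, transformations are modifications. -/
abbrev Prederivator := Cat.{u, u}ᵒᵖ ⥤ᵖ Cat.{v, w}

namespace Prederivator

variable (D : Prederivator.{u, v, w})

/-- The category `D(A)` of coherent `A`-shaped diagrams. -/
abbrev val (A : Cat.{u, u}) : Cat.{v, w} := D.obj (op A)

/-- Restriction `u^* : D(B) ⥤ D(A)`. -/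
abbrev res {A B : Cat.{u, u}} (f : A ⟶ B) : D.val B ⥤ D.val A := (D.map f.op).toFunctor

/-- The transformation `f^* ⟶ g^*` induced by `f ⟶ g`. -/
abbrev resMap {A B : Cat.{u, u}} {f g : A ⟶ B} (α : f ⟶ g) : D.res f ⟶ D.res g :=
  (D.map₂ (Bicategory.Opposite.op2 α)).toNatTrans

/-- `(f ≫ g)^* ≅ f^* g^*`. -/
abbrev resComp {A B C : Cat.{u, u}} (f : A ⟶ B) (g : B ⟶ C) :
    D.res (f ≫ g) ≅ D.res g ⋙ D.res f :=
  Cat.Hom.toNatIso (D.mapComp g.op f.op)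

/-- The transformation `p^* f^* ⟶ q^* g^*` induced by a square `p ≫ f ⟶ q ≫ g`. -/
abbrev resSquare {A B C P : Cat.{u, u}} {p : P ⟶ A} {f : A ⟶ C} {q : P ⟶ B} {g : B ⟶ C}
    (α : p ≫ f ⟶ q ≫ g) : D.res f ⋙ D.res p ⟶ D.res g ⋙ D.res q :=
  (D.resComp p f).inv ≫ D.resMap α ≫ (D.resComp q g).hom

/-- The shifted prederivator `D^K`, `D^K(A) = D(K × A)`. -/
abbrev shift (K : Cat.{u, u}) : Prederivator.{u, v, w} := compPs (prodPs K) D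

/-- The restriction morphism `f^* : D^L ⟶ D^K`. -/
abbrev shiftRes {K L : Cat.{u, u}} (f : K ⟶ L) : D.shift L ⟶ D.shift K :=
  postcompTrans (prodTrans f) D

/-- Evaluation `D^K(A) ⥤ D(A)`, `X ↦ X_k`. -/
abbrev eval {K : Cat.{u, u}} (k : K) (A : Cat.{u, u}) : D.val (prodCat K A) ⥤ D.val A :=
  D.res (CategoryTheory.Prod.sectR k A).toCatHom

end Prederivator

/-- The terminal category. -/
abbrev ptCat : Cat.{u, u} := Cat.of (Discrete PUnit.{u + 1})

/-- The functor from the terminal category classifying an object. -/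
abbrev ptHom {A : Cat.{u, u}} (a : A) : ptCat.{u} ⟶ A := (Functor.fromPUnit.{u} (C := A) a).toCatHom

/-- The unique functor to the terminal category. -/
abbrev toPt (A : Cat.{u, u}) : A ⟶ ptCat.{u} := (Functor.star.{u} A).toCatHom

/-! ### Derivators -/

/-- The slice category `(f/b)`. -/
abbrev overCat {A B : Cat.{u, u}} (f : A ⟶ B) (b : B) : Cat.{u, u} :=
  Cat.of (CostructuredArrow f.toFunctor b)

/-- The slice category `(b/f)`. -/
abbrev underCat {A B : Cat.{u, u}} (f : A ⟶ B) (b : B) : Cat.{u, u} :=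
  Cat.of (StructuredArrow b f.toFunctor)

abbrev overProj {A B : Cat.{u, u}} (f : A ⟶ B) (b : B) : overCat f b ⟶ A :=
  (CostructuredArrow.proj f.toFunctor b).toCatHom

abbrev underProj {A B : Cat.{u, u}} (f : A ⟶ B) (b : B) : underCat f b ⟶ A :=
  (StructuredArrow.proj b f.toFunctor).toCatHom

/-- The canonical transformation `f p ⟶ b π` on `(f/b)`. -/
def overCell {A B : Cat.{u, u}} (f : A ⟶ B) (b : B) :
    overProj f b ≫ f ⟶ toPt (overCat f b) ≫ ptHom b :=
  Cat.Hom₂.ofNatTrans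
    { app := fun x => x.hom
      naturality := fun _ _ g => (CostructuredArrow.w g).trans (Category.comp_id _).symm }

/-- The canonical transformation `b π ⟶ f q` on `(b/f)`. -/
def underCell {A B : Cat.{u, u}} (f : A ⟶ B) (b : B) :
    toPt (underCat f b) ≫ ptHom b ⟶ underProj f b ≫ f :=
  Cat.Hom₂.ofNatTrans
    { app := fun x => x.hom
      naturality := fun _ _ g => (Category.id_comp _).trans (StructuredArrow.w g).symm }

/-- The derivator axioms. -/
structure IsDerivator (D : Prederivator.{u, v, w}) : Prop where
  /-- Coproducts are sent to products. -/
  der1 : ∀ (ι : Type u) (A : ι → Cat.{u, u}),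
    (Functor.pi' fun i => D.res (B := Cat.of (Σ i, A i))
      (CategoryTheory.Sigma.incl (C := fun i => A i) i).toCatHom).IsEquivalence
  /-- Isomorphisms are detected pointwise. -/
  der2 : ∀ {A : Cat.{u, u}} {X Y : D.val A} (f : X ⟶ Y),
    IsIso f ↔ ∀ a : A, IsIso ((D.res (ptHom a)).map f)
  /-- Left Kan extensions exist. -/
  der3_left : ∀ {A B : Cat.{u, u}} (f : A ⟶ B), (D.res f).IsRightAdjoint
  /-- Right Kan extensions exist. -/
  der3_right : ∀ {A B : Cat.{u, u}} (f : A ⟶ B), (D.res f).IsLeftAdjoint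
  /-- Left Kan extensions are computed pointwise: `π_! p^* ⟶ b^* f_!` is invertible. -/
  der4_left : ∀ {A B : Cat.{u, u}} (f : A ⟶ B) (b : B)
    {L : D.val A ⥤ D.val B} (adj : L ⊣ D.res f)
    {L' : D.val (overCat f b) ⥤ D.val ptCat} (adj' : L' ⊣ D.res (toPt (overCat f b))),
    IsIso ((mateEquiv adj adj').symm (.mk _ _ _ _ (D.resSquare (overCell f b)))).natTrans
  /-- Right Kan extensions are computed pointwise: `b^* f_* ⟶ π_* q^*` is invertible. -/
  der4_right : ∀ {A B : Cat.{u, u}} (f : A ⟶ B) (b : B)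
    {R : D.val A ⥤ D.val B} (adj : D.res f ⊣ R)
    {R' : D.val (underCat f b) ⥤ D.val ptCat} (adj' : D.res (toPt (underCat f b)) ⊣ R'),
    IsIso ((mateEquiv adj adj') (.mk _ _ _ _ (D.resSquare (underCell f b)))).natTrans

/-! ### Squares, stability, exactness -/

/-- The poset `[1] × [1]`. -/
@[ext]
structure Sq : Type u where
  i : Fin 2
  j : Fin 2

instance : Preorder Sq.{u} := Preorder.lift fun x => (x.i, x.j)

abbrev sqCat : Cat.{u, u} := Cat.of Sq.{u}

/-- The square without its terminal object. -/
abbrev spanCat : Cat.{u, u} := Cat.of {x : Sq.{u} // x ≠ ⟨1, 1⟩}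

/-- The square without its initial object. -/
abbrev cospanCat : Cat.{u, u} := Cat.of {x : Sq.{u} // x ≠ ⟨0, 0⟩}

abbrev spanIncl : spanCat.{u} ⟶ sqCat.{u} := (Subtype.mono_coe (· ≠ _)).functor.toCatHom

abbrev cospanIncl : cospanCat.{u} ⟶ sqCat.{u} := (Subtype.mono_coe (· ≠ _)).functor.toCatHom

namespace Prederivator

variable (D : Prederivator.{u, v, w})

/-- A square `Q ∈ D^□(A)` is cocartesian if it lies in the essential image of the left Kan
extension functor along the inclusion of the span. -/
def IsCocartesian {A : Cat.{u, u}} (Q : D.val (prodCat sqCat A)) : Prop :=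
  ∃ (L : D.val (prodCat spanCat A) ⥤ D.val (prodCat sqCat A))
    (_ : L ⊣ D.res (prodMap spanIncl (𝟙 A))), L.essImage Q

/-- A square `Q ∈ D^□(A)` is cartesian if it lies in the essential image of the right Kan
extension functor along the inclusion of the cospan. -/
def IsCartesian {A : Cat.{u, u}} (Q : D.val (prodCat sqCat A)) : Prop :=
  ∃ (R : D.val (prodCat cospanCat A) ⥤ D.val (prodCat sqCat A))
    (_ : D.res (prodMap cospanIncl (𝟙 A)) ⊣ R), R.essImage Q

def IsBicartesian {A : Cat.{u, u}} (Q : D.val (prodCat sqCat A)) : Prop :=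
  D.IsCocartesian Q ∧ D.IsCartesian Q

end Prederivator

/-- A stable derivator: a pointed derivator in which cartesian and cocartesian squares agree. -/
structure IsStableDerivator (D : Prederivator.{u, v, w}) : Prop extends IsDerivator D where
  pointed : Limits.HasZeroObject (D.val ptCat)
  stable : ∀ {A : Cat.{u, u}} (Q : D.val (prodCat sqCat A)), D.IsCocartesian Q ↔ D.IsCartesian Q

/-- A morphism is exact if it is right exact (preserves initial objects and cocartesian squares)
and left exact (preserves terminal objects and cartesian squares). -/
structure IsExact {D E : Prederivator.{u, v, w}} (G : D ⟶ E) : Prop where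
  initial : ∀ {A : Cat.{u, u}} (X : D.val A), Nonempty (Limits.IsInitial X) →
    Nonempty (Limits.IsInitial ((G.app (op A)).toFunctor.obj X))
  terminal : ∀ {A : Cat.{u, u}} (X : D.val A), Nonempty (Limits.IsTerminal X) →
    Nonempty (Limits.IsTerminal ((G.app (op A)).toFunctor.obj X))
  cocartesian : ∀ {A : Cat.{u, u}} (Q : D.val (prodCat sqCat A)), D.IsCocartesian Q →
    E.IsCocartesian ((G.app (op (prodCat sqCat A))).toFunctor.obj Q)
  cartesian : ∀ {A : Cat.{u, u}} (Q : D.val (prodCat sqCat A)), D.IsCartesian Q →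
    E.IsCartesian ((G.app (op (prodCat sqCat A))).toFunctor.obj Q)

lemma IsExact.id (D : Prederivator.{u, v, w}) : IsExact (𝟙 D) where
  initial _ h := h
  terminal _ h := h
  cocartesian _ h := h
  cartesian _ h := h

lemma IsExact.comp {D E F : Prederivator.{u, v, w}} {G : D ⟶ E} {H : E ⟶ F}
    (hG : IsExact G) (hH : IsExact H) : IsExact (G ≫ H) where
  initial _ h := hH.initial _ (hG.initial _ h)
  terminal _ h := hH.terminal _ (hG.terminal _ h)
  cocartesian _ h := hH.cocartesian _ (hG.cocartesian _ h)
  cartesian _ h := hH.cartesian _ (hG.cartesian _ h)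

/-! ### The 2-category of stable derivators and exact morphisms -/

structure StableDerivator where
  pre : Prederivator.{u, v, w}
  isStable : IsStableDerivator pre

structure ExactMorphism (D E : StableDerivator.{u, v, w}) where
  mor : D.pre ⟶ E.pre
  isExact : IsExact mor

instance ExactMorphism.category (D E : StableDerivator.{u, v, w}) : Category (ExactMorphism D E) where
  Hom G H := G.mor ⟶ H.mor
  id G := 𝟙 G.mor
  comp Γ Γ' := CategoryStruct.comp (obj := D.pre ⟶ E.pre) Γ Γ'
  id_comp Γ := Category.id_comp (obj := D.pre ⟶ E.pre) Γ
  comp_id Γ := Category.comp_id (obj := D.pre ⟶ E.pre) Γ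
  assoc Γ Γ' Γ'' := Category.assoc (obj := D.pre ⟶ E.pre) Γ Γ' Γ''

abbrev ExactMorphism.isoMk {D E : StableDerivator.{u, v, w}} {G H : ExactMorphism D E}
    (e : G.mor ≅ H.mor) : G ≅ H where
  hom := e.hom
  inv := e.inv
  hom_inv_id := e.hom_inv_id
  inv_hom_id := e.inv_hom_id

instance : CategoryStruct StableDerivator.{u, v, w} where
  Hom D E := ExactMorphism D E
  id D := ⟨𝟙 D.pre, .id D.pre⟩
  comp G H := ⟨G.mor ≫ H.mor, G.isExact.comp H.isExact⟩

/-- Stable derivators, exact morphisms and all transformations between them. -/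
instance : Bicategory StableDerivator.{u, v, w} where
  homCategory D E := ExactMorphism.category D E
  whiskerLeft G _ _ Γ := G.mor ◁ Γ
  whiskerRight {D E F G H} Γ K :=
    Bicategory.whiskerRight (B := Prederivator) (f := G.mor) (g := H.mor) Γ K.mor
  associator G H K := ExactMorphism.isoMk (α_ G.mor H.mor K.mor)
  leftUnitor G := ExactMorphism.isoMk (λ_ G.mor)
  rightUnitor G := ExactMorphism.isoMk (ρ_ G.mor)
  whiskerLeft_id G H := Pseudofunctor.StrongTrans.homCategory.ext fun b =>
    Bicategory.whiskerLeft_id (G.mor.app b) (H.mor.app b)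
  whiskerLeft_comp G _ _ _ Γ Γ' := Pseudofunctor.StrongTrans.homCategory.ext fun b =>
    Bicategory.whiskerLeft_comp (G.mor.app b) (Γ.as.app b) (Γ'.as.app b)
  id_whiskerLeft Γ := Pseudofunctor.StrongTrans.homCategory.ext fun b =>
    Bicategory.id_whiskerLeft (Γ.as.app b)
  comp_whiskerLeft G H _ _ Γ := Pseudofunctor.StrongTrans.homCategory.ext fun b =>
    Bicategory.comp_whiskerLeft (G.mor.app b) (H.mor.app b) (Γ.as.app b)
  id_whiskerRight G H := Pseudofunctor.StrongTrans.homCategory.ext fun b =>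
    Bicategory.id_whiskerRight (G.mor.app b) (H.mor.app b)
  comp_whiskerRight Γ Γ' H := Pseudofunctor.StrongTrans.homCategory.ext fun b =>
    Bicategory.comp_whiskerRight (Γ.as.app b) (Γ'.as.app b) (H.mor.app b)
  whiskerRight_id Γ := Pseudofunctor.StrongTrans.homCategory.ext fun b =>
    Bicategory.whiskerRight_id (Γ.as.app b)
  whiskerRight_comp Γ G H := Pseudofunctor.StrongTrans.homCategory.ext fun b =>
    Bicategory.whiskerRight_comp (Γ.as.app b) (G.mor.app b) (H.mor.app b)
  whisker_assoc G _ _ Γ H := Pseudofunctor.StrongTrans.homCategory.ext fun b =>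
    Bicategory.whisker_assoc (G.mor.app b) (Γ.as.app b) (H.mor.app b)
  whisker_exchange Γ Γ' := Pseudofunctor.StrongTrans.homCategory.ext fun b =>
    Bicategory.whisker_exchange (Γ.as.app b) (Γ'.as.app b)
  pentagon G H K L := Pseudofunctor.StrongTrans.homCategory.ext fun b =>
    Bicategory.pentagon (G.mor.app b) (H.mor.app b) (K.mor.app b) (L.mor.app b)
  triangle G H := Pseudofunctor.StrongTrans.homCategory.ext fun b =>
    Bicategory.triangle (G.mor.app b) (H.mor.app b)

/-- The inclusion of stable derivators and exact morphisms into prederivators. -/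
abbrev forgetPs : StableDerivator.{u, v, w} ⥤ᵖ Prederivator.{u, v, w} where
  obj D := D.pre
  map G := ExactMorphism.mor G
  map₂ Γ := Γ
  mapId D := Iso.refl (𝟙 D.pre)
  mapComp G H := Iso.refl (ExactMorphism.mor G ≫ ExactMorphism.mor H)
  map₂_whisker_left {D E F} G _ _ Γ := by
    exact ((Category.id_comp (obj := D.pre ⟶ F.pre) _).trans
      (Category.comp_id (obj := D.pre ⟶ F.pre) _)).symm
  map₂_whisker_right {D E F _ _} Γ G := by
    exact ((Category.id_comp (obj := D.pre ⟶ F.pre) _).trans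
      (Category.comp_id (obj := D.pre ⟶ F.pre) _)).symm
  map₂_associator G H K := by
    change (α_ (ExactMorphism.mor G) (ExactMorphism.mor H) (ExactMorphism.mor K)).hom =
      𝟙 _ ≫ 𝟙 _ ▷ ExactMorphism.mor K ≫ (α_ _ _ _).hom ≫ ExactMorphism.mor G ◁ 𝟙 _ ≫ 𝟙 _
    simp
  map₂_left_unitor G := by
    change (λ_ (ExactMorphism.mor G)).hom = 𝟙 _ ≫ 𝟙 _ ▷ ExactMorphism.mor G ≫ (λ_ _).hom
    simp
  map₂_right_unitor G := by
    change (ρ_ (ExactMorphism.mor G)).hom = 𝟙 _ ≫ ExactMorphism.mor G ◁ 𝟙 _ ≫ (ρ_ _).hom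
    simp

/-- The 2-functor `D ↦ D^K`. -/
abbrev shiftPs (K : Cat.{u, u}) : StableDerivator.{u, v, w} ⥤ᵖ Prederivator.{u, v, w} :=
  compPs forgetPs (precompPs (prodPs K))

/-! ### The mesh category -/

/-- A vertex `(k, l)`, `k ∈ ℤ`, `0 ≤ l ≤ n + 1`, of the repetitive quiver of `(0 < ⋯ < n + 1)`. -/
@[ext]
structure RepVertex (n : ℕ) : Type u where
  k : ℤ
  l : ℕ
  hl : l ≤ n + 1

/-- The edges of the repetitive quiver of `(0 < ⋯ < n + 1)`:
for every edge `β : l → l + 1` there are edges `β : (k, l) → (k, l + 1)` and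
`β* : (k, l + 1) → (k + 1, l)`. -/
inductive RepVertex.Edge {n : ℕ} (x y : RepVertex.{u} n) : Type u
  | edge (hk : y.k = x.k) (hl : y.l = x.l + 1) : RepVertex.Edge x y
  | star (hk : y.k = x.k + 1) (hl : x.l = y.l + 1) : RepVertex.Edge x y

instance (n : ℕ) : Quiver (RepVertex.{u} n) := ⟨RepVertex.Edge⟩

/-- The relations forcing the squares of the repetitive quiver to commute. -/
inductive MeshRel (n : ℕ) : HomRel (Paths (RepVertex.{u} n))
  | square {a b c d : RepVertex.{u} n} (e₁ : b.k = a.k) (e₂ : b.l = a.l + 1)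
      (e₃ : d.k = b.k + 1) (e₄ : b.l = d.l + 1) (e₅ : c.k = a.k + 1) (e₆ : a.l = c.l + 1)
      (e₇ : d.k = c.k) (e₈ : d.l = c.l + 1) :
      MeshRel n
        (Quiver.Path.cons (Quiver.Path.cons .nil (RepVertex.Edge.edge (x := a) e₁ e₂))
          (RepVertex.Edge.star (x := b) (y := d) e₃ e₄))
        (Quiver.Path.cons (Quiver.Path.cons .nil (RepVertex.Edge.star (x := a) e₅ e₆))
          (RepVertex.Edge.edge (x := c) (y := d) e₇ e₈))

/-- The mesh category: the free category on the repetitive quiver modulo the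
commutativity of all squares. -/
abbrev PresentedMesh (n : ℕ) : Type u := CategoryTheory.Quotient (MeshRel.{u} n)

/-- The mesh category `M_n` as a poset. `PresentedMesh.toMesh_isEquivalence` identifies it with
the category presented by the repetitive quiver and its mesh relations. -/
@[ext]
structure Mesh (n : ℕ) : Type u where
  k : ℤ
  l : ℕ
  hl : l ≤ n + 1

instance (n : ℕ) : Preorder (Mesh.{u} n) := Preorder.lift fun x => (x.k, x.k + (x.l : ℤ))

lemma Mesh.le_iff {n : ℕ} {x y : Mesh.{u} n} :
    x ≤ y ↔ x.k ≤ y.k ∧ x.k + (x.l : ℤ) ≤ y.k + (y.l : ℤ) := Iff.rfl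

/-- The vertex `(k, l)` viewed as an element of the poset `M_n`. -/
def RepVertex.toMesh {n : ℕ} (x : RepVertex.{u} n) : Mesh.{u} n := ⟨x.k, x.l, x.hl⟩

def RepVertex.toMeshPrefunctor (n : ℕ) : RepVertex.{u} n ⥤q Mesh.{u} n where
  obj := RepVertex.toMesh
  map {x y} e := homOfLE (by
    rw [Mesh.le_iff]
    cases (show RepVertex.Edge x y from e) <;> simp only [RepVertex.toMesh] <;> omega)

/-- The canonical functor from the presented mesh category to the poset `M_n`. -/
def PresentedMesh.toMesh (n : ℕ) : PresentedMesh.{u} n ⥤ Mesh.{u} n :=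
  CategoryTheory.Quotient.lift _ (Paths.lift (RepVertex.toMeshPrefunctor n))
    (fun _ _ _ _ _ => Subsingleton.elim _ _)

lemma RepVertex.exists_path {n : ℕ} (N : ℕ) : ∀ (x y : RepVertex.{u} n), x.toMesh ≤ y.toMesh →
    2 * y.k + y.l ≤ 2 * x.k + x.l + N → Nonempty (Quiver.Path x y) := by
  induction N with
  | zero =>
    intro x y h h'
    rw [Mesh.le_iff] at h
    simp only [toMesh] at h
    obtain rfl : x = y := by ext <;> omega
    exact ⟨.nil⟩
  | succ N ih =>
    intro x y h h'
    rw [Mesh.le_iff] at h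
    simp only [toMesh] at h
    have hx := x.hl
    have hy := y.hl
    by_cases h₁ : 1 ≤ y.l ∧ x.k + x.l ≤ y.k + y.l - 1
    · obtain ⟨p⟩ := ih x ⟨y.k, y.l - 1, by omega⟩
        (by rw [Mesh.le_iff]; simp only [toMesh]; omega) (by simp only; omega)
      exact ⟨p.cons (Edge.edge rfl (by simp only; omega))⟩
    · by_cases h₂ : x.k ≤ y.k - 1 ∧ y.l ≤ n
      · obtain ⟨p⟩ := ih x ⟨y.k - 1, y.l + 1, by omega⟩
          (by rw [Mesh.le_iff]; simp only [toMesh]; omega) (by simp only; omega)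
        exact ⟨p.cons (Edge.star (by simp only; omega) rfl)⟩
      · obtain rfl : x = y := by ext <;> omega
        exact ⟨.nil⟩

lemma RepVertex.le_of_path {n : ℕ} {x y : RepVertex.{u} n} (p : Quiver.Path x y) :
    x.toMesh ≤ y.toMesh :=
  leOfHom ((Paths.lift (RepVertex.toMeshPrefunctor.{u} n)).map p)

/-- The class of a path in the mesh category. -/
abbrev PresentedMesh.mk {n : ℕ} {x y : RepVertex.{u} n} (p : Quiver.Path x y) :
    (⟨x⟩ : PresentedMesh.{u} n) ⟶ ⟨y⟩ :=
  (CategoryTheory.Quotient.functor (MeshRel.{u} n)).map p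

lemma RepVertex.square_comm {n : ℕ} {x a b c d : RepVertex.{u} n} (p : Quiver.Path x a)
    (e₁ : b.k = a.k) (e₂ : b.l = a.l + 1)
    (e₃ : d.k = b.k + 1) (e₄ : b.l = d.l + 1) (e₅ : c.k = a.k + 1) (e₆ : a.l = c.l + 1)
    (e₇ : d.k = c.k) (e₈ : d.l = c.l + 1) :
    PresentedMesh.mk ((p.cons (Edge.edge e₁ e₂)).cons (Edge.star e₃ e₄)) =
      PresentedMesh.mk ((p.cons (Edge.star e₅ e₆)).cons (Edge.edge e₇ e₈)) :=
  congrArg (PresentedMesh.mk p ≫ ·)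
    (CategoryTheory.Quotient.sound _ (MeshRel.square e₁ e₂ e₃ e₄ e₅ e₆ e₇ e₈))

lemma RepVertex.mk_cons {n : ℕ} {x a b : RepVertex.{u} n} {p q : Quiver.Path x a}
    (h : PresentedMesh.mk p = PresentedMesh.mk q) (e : a ⟶ b) :
    PresentedMesh.mk (p.cons e) = PresentedMesh.mk (q.cons e) :=
  congrArg (· ≫ PresentedMesh.mk e.toPath) h

lemma RepVertex.mk_eq {n : ℕ} (N : ℕ) : ∀ {x y : RepVertex.{u} n} (p q : Quiver.Path x y),
    2 * y.k + y.l ≤ 2 * x.k + x.l + N → PresentedMesh.mk p = PresentedMesh.mk q := by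
  induction N with
  | zero =>
    intro x y p q h
    have key : ∀ {z : RepVertex.{u} n} (p : Quiver.Path x z),
        2 * z.k + z.l ≤ 2 * x.k + x.l → ∃ e : x = z, p = e ▸ .nil := by
      intro z p h
      cases p with
      | nil => exact ⟨rfl, rfl⟩
      | cons p e =>
        have := RepVertex.le_of_path p
        rw [Mesh.le_iff] at this
        simp only [toMesh] at this
        cases (show RepVertex.Edge _ _ from e) <;> omega
    obtain ⟨e, rfl⟩ := key p (by omega)
    obtain ⟨_, rfl⟩ := key q (by omega)
    rfl
  | succ N ih =>
    have aux : ∀ {x a b y : RepVertex.{u} n} (p : Quiver.Path x a) (q : Quiver.Path x b)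
        (h₁ : y.k = a.k) (h₂ : y.l = a.l + 1) (h₃ : y.k = b.k + 1) (h₄ : b.l = y.l + 1),
        2 * y.k + y.l ≤ 2 * x.k + x.l + ((N + 1 : ℕ) : ℤ) →
        PresentedMesh.mk (p.cons (Edge.edge h₁ h₂)) =
          PresentedMesh.mk (q.cons (Edge.star h₃ h₄)) := by
      intro x a b y p q h₁ h₂ h₃ h₄ h
      have hp := RepVertex.le_of_path p
      have hq := RepVertex.le_of_path q
      rw [Mesh.le_iff] at hp hq
      simp only [toMesh] at hp hq
      have hb := b.hl
      obtain ⟨r⟩ := RepVertex.exists_path N x ⟨b.k, a.l + 1, by omega⟩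
        (by rw [Mesh.le_iff]; simp only [toMesh]; omega) (by simp only; omega)
      have e₁ := ih p (r.cons (Edge.star (by simp only; omega) rfl)) (by omega)
      have e₂ := ih q (r.cons (Edge.edge rfl (by simp only; omega))) (by omega)
      rw [mk_cons e₁, mk_cons e₂]
      exact (square_comm r _ _ _ _ _ _ _ _).symm
    intro x y p q h
    cases p with
    | nil =>
      cases q with
      | nil => rfl
      | cons q f =>
        have := RepVertex.le_of_path q
        rw [Mesh.le_iff] at this
        simp only [toMesh] at this
        cases (show RepVertex.Edge _ _ from f) <;> omega
    | @cons a _ p e =>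
      cases q with
      | nil =>
        have := RepVertex.le_of_path p
        rw [Mesh.le_iff] at this
        simp only [toMesh] at this
        cases (show RepVertex.Edge _ _ from e) <;> omega
      | @cons b _ q f =>
        match e, f with
        | .edge h₁ h₂, .edge h₃ h₄ =>
          obtain rfl : a = b := by ext <;> omega
          exact mk_cons (ih p q (by omega)) _
        | .star h₁ h₂, .star h₃ h₄ =>
          obtain rfl : a = b := by ext <;> omega
          exact mk_cons (ih p q (by omega)) _
        | .edge h₁ h₂, .star h₃ h₄ => exact aux p q h₁ h₂ h₃ h₄ h
        | .star h₁ h₂, .edge h₃ h₄ => exact (aux q p h₃ h₄ h₁ h₂ h).symm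

theorem PresentedMesh.toMesh_isEquivalence (n : ℕ) :
    (PresentedMesh.toMesh.{u} n).IsEquivalence where
  faithful := ⟨fun {x y} f g _ => by
    obtain ⟨p, rfl⟩ := (CategoryTheory.Quotient.functor (MeshRel.{u} n)).map_surjective f
    obtain ⟨q, rfl⟩ := (CategoryTheory.Quotient.functor (MeshRel.{u} n)).map_surjective g
    exact RepVertex.mk_eq
      (2 * y.as.k + y.as.l - (2 * x.as.k + x.as.l)).toNat p q (by omega)⟩
  full := ⟨fun {x y} f => by
    obtain ⟨p⟩ := RepVertex.exists_path
      (2 * y.as.k + y.as.l - (2 * x.as.k + x.as.l)).toNat x.as y.as (leOfHom f) (by omega)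
    exact ⟨(CategoryTheory.Quotient.functor (MeshRel.{u} n)).map p, Subsingleton.elim _ _⟩⟩
  essSurj := ⟨fun y => ⟨⟨⟨y.k, y.l, y.hl⟩⟩, ⟨Iso.refl y⟩⟩⟩


namespace Mesh

variable {n : ℕ}

/-- The objects of `A_n`, viewed in `M_n`. -/
def InChain (x : Mesh.{u} n) : Prop := x.k = 0 ∧ 1 ≤ x.l ∧ x.l ≤ n

/-- The objects of `K₁`: add `(k, n + 1)`, `k ≥ 0`, and `(k, 0)`, `k > 0`. -/
def InK₁ (x : Mesh.{u} n) : Prop :=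
  x.InChain ∨ (0 ≤ x.k ∧ x.l = n + 1) ∨ (0 < x.k ∧ x.l = 0)

/-- The objects of `K₂`: add `(k, l)`, `k > 0`. -/
def InK₂ (x : Mesh.{u} n) : Prop := x.InK₁ ∨ 0 < x.k

/-- The objects of `K₃`: add `(k, n + 1)`, `k < 0`, and `(k, 0)`, `k ≤ 0`. -/
def InK₃ (x : Mesh.{u} n) : Prop :=
  x.InK₂ ∨ (x.k < 0 ∧ x.l = n + 1) ∨ (x.k ≤ 0 ∧ x.l = 0)

end Mesh

/-- The poset `A_n = (1 < ⋯ < n)`. -/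
@[ext]
structure Chain (n : ℕ) : Type u where
  l : ℕ
  one_le : 1 ≤ l
  le : l ≤ n

instance (n : ℕ) : Preorder (Chain.{u} n) := Preorder.lift Chain.l

abbrev chainCat (n : ℕ) : Cat.{u, u} := Cat.of (Chain.{u} n)

abbrev meshCat (n : ℕ) : Cat.{u, u} := Cat.of (Mesh.{u} n)

abbrev catK₁ (n : ℕ) : Cat.{u, u} := Cat.of {x : Mesh.{u} n // x.InK₁}

abbrev catK₂ (n : ℕ) : Cat.{u, u} := Cat.of {x : Mesh.{u} n // x.InK₂}

abbrev catK₃ (n : ℕ) : Cat.{u, u} := Cat.of {x : Mesh.{u} n // x.InK₃}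

/-- The inclusion `i : A_n → M_n`, `l ↦ (0, l)`. -/
def incl (n : ℕ) : chainCat.{u} n ⟶ meshCat.{u} n :=
  (show Monotone fun x : Chain.{u} n => (⟨0, x.l, x.le.trans n.le_succ⟩ : Mesh.{u} n) from
    fun x y (h : x.l ≤ y.l) => Mesh.le_iff.2 (by simp only; omega)).functor.toCatHom

def incl₁ (n : ℕ) : chainCat.{u} n ⟶ catK₁.{u} n :=
  (show Monotone fun x : Chain.{u} n =>
      (⟨⟨0, x.l, x.le.trans n.le_succ⟩, .inl ⟨rfl, x.one_le, x.le⟩⟩ : {x : Mesh.{u} n // x.InK₁})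
    from fun x y (h : x.l ≤ y.l) => Mesh.le_iff.2 (by simp only; omega)).functor.toCatHom

def incl₂ (n : ℕ) : catK₁.{u} n ⟶ catK₂.{u} n :=
  (show Monotone fun x : {x : Mesh.{u} n // x.InK₁} =>
      (⟨x.1, .inl x.2⟩ : {x : Mesh.{u} n // x.InK₂}) from fun _ _ h => h).functor.toCatHom

def incl₃ (n : ℕ) : catK₂.{u} n ⟶ catK₃.{u} n :=
  (show Monotone fun x : {x : Mesh.{u} n // x.InK₂} =>
      (⟨x.1, .inl x.2⟩ : {x : Mesh.{u} n // x.InK₃}) from fun _ _ h => h).functor.toCatHom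

def incl₄ (n : ℕ) : catK₃.{u} n ⟶ meshCat.{u} n :=
  (show Monotone fun x : {x : Mesh.{u} n // x.InK₃} => x.1 from fun _ _ h => h).functor.toCatHom

lemma incl_eq (n : ℕ) : incl.{u} n = incl₁ n ≫ incl₂ n ≫ incl₃ n ≫ incl₄ n := rfl

/-- The square with vertices `(k, l)`, `(k, l + 1)`, `(k + 1, l - 1)`, `(k + 1, l)` in `M_n`. -/
def meshSquare (n : ℕ) (k : ℤ) (l : ℕ) (h₁ : 1 ≤ l) (h₂ : l ≤ n) :
    sqCat.{u} ⟶ meshCat.{u} n :=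
  (show Monotone fun x : Sq.{u} =>
      (⟨k + (x.j : ℕ), l + (x.i : ℕ) - (x.j : ℕ), by omega⟩ : Mesh.{u} n) from
    fun x y h => Mesh.le_iff.2 (by
      have h₃ : (x.i : ℕ) ≤ y.i := h.1
      have h₄ : (x.j : ℕ) ≤ y.j := h.2
      simp only
      omega)).functor.toCatHom

/-! ### The exact coherent diagrams on the mesh category -/

/-- `X ∈ D^{M_n}(A)` vanishes at all `(k, 0)`, `(k, n + 1)` and makes all squares bicartesian. -/
structure IsExactDiagram (n : ℕ) (D : Prederivator.{u, v, w}) (A : Cat.{u, u})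
    (X : D.val (prodCat (meshCat n) A)) : Prop where
  bot : ∀ k : ℤ, Limits.IsZero ((D.eval (K := meshCat n) ⟨k, 0, Nat.zero_le _⟩ A).obj X)
  top : ∀ k : ℤ, Limits.IsZero ((D.eval (K := meshCat n) ⟨k, n + 1, le_rfl⟩ A).obj X)
  square : ∀ (k : ℤ) (l : ℕ) (h₁ : 1 ≤ l) (h₂ : l ≤ n),
    D.IsBicartesian ((D.res (prodMap (meshSquare n k l h₁ h₂) (𝟙 A))).obj X)

namespace Prederivator

variable {D : Prederivator.{u, v, w}}

lemma IsCocartesian.of_iso {A : Cat.{u, u}} {Q Q' : D.val (prodCat sqCat A)} (e : Q ≅ Q')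
    (h : D.IsCocartesian Q) : D.IsCocartesian Q' := by
  obtain ⟨L, adj, h⟩ := h
  exact ⟨L, adj, Functor.essImage.ofIso e h⟩

lemma IsCartesian.of_iso {A : Cat.{u, u}} {Q Q' : D.val (prodCat sqCat A)} (e : Q ≅ Q')
    (h : D.IsCartesian Q) : D.IsCartesian Q' := by
  obtain ⟨R, adj, h⟩ := h
  exact ⟨R, adj, Functor.essImage.ofIso e h⟩

lemma IsBicartesian.of_iso {A : Cat.{u, u}} {Q Q' : D.val (prodCat sqCat A)} (e : Q ≅ Q')
    (h : D.IsBicartesian Q) : D.IsBicartesian Q' :=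
  ⟨h.1.of_iso e, h.2.of_iso e⟩

end Prederivator

lemma IsExactDiagram.of_iso {n : ℕ} {D : Prederivator.{u, v, w}} {A : Cat.{u, u}}
    {X Y : D.val (prodCat (meshCat n) A)} (e : X ≅ Y) (h : IsExactDiagram n D A X) :
    IsExactDiagram n D A Y where
  bot k := (h.bot k).of_iso ((D.eval _ A).mapIso e.symm)
  top k := (h.top k).of_iso ((D.eval _ A).mapIso e.symm)
  square k l h₁ h₂ := (h.square k l h₁ h₂).of_iso ((D.res _).mapIso e)

/-- The property defining `D^{M_n,ex} ⊆ D^{M_n}`. Closure under restriction along all `A' → A` is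
built in, so that a subprederivator is obtained for every prederivator; for derivators it is
automatic. -/
def exProp (n : ℕ) (D : Prederivator.{u, v, w}) :
    Pseudofunctor.ObjectProperty (D.shift (meshCat n)) where
  prop A X := ∀ (A' : Cat.{u, u}ᵒᵖ) (f : A ⟶ A'),
    IsExactDiagram n D A'.unop (((D.shift (meshCat n)).map f).toFunctor.obj X)

instance (n : ℕ) (D : Prederivator.{u, v, w}) : (exProp n D).IsClosedUnderMapObj where
  map_obj {_ _ M} hM f A' g := (hM A' (f ≫ g)).of_iso
    ((Cat.Hom.toNatIso ((D.shift (meshCat n)).mapComp f g)).app M)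

lemma IsExact.isZero {D E : Prederivator.{u, v, w}} {G : D ⟶ E} (hG : IsExact G)
    {A : Cat.{u, u}} {X : D.val A} (h : Limits.IsZero X) :
    Limits.IsZero ((G.app (op A)).toFunctor.obj X) := by
  obtain ⟨h₁⟩ := hG.initial X ⟨h.isInitial⟩
  obtain ⟨h₂⟩ := hG.terminal X ⟨h.isTerminal⟩
  exact ⟨fun Y => ⟨⟨⟨h₁.to Y⟩, fun f => h₁.hom_ext _ _⟩⟩,
    fun Y => ⟨⟨⟨h₂.from Y⟩, fun f => h₂.hom_ext _ _⟩⟩⟩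

/-- Morphisms of prederivators commute with restriction. -/
abbrev resIso {D E : Prederivator.{u, v, w}} (G : D ⟶ E) {A B : Cat.{u, u}} (f : A ⟶ B)
    (X : D.val B) : (G.app (op A)).toFunctor.obj ((D.res f).obj X) ≅
      (E.res f).obj ((G.app (op B)).toFunctor.obj X) :=
  (Cat.Hom.toNatIso (G.naturality f.op)).app X

lemma IsExactDiagram.map {n : ℕ} {D E : Prederivator.{u, v, w}} {G : D ⟶ E} (hG : IsExact G)
    {A : Cat.{u, u}} {X : D.val (prodCat (meshCat n) A)} (h : IsExactDiagram n D A X) :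
    IsExactDiagram n E A ((G.app (op (prodCat (meshCat n) A))).toFunctor.obj X) where
  bot k := (hG.isZero (h.bot k)).of_iso (resIso G _ X).symm
  top k := (hG.isZero (h.top k)).of_iso (resIso G _ X).symm
  square k l h₁ h₂ := Prederivator.IsBicartesian.of_iso (resIso G _ X)
    ⟨hG.cocartesian _ (h.square k l h₁ h₂).1, hG.cartesian _ (h.square k l h₁ h₂).2⟩

/-- The prederivator `D^{M_n,ex}`. -/
abbrev exMesh (n : ℕ) (D : Prederivator.{u, v, w}) : Prederivator.{u, v, w} :=
  (exProp n D).fullsubcategory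

/-- The inclusion `D^{M_n,ex} ⟶ D^{M_n}`. -/
abbrev exMeshι (n : ℕ) (D : Prederivator.{u, v, w}) : exMesh n D ⟶ D.shift (meshCat n) :=
  (exProp n D).ι

lemma exProp_map {n : ℕ} {D E : Prederivator.{u, v, w}} {G : D ⟶ E} (hG : IsExact G)
    (A : Cat.{u, u}ᵒᵖ) (X : D.val (prodCat (meshCat n) A.unop)) (h : (exProp n D).prop A X) :
    (exProp n E).prop A ((G.app (op (prodCat (meshCat n) A.unop))).toFunctor.obj X) :=
  fun A' f => ((h A' f).map hG).of_iso (resIso G ((prodPs (meshCat n)).map f).unop X)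

/-- The 2-functor `D ↦ D^{M_n,ex}` on stable derivators and exact morphisms. -/
abbrev exPs (n : ℕ) : StableDerivator.{u, v, w} ⥤ᵖ Prederivator.{u, v, w} where
  obj D := exMesh n D.pre
  map {D E} G := fullMap ((precompPs (prodPs (meshCat n))).map (ExactMorphism.mor G))
    (exProp_map (ExactMorphism.isExact G))
  map₂ {D E G H} Γ := fullMap₂ ((precompPs (prodPs (meshCat n))).map₂
    (f := ExactMorphism.mor G) (g := ExactMorphism.mor H) Γ) _ _
  mapId D := fullMapIso ((precompPs (prodPs (meshCat n))).mapId D.pre) _ (fun _ _ h => h) ≪≫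
    fullMapId _
  mapComp {D E F} G H := fullMapIso ((precompPs (prodPs (meshCat n))).mapComp
      (ExactMorphism.mor G) (ExactMorphism.mor H)) _
      (fun X M h => exProp_map (ExactMorphism.isExact H) X _
        (exProp_map (ExactMorphism.isExact G) X M h)) ≪≫
    fullMapComp _ _ _ _ _
  map₂_id _ := rfl
  map₂_comp _ _ := rfl
  map₂_whisker_left {D E F} G H K Γ := fullTrans_ext fun A M => by
    let M' : D.pre.val (prodCat (meshCat n) A.unop) := M.obj
    let g := (ExactMorphism.mor G).app (op (prodCat (meshCat n) A.unop))
    let Γ' : ExactMorphism.mor H ⟶ ExactMorphism.mor K := Γ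
    change (Γ'.as.app (op (prodCat (meshCat n) A.unop))).toNatTrans.app (g.toFunctor.obj M') =
      (𝟙 _ ≫ 𝟙 _) ≫ (Γ'.as.app (op (prodCat (meshCat n) A.unop))).toNatTrans.app
        (g.toFunctor.obj M') ≫ 𝟙 _ ≫ 𝟙 _
    simp
  map₂_whisker_right {D E F G H} Γ K := fullTrans_ext fun A M => by
    let M' : D.pre.val (prodCat (meshCat n) A.unop) := M.obj
    let k := (ExactMorphism.mor K).app (op (prodCat (meshCat n) A.unop))
    let Γ' : ExactMorphism.mor G ⟶ ExactMorphism.mor H := Γ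
    change k.toFunctor.map ((Γ'.as.app (op (prodCat (meshCat n) A.unop))).toNatTrans.app M') =
      (𝟙 _ ≫ 𝟙 _) ≫ k.toFunctor.map ((Γ'.as.app (op (prodCat (meshCat n) A.unop))).toNatTrans.app
        M') ≫ 𝟙 _ ≫ 𝟙 _
    simp
  map₂_associator {D E F I} G H K := fullTrans_ext fun A M => by
    let M' : D.pre.val (prodCat (meshCat n) A.unop) := M.obj
    let g := (ExactMorphism.mor G).app (op (prodCat (meshCat n) A.unop))
    let h := (ExactMorphism.mor H).app (op (prodCat (meshCat n) A.unop))
    let k := (ExactMorphism.mor K).app (op (prodCat (meshCat n) A.unop))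
    change 𝟙 (k.toFunctor.obj (h.toFunctor.obj (g.toFunctor.obj M'))) =
      (𝟙 _ ≫ 𝟙 _) ≫ k.toFunctor.map (𝟙 _ ≫ 𝟙 _) ≫ 𝟙 _ ≫ (𝟙 _ ≫ 𝟙 _) ≫ 𝟙 _ ≫ 𝟙 _
    simp
  map₂_left_unitor {D E} G := fullTrans_ext fun A M => by
    let M' : D.pre.val (prodCat (meshCat n) A.unop) := M.obj
    let g := (ExactMorphism.mor G).app (op (prodCat (meshCat n) A.unop))
    change 𝟙 (g.toFunctor.obj M') =
      (𝟙 _ ≫ 𝟙 _) ≫ g.toFunctor.map (𝟙 _ ≫ 𝟙 _) ≫ 𝟙 _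
    simp
  map₂_right_unitor {D E} G := fullTrans_ext fun A M => by
    let M' : D.pre.val (prodCat (meshCat n) A.unop) := M.obj
    let g := (ExactMorphism.mor G).app (op (prodCat (meshCat n) A.unop))
    change 𝟙 (g.toFunctor.obj M') =
      (𝟙 _ ≫ 𝟙 _) ≫ (𝟙 _ ≫ 𝟙 _) ≫ 𝟙 _
    simp

lemma trans_ext {F G : Prederivator.{u, v, w}} {η θ : F ⟶ G} {Γ Γ' : η ⟶ θ}
    (h : ∀ X (M : F.obj X), (Γ.as.app X).toNatTrans.app M = (Γ'.as.app X).toNatTrans.app M) :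
    Γ = Γ' :=
  Pseudofunctor.StrongTrans.homCategory.ext fun X =>
    Cat.Hom₂.ext (NatTrans.ext (funext (h X)))

/-- The inclusions `D^{M_n,ex} ⟶ D^{M_n}`, natural in exact morphisms. -/
def exι (n : ℕ) : exPs.{u, v, w} n ⟶ shiftPs (meshCat n) where
  app D := exMeshι n D.pre
  naturality G := fullMapι ((precompPs (prodPs (meshCat n))).map (ExactMorphism.mor G))
    (exProp_map (ExactMorphism.isExact G))
  naturality_naturality {D E G H} Γ := trans_ext fun A M => by
    let M' : D.pre.val (prodCat (meshCat n) A.unop) := M.obj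
    let Γ' : ExactMorphism.mor G ⟶ ExactMorphism.mor H := Γ
    change (Γ'.as.app (op (prodCat (meshCat n) A.unop))).toNatTrans.app M' ≫ 𝟙 _ =
      𝟙 _ ≫ (Γ'.as.app (op (prodCat (meshCat n) A.unop))).toNatTrans.app M'
    simp
  naturality_id D := trans_ext fun A M => by
    let M' : D.pre.val (prodCat (meshCat n) A.unop) := M.obj
    change 𝟙 M' ≫ (𝟙 _ ≫ 𝟙 _) = (𝟙 _ ≫ 𝟙 _) ≫ 𝟙 _ ≫ 𝟙 _
    simp
  naturality_comp {D E F} G H := trans_ext fun A M => by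
    let M' : D.pre.val (prodCat (meshCat n) A.unop) := M.obj
    let g := (ExactMorphism.mor G).app (op (prodCat (meshCat n) A.unop))
    let h := (ExactMorphism.mor H).app (op (prodCat (meshCat n) A.unop))
    change 𝟙 (h.toFunctor.obj (g.toFunctor.obj M')) ≫ (𝟙 _ ≫ 𝟙 _) =
      (𝟙 _ ≫ 𝟙 _) ≫ 𝟙 _ ≫ 𝟙 _ ≫ 𝟙 _ ≫ h.toFunctor.map (𝟙 _) ≫ 𝟙 _
    simp

/-- The restriction morphisms `u^* : D^L ⟶ D^K`, natural in exact morphisms. -/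
def resPs {K L : Cat.{u, u}} (f : K ⟶ L) : shiftPs.{u, v, w} L ⟶ shiftPs K :=
  precompTrans forgetPs (precompPsMap (prodTrans f))

theorem resPs_app {K L : Cat.{u, u}} (f : K ⟶ L) (D : StableDerivator.{u, v, w}) :
    (resPs f).app D = D.pre.shiftRes f := rfl

end DerivatorAR

end

open DerivatorAR

/-! A diagram on `M_n` that vanishes on both boundary rows and has bicartesian squares is determined
by its column `k = 0`. To the right, the value at `(k, l)`, `k > 0`, is the pushout of the span from
`(k - 1, l)` to `(k - 1, l + 1)` and `(k, l - 1)`. To the left, the value at `(k, l)`, `k < 0`, is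
the pullback of the cospan from `(k, l + 1)` and `(k + 1, l - 1)` to `(k + 1, l)`. In the poset
these pushouts and pullbacks are the pointwise formulas for Kan extension along `incl₂` and `incl₄`,
while `incl₁` and `incl₃` are a sieve and a cosieve and extend by zero. So the exact diagrams are
precisely the iterated Kan extensions of their restriction to `A_n`
(`IsPointedDerivator.meshExact_iff`). Each of the four extensions is along a fully faithful functor,
hence restriction to `A_n` is an equivalence from exact diagrams at every level
(`IsStableDerivator.res_incl_isEquivalence`).

The passage between Kan extensions and squares is `IsDerivator.isLKE_spanIncl_of_isLKE` together
with `IsDerivator.isLKE_of_squares` and their duals. It rests on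
`IsDerivator.lexact_of_isReflective`: the colimit over a slice may be computed on any category
mapping to it by a right adjoint. Kan extensions are handled through universal arrows, so no choice
of adjoints enters. Left and right exactness of a square are transposes of each other, so base
change is proved on one side only.

The parameter `A` is removed by working in the derivator `K ↦ D(K × A)`. Derivator axioms and
stability are invariant under levelwise equivalence, which makes the exact diagrams a stable
derivator. Their inclusion is exact because they are closed under the left Kan extensions that
define cocartesian squares; stability on both sides then handles cartesian squares.

Naturality comes from the calculus of mates. Restriction `i^*` is pseudonatural by construction, and
componentwise adjoint inverses of a pseudonatural transformation are again pseudonatural. This is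
applied over all parameters `A` and then over all stable derivators (`exists_equivalence`), so it is
never checked by hand that `F` commutes with exact morphisms. Finally `exists_iso_kan` identifies
any such inverse with the composite of the four Kan extensions. -/

noncomputable section

namespace DerivatorAR

open Prederivator

section

/-! ### Universal arrows -/

section Universal

variable {𝒞 : Type u₁} [Category.{v₁} 𝒞] {𝒟 : Type u₂} [Category.{v₂} 𝒟]
  {ℰ : Type u₃} [Category.{v₃} ℰ]

/-- `φ : X ⟶ R Z` is a universal arrow from `X` to the functor `R`. -/
def IsUniv (R : 𝒟 ⥤ 𝒞) {X : 𝒞} {Z : 𝒟} (φ : X ⟶ R.obj Z) : Prop :=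
  ∀ Y, Function.Bijective fun g : Z ⟶ Y => φ ≫ R.map g

/-- `φ : R Z ⟶ X` is a universal arrow from the functor `R` to `X`. -/
def IsCouniv (R : 𝒟 ⥤ 𝒞) {X : 𝒞} {Z : 𝒟} (φ : R.obj Z ⟶ X) : Prop :=
  ∀ Y, Function.Bijective fun g : Y ⟶ Z => R.map g ≫ φ

lemma IsUniv.congr {R : 𝒟 ⥤ 𝒞} {X : 𝒞} {Z : 𝒟} {φ ψ : X ⟶ R.obj Z} (h : IsUniv R φ) (e : φ = ψ) :
    IsUniv R ψ := e ▸ h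

lemma IsCouniv.congr {R : 𝒟 ⥤ 𝒞} {X : 𝒞} {Z : 𝒟} {φ ψ : R.obj Z ⟶ X} (h : IsCouniv R φ)
    (e : φ = ψ) : IsCouniv R ψ := e ▸ h

lemma isUniv_unit {L : 𝒞 ⥤ 𝒟} {R : 𝒟 ⥤ 𝒞} (adj : L ⊣ R) (X : 𝒞) :
    IsUniv R (adj.unit.app X) := fun Y => by
  have : (fun g => adj.unit.app X ≫ R.map g) = adj.homEquiv X Y :=
    funext fun g => (adj.homEquiv_unit ..).symm
  rw [this]
  exact (adj.homEquiv X Y).bijective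

lemma isCouniv_counit {L : 𝒟 ⥤ 𝒞} {R : 𝒞 ⥤ 𝒟} (adj : L ⊣ R) (X : 𝒞) :
    IsCouniv L (adj.counit.app X) := fun Y => by
  have : (fun g => L.map g ≫ adj.counit.app X) = (adj.homEquiv Y X).symm :=
    funext fun g => (adj.homEquiv_counit ..).symm
  rw [this]
  exact (adj.homEquiv Y X).symm.bijective

lemma exists_isUniv (R : 𝒟 ⥤ 𝒞) (h : R.IsRightAdjoint) (X : 𝒞) :
    ∃ (Z : 𝒟) (φ : X ⟶ R.obj Z), IsUniv R φ :=
  ⟨_, _, isUniv_unit (Adjunction.ofIsRightAdjoint R) X⟩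

lemma exists_isCouniv (R : 𝒟 ⥤ 𝒞) (h : R.IsLeftAdjoint) (X : 𝒞) :
    ∃ (Z : 𝒟) (φ : R.obj Z ⟶ X), IsCouniv R φ :=
  ⟨_, _, isCouniv_counit (Adjunction.ofIsLeftAdjoint R) X⟩

namespace IsUniv

variable {R : 𝒟 ⥤ 𝒞} {X : 𝒞} {Z : 𝒟} {φ : X ⟶ R.obj Z}

lemma existsUnique (h : IsUniv R φ) {Y : 𝒟} (ψ : X ⟶ R.obj Y) : ∃ g : Z ⟶ Y, φ ≫ R.map g = ψ :=
  (h Y).2 ψ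

lemma hom_ext (h : IsUniv R φ) {Y : 𝒟} {g g' : Z ⟶ Y} (e : φ ≫ R.map g = φ ≫ R.map g') : g = g' :=
  (h Y).1 e

lemma isIso_of_comp (h : IsUniv R φ) {Z' : 𝒟} (g : Z ⟶ Z') (h' : IsUniv R (φ ≫ R.map g)) :
    IsIso g := by
  obtain ⟨k, hk⟩ := h'.existsUnique φ
  refine ⟨k, h.hom_ext ?_, h'.hom_ext ?_⟩
  · simpa using hk
  · simp only [Functor.map_comp, ← Category.assoc, hk]
    simp

lemma comp_iso (h : IsUniv R φ) {Z' : 𝒟} (g : Z ⟶ Z') [IsIso g] : IsUniv R (φ ≫ R.map g) := fun Y => by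
  have : (fun k : Z' ⟶ Y => (φ ≫ R.map g) ≫ R.map k) =
      (fun k : Z ⟶ Y => φ ≫ R.map k) ∘ fun k => g ≫ k := by
    ext k; simp
  rw [this]
  exact (h Y).comp ((asIso g).symm.homFromEquiv (Z := Y)).bijective

lemma iso_comp_iff {X' : 𝒞} (e : X' ⟶ X) [IsIso e] : IsUniv R (e ≫ φ) ↔ IsUniv R φ := by
  refine forall_congr' fun Y => ?_
  have : (fun k : Z ⟶ Y => (e ≫ φ) ≫ R.map k) =
      (fun k => e ≫ k) ∘ fun k : Z ⟶ Y => φ ≫ R.map k := by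
    ext k; simp
  rw [this]
  exact Function.Bijective.of_comp_iff' ((asIso e).symm.homFromEquiv (Z := R.obj Y)).bijective _

/-- Universal arrows compose, and a universal first factor can be cancelled. This plays the role of
composing adjoints without choosing them. -/
lemma comp_iff (h : IsUniv R φ) {R' : ℰ ⥤ 𝒟} {W : ℰ} (ψ : Z ⟶ R'.obj W) :
    IsUniv (R' ⋙ R) (φ ≫ R.map ψ) ↔ IsUniv R' ψ := by
  refine forall_congr' fun Y => ?_
  have : (fun k : W ⟶ Y => (φ ≫ R.map ψ) ≫ (R' ⋙ R).map k) =
      (fun k => φ ≫ R.map k) ∘ fun k : W ⟶ Y => ψ ≫ R'.map k := by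
    ext k; simp
  rw [this]
  exact Function.Bijective.of_comp_iff' (h _) _

lemma of_natIso {R' : 𝒟 ⥤ 𝒞} (e : R ≅ R') (h : IsUniv R φ) : IsUniv R' (φ ≫ e.hom.app Z) := fun Y => by
  have : (fun k : Z ⟶ Y => (φ ≫ e.hom.app Z) ≫ R'.map k) =
      (fun k => k ≫ e.hom.app Y) ∘ fun k : Z ⟶ Y => φ ≫ R.map k := by
    ext k; simp
  rw [this]
  exact ((e.app Y).homToEquiv (Z := X)).bijective.comp (h Y)

lemma isIso_of_isEquivalence [R.IsEquivalence] (h : IsUniv R φ) : IsIso φ := by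
  obtain ⟨W, ⟨e⟩⟩ := Functor.EssSurj.mem_essImage (F := R) X
  have : IsUniv R e.inv := by
    have : IsUniv R (𝟙 (R.obj W)) := fun Y => by
      simpa using ⟨R.map_injective, R.map_surjective⟩
    simpa using (iso_comp_iff e.inv).2 this
  obtain ⟨g, hg⟩ := this.existsUnique φ
  have : IsIso g := this.isIso_of_comp g (hg ▸ h)
  rw [← hg]
  infer_instance

lemma of_isIso [R.Full] [R.Faithful] [IsIso φ] : IsUniv R φ := by
  have h : IsUniv R (𝟙 (R.obj Z)) := fun Y => by
    simpa using ⟨R.map_injective, R.map_surjective⟩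
  simpa using (iso_comp_iff φ).2 h

lemma exists_iso (h : IsUniv R φ) {Z' : 𝒟} {φ' : X ⟶ R.obj Z'} (h' : IsUniv R φ') :
    ∃ e : Z ≅ Z', φ ≫ R.map e.hom = φ' := by
  obtain ⟨g, rfl⟩ := h.existsUnique φ'
  have := h.isIso_of_comp g h'
  exact ⟨asIso g, rfl⟩

end IsUniv

namespace IsCouniv

variable {R : 𝒟 ⥤ 𝒞} {X : 𝒞} {Z : 𝒟} {φ : R.obj Z ⟶ X}

lemma existsUnique (h : IsCouniv R φ) {Y : 𝒟} (ψ : R.obj Y ⟶ X) : ∃ g : Y ⟶ Z, R.map g ≫ φ = ψ :=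
  (h Y).2 ψ

lemma hom_ext (h : IsCouniv R φ) {Y : 𝒟} {g g' : Y ⟶ Z} (e : R.map g ≫ φ = R.map g' ≫ φ) : g = g' :=
  (h Y).1 e

lemma isIso_of_comp (h : IsCouniv R φ) {Z' : 𝒟} (g : Z' ⟶ Z) (h' : IsCouniv R (R.map g ≫ φ)) :
    IsIso g := by
  obtain ⟨k, hk⟩ := h'.existsUnique φ
  refine ⟨k, h'.hom_ext ?_, h.hom_ext ?_⟩
  · simp only [Functor.map_comp, Category.assoc, hk]
    simp
  · simpa using hk

lemma iso_comp (h : IsCouniv R φ) {Z' : 𝒟} (g : Z' ⟶ Z) [IsIso g] : IsCouniv R (R.map g ≫ φ) :=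
  fun Y => by
  have : (fun k : Y ⟶ Z' => R.map k ≫ R.map g ≫ φ) =
      (fun k : Y ⟶ Z => R.map k ≫ φ) ∘ fun k => k ≫ g := by
    ext k; simp
  rw [this]
  exact (h Y).comp ((asIso g).homToEquiv (Z := Y)).bijective

lemma comp_iso_iff {X' : 𝒞} (e : X ⟶ X') [IsIso e] : IsCouniv R (φ ≫ e) ↔ IsCouniv R φ := by
  refine forall_congr' fun Y => ?_
  have : (fun k : Y ⟶ Z => R.map k ≫ φ ≫ e) =
      (fun k => k ≫ e) ∘ fun k : Y ⟶ Z => R.map k ≫ φ := by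
    ext k; simp
  rw [this]
  exact Function.Bijective.of_comp_iff' ((asIso e).homToEquiv (Z := R.obj Y)).bijective _

lemma of_natIso {R' : 𝒟 ⥤ 𝒞} (e : R ≅ R') (h : IsCouniv R φ) : IsCouniv R' (e.inv.app Z ≫ φ) :=
  fun Y => by
  have : (fun k : Y ⟶ Z => R'.map k ≫ e.inv.app Z ≫ φ) =
      (fun k => e.inv.app Y ≫ k) ∘ fun k : Y ⟶ Z => R.map k ≫ φ := by
    ext k; simp
  rw [this]
  exact ((e.app Y).homFromEquiv (Z := X)).bijective.comp (h Y)

lemma isIso_of_isEquivalence [R.IsEquivalence] (h : IsCouniv R φ) : IsIso φ := by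
  obtain ⟨W, ⟨e⟩⟩ := Functor.EssSurj.mem_essImage (F := R) X
  have : IsCouniv R e.hom := by
    have : IsCouniv R (𝟙 (R.obj W)) := fun Y => by
      simpa using ⟨R.map_injective, R.map_surjective⟩
    simpa using (comp_iso_iff e.hom).2 this
  obtain ⟨g, hg⟩ := this.existsUnique φ
  have : IsIso g := this.isIso_of_comp g (hg ▸ h)
  rw [← hg]
  infer_instance

lemma exists_iso (h : IsCouniv R φ) {Z' : 𝒟} {φ' : R.obj Z' ⟶ X} (h' : IsCouniv R φ') :
    ∃ e : Z' ≅ Z, R.map e.hom ≫ φ = φ' := by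
  obtain ⟨g, rfl⟩ := h.existsUnique φ'
  have := h.isIso_of_comp g h'
  exact ⟨asIso g, rfl⟩

end IsCouniv

end Universal

namespace Prederivator

variable {D : Prederivator.{u, v, w}} {A B C E P Q : Cat.{u, u}}

/-! ### Calculus of restriction functors -/

lemma resMap_id (f : A ⟶ B) (X : D.val B) : (D.resMap (𝟙 f)).app X = 𝟙 _ := by
  change (D.map₂ (𝟙 f.op)).toNatTrans.app X = _
  rw [D.map₂_id]; rfl

lemma resMap_comp {f g h : A ⟶ B} (α : f ⟶ g) (β : g ⟶ h) (X : D.val B) :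
    (D.resMap (α ≫ β)).app X = (D.resMap α).app X ≫ (D.resMap β).app X := by
  change (D.map₂ (Bicategory.Opposite.op2 α ≫ Bicategory.Opposite.op2 β)).toNatTrans.app X = _
  rw [D.map₂_comp]; rfl

/-- Composition is reversed in `Catᵒᵖ`, so right whiskering in `Cat` is governed by
`map₂_whisker_left`, and left whiskering by `map₂_whisker_right`. -/
lemma resMap_whiskerRight {f g : A ⟶ B} (α : f ⟶ g) (h : B ⟶ C) (X : D.val C) :
    (D.resMap (α ▷ h)).app X ≫ (D.resComp g h).hom.app X =
      (D.resComp f h).hom.app X ≫ (D.resMap α).app ((D.res h).obj X) := by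
  have := congr($(D.map₂_whisker_left h.op (Bicategory.Opposite.op2 α)).toNatTrans.app X)
  have h2 : (D.resMap (α ▷ h)).app X = (D.resComp f h).hom.app X ≫
    (D.resMap α).app ((D.res h).obj X) ≫ (D.resComp g h).inv.app X := this
  rw [h2]
  simp

lemma resMap_whiskerLeft (f : A ⟶ B) {g h : B ⟶ C} (β : g ⟶ h) (X : D.val C) :
    (D.resMap (f ◁ β)).app X ≫ (D.resComp f h).hom.app X =
      (D.resComp f g).hom.app X ≫ (D.res f).map ((D.resMap β).app X) := by
  have := congr($(D.map₂_whisker_right (Bicategory.Opposite.op2 β) f.op).toNatTrans.app X)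
  have h2 : (D.resMap (f ◁ β)).app X = (D.resComp f g).hom.app X ≫
    (D.res f).map ((D.resMap β).app X) ≫ (D.resComp f h).inv.app X := this
  rw [h2]
  simp

lemma resComp_assoc (f : A ⟶ B) (g : B ⟶ C) (h : C ⟶ E) (X : D.val E) :
    (D.resComp (f ≫ g) h).hom.app X ≫ (D.resComp f g).hom.app ((D.res h).obj X) =
      (D.resComp f (g ≫ h)).hom.app X ≫ (D.res f).map ((D.resComp g h).hom.app X) := by
  -- Associators of `Cat` have identity components, so at an object the coherence law becomes an
  -- equation between composites of `resComp`.
  have := congr($(D.map₂_associator h.op g.op f.op).toNatTrans.app X)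
  have h2 : (D.resMap (𝟙 (f ≫ g ≫ h))).app X = (D.resComp f (g ≫ h)).hom.app X ≫
    (D.res f).map ((D.resComp g h).hom.app X) ≫ 𝟙 _ ≫ (D.resComp f g).inv.app ((D.res h).obj X) ≫
      (D.resComp (f ≫ g) h).inv.app X := this
  rw [resMap_id] at h2
  have h3 := h2 =≫ ((D.resComp (f ≫ g) h).hom.app X ≫ (D.resComp f g).hom.app ((D.res h).obj X))
  simpa using h3

/-- `𝟙^* ≅ 𝟭`. -/
abbrev resId (D : Prederivator.{u, v, w}) (A : Cat.{u, u}) : D.res (𝟙 A) ≅ 𝟭 (D.val A) :=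
  Cat.Hom.toNatIso (D.mapId (op A))

lemma resComp_id_left (f : A ⟶ B) (X : D.val B) :
    (D.resComp (𝟙 A) f).hom.app X ≫ (D.resId A).hom.app ((D.res f).obj X) = 𝟙 _ := by
  have := congr($(D.map₂_right_unitor f.op).toNatTrans.app X)
  have h2 : (D.resMap (𝟙 f)).app X = (D.resComp (𝟙 A) f).hom.app X ≫
    (D.resId A).hom.app ((D.res f).obj X) ≫ 𝟙 _ := this
  rw [resMap_id] at h2
  exact (h2.trans (by simp; rfl)).symm

lemma resComp_id_right (f : A ⟶ B) (X : D.val B) :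
    (D.resComp f (𝟙 B)).hom.app X ≫ (D.res f).map ((D.resId B).hom.app X) = 𝟙 _ := by
  have := congr($(D.map₂_left_unitor f.op).toNatTrans.app X)
  have h2 : (D.resMap (𝟙 f)).app X = (D.resComp f (𝟙 B)).hom.app X ≫
    (D.res f).map ((D.resId B).hom.app X) ≫ 𝟙 _ := this
  rw [resMap_id] at h2
  exact (h2.trans (by simp; rfl)).symm

end Prederivator

end

section

namespace Prederivator

variable {D : Prederivator.{u, v, w}} {A B C E P Q : Cat.{u, u}}

/-! ### Exact squares -/

/-- The component `p^* f^* Z ⟶ q^* g^* Z` of `D.resSquare θ`. -/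
def sqApp {p : P ⟶ A} {f : A ⟶ C} {q : P ⟶ B} {g : B ⟶ C} (θ : p ≫ f ⟶ q ≫ g) (Z : D.val C) :
    (D.res p).obj ((D.res f).obj Z) ⟶ (D.res q).obj ((D.res g).obj Z) :=
  (D.resSquare θ).app Z

lemma sqApp_eq {p : P ⟶ A} {f : A ⟶ C} {q : P ⟶ B} {g : B ⟶ C}
    (θ : p ≫ f ⟶ q ≫ g) (Z : D.val C) : sqApp θ Z =
      (D.resComp p f).inv.app Z ≫ (D.resMap θ).app Z ≫ (D.resComp q g).hom.app Z := rfl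

lemma sqApp_naturality {p : P ⟶ A} {f : A ⟶ C} {q : P ⟶ B} {g : B ⟶ C} (θ : p ≫ f ⟶ q ≫ g)
    {Z W : D.val C} (k : Z ⟶ W) : (D.res p).map ((D.res f).map k) ≫ sqApp θ W =
      sqApp θ Z ≫ (D.res q).map ((D.res g).map k) :=
  (D.resSquare θ).naturality k

/-- Pasting of squares. -/
abbrev paste {P' B' : Cat.{u, u}} {p : P ⟶ A} {f : A ⟶ C} {q : P ⟶ B} {g : B ⟶ C}
    (θ : p ≫ f ⟶ q ≫ g) {p' : P' ⟶ P} {q' : P' ⟶ B'} {g' : B' ⟶ B} (θ' : p' ≫ q ⟶ q' ≫ g') :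
    (p' ≫ p) ≫ f ⟶ q' ≫ (g' ≫ g) :=
  CategoryStruct.comp (X := (p' ≫ p) ≫ f) (Y := p' ≫ q ≫ g) (p' ◁ θ) (θ' ▷ g)

/-- Restriction is functorial only up to `resComp`, so pasting holds up to these comparisons.
Cancelling the one for `(p' ≫ p) ≫ f` leaves an identity assembled from associativity and the two
whiskering laws. -/
lemma sqApp_paste {P' B' : Cat.{u, u}} {p : P ⟶ A} {f : A ⟶ C} {q : P ⟶ B} {g : B ⟶ C}
    (θ : p ≫ f ⟶ q ≫ g) {p' : P' ⟶ P} {q' : P' ⟶ B'} {g' : B' ⟶ B} (θ' : p' ≫ q ⟶ q' ≫ g')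
    (Z : D.val C) :
    (D.resComp p' p).hom.app ((D.res f).obj Z) ≫ (D.res p').map (sqApp θ Z) ≫
      sqApp θ' ((D.res g).obj Z) =
    sqApp (paste θ θ') Z ≫ (D.res q').map ((D.resComp g' g).hom.app Z) := by
  rw [← cancel_epi ((D.resComp (p' ≫ p) f).hom.app Z)]
  have h1 := D.resComp_assoc p' p f Z
  have h2 := resMap_whiskerLeft (D := D) p' θ Z
  have h3 := D.resComp_assoc p' q g Z
  have h4 := resMap_whiskerRight (D := D) θ' g Z
  have h5 := D.resComp_assoc q' g' g Z
  have h6 := resMap_comp (D := D) (f := (p' ≫ p) ≫ f) (g := p' ≫ q ≫ g) (p' ◁ θ) (θ' ▷ g) Z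
  rw [reassoc_of% h1, sqApp_eq, sqApp_eq, sqApp_eq]
  simp only [Functor.map_comp, Category.assoc]
  rw [← Functor.map_comp_assoc, Iso.hom_inv_id_app, CategoryTheory.Functor.map_id, Category.id_comp,
    ← reassoc_of% h2, ← reassoc_of% h3, Iso.hom_inv_id_app_assoc, ← reassoc_of% h4,
    Iso.hom_inv_id_app_assoc, h6, h5]
  simp only [Category.assoc]

end Prederivator

end

section

namespace Prederivator

variable {D : Prederivator.{u, v, w}} {A B C E P Q : Cat.{u, u}}

section Exact

variable {p : P ⟶ A} {f : A ⟶ C} {q : P ⟶ B} {g : B ⟶ C}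

/-- A square is left exact if the canonical transformation `q_! p^* ⟶ g^* f_!` is invertible,
expressed through universal arrows. -/
def LExact (D : Prederivator.{u, v, w}) (θ : p ≫ f ⟶ q ≫ g) : Prop :=
  ∀ ⦃X : D.val A⦄ ⦃Z : D.val C⦄ (φ : X ⟶ (D.res f).obj Z), IsUniv (D.res f) φ →
    IsUniv (D.res q) ((D.res p).map φ ≫ sqApp θ Z)

/-- A square is right exact if the canonical transformation `f^* g_* ⟶ p_* q^*` is invertible,
expressed through universal arrows. -/
def RExact (D : Prederivator.{u, v, w}) (θ : p ≫ f ⟶ q ≫ g) : Prop :=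
  ∀ ⦃X : D.val B⦄ ⦃Z : D.val C⦄ (φ : (D.res g).obj Z ⟶ X), IsCouniv (D.res g) φ →
    IsCouniv (D.res p) (sqApp θ Z ≫ (D.res q).map φ)

variable {θ : p ≫ f ⟶ q ≫ g}

/-- With `φ : Y ⟶ f^* W` universal and `ψ : g^* Z ⟶ X` couniversal, the map `Hom(Y, f^* Z) → Hom(p^*
Y, q^* X)` in question is the composite of the bijections with `Hom(W, Z)`, with `Hom(g^* W, X)`,
and, by left exactness, with `Hom(p^* Y, q^* X)`. -/
lemma LExact.rexact (h : LExact D θ) (hf : (D.res f).IsRightAdjoint) : RExact D θ := by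
  intro X Z ψ hψ Y
  obtain ⟨W, φ, hφ⟩ := exists_isUniv (D.res f) hf Y
  have h1 := h φ hφ X
  have h2 := (h1.comp (hψ W)).comp ((Equiv.ofBijective _ (hφ Z)).symm.bijective)
  convert h2 using 1
  ext k
  obtain ⟨k, rfl⟩ := (Equiv.ofBijective _ (hφ Z)).surjective k
  simp [reassoc_of% sqApp_naturality]

lemma RExact.lexact (h : RExact D θ) (hg : (D.res g).IsLeftAdjoint) : LExact D θ := by
  intro X Z ψ hψ Y
  obtain ⟨W, φ, hφ⟩ := exists_isCouniv (D.res g) hg Y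
  have h1 := h φ hφ X
  have h2 := (h1.comp (hψ W)).comp ((Equiv.ofBijective _ (hφ Z)).symm.bijective)
  convert h2 using 1
  ext k
  obtain ⟨k, rfl⟩ := (Equiv.ofBijective _ (hφ Z)).surjective k
  simp [reassoc_of% sqApp_naturality]

/-- The mate is the unique map that carries the unit of `adj'` to the base change of the unit of
`adj`, so it is invertible exactly when the latter is universal. This links (Der4) to the
choice-free notion `LExact`. -/
lemma isIso_mate_iff_lexact {L : D.val A ⥤ D.val C} (adj : L ⊣ D.res f)
    {L' : D.val P ⥤ D.val B} (adj' : L' ⊣ D.res q) :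
    IsIso ((mateEquiv adj adj').symm (.mk _ _ _ _ (D.resSquare θ))).natTrans ↔ LExact D θ := by
  have key (X : D.val A) : adj'.unit.app _ ≫ (D.res q).map
      (((mateEquiv adj adj').symm (.mk _ _ _ _ (D.resSquare θ))).natTrans.app X) =
      (D.res p).map (adj.unit.app X) ≫ sqApp θ (L.obj X) := by
    have := unit_mateEquiv adj adj'
      ((mateEquiv adj adj').symm (.mk _ _ _ _ (D.resSquare θ))) X
    rw [Equiv.apply_symm_apply] at this
    exact this.symm
  rw [NatTrans.isIso_iff_isIso_app]
  constructor
  · intro h X Z φ hφ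
    have h1 := (isUniv_unit adj' _).comp_iso
      (((mateEquiv adj adj').symm (.mk _ _ _ _ (D.resSquare θ))).natTrans.app X)
    rw [key] at h1
    obtain ⟨e, rfl⟩ := (isUniv_unit adj X).exists_iso hφ
    have h2 := h1.comp_iso ((D.res g).map e.hom)
    simpa [sqApp_naturality, reassoc_of% sqApp_naturality] using h2
  · intro h X
    refine (isUniv_unit adj' _).isIso_of_comp _ ?_
    rw [key]
    exact h _ (isUniv_unit adj X)

lemma isIso_mate_iff_rexact {R : D.val B ⥤ D.val C} (adj : D.res g ⊣ R)
    {R' : D.val P ⥤ D.val A} (adj' : D.res p ⊣ R') :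
    IsIso ((mateEquiv adj adj') (.mk _ _ _ _ (D.resSquare θ))).natTrans ↔ RExact D θ := by
  have key (X : D.val B) : (D.res p).map
      (((mateEquiv adj adj') (.mk _ _ _ _ (D.resSquare θ))).natTrans.app X) ≫ adj'.counit.app _ =
      sqApp θ (R.obj X) ≫ (D.res q).map (adj.counit.app X) :=
    mateEquiv_counit adj adj' (.mk _ _ _ _ (D.resSquare θ)) X
  rw [NatTrans.isIso_iff_isIso_app]
  constructor
  · intro h X Z φ hφ
    have h1 := (isCouniv_counit adj' _).iso_comp
      (((mateEquiv adj adj') (.mk _ _ _ _ (D.resSquare θ))).natTrans.app X)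
    rw [key] at h1
    obtain ⟨e, rfl⟩ := (isCouniv_counit adj X).exists_iso hφ
    have h2 := h1.iso_comp ((D.res f).map e.hom)
    simpa [sqApp_naturality, reassoc_of% sqApp_naturality] using h2
  · intro h X
    refine (isCouniv_counit adj' _).isIso_of_comp _ ?_
    rw [key]
    exact h _ (isCouniv_counit adj X)

variable {P' B' : Cat.{u, u}} {p' : P' ⟶ P} {q' : P' ⟶ B'} {g' : B' ⟶ B}
  {θ' : p' ≫ q ⟶ q' ≫ g'}

lemma paste_isUniv_iff {X : D.val A} {Z : D.val C} (φ : X ⟶ (D.res f).obj Z) :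
    IsUniv (D.res q') ((D.res p').map ((D.res p).map φ ≫ sqApp θ Z) ≫
      sqApp θ' _) ↔
    IsUniv (D.res q') ((D.res (p' ≫ p)).map φ ≫ sqApp (paste θ θ') Z) := by
  have h := sqApp_paste (D := D) θ θ' Z
  have h2 := (D.resComp p' p).hom.naturality φ
  rw [← IsUniv.iso_comp_iff ((D.resComp p' p).hom.app X)]
  have h3 : (D.resComp p' p).hom.app X ≫ (D.res p').map ((D.res p).map φ ≫
      sqApp θ Z) ≫ sqApp θ' _ =
      ((D.res (p' ≫ p)).map φ ≫ sqApp (paste θ θ') Z) ≫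
        (D.res q').map ((D.resComp g' g).hom.app Z) := by
    rw [Category.assoc, ← h, Functor.map_comp, Category.assoc]
    exact ((reassoc_of% h2) _).symm
  rw [h3]
  refine ⟨fun h => ?_, fun h => h.comp_iso _⟩
  have := h.comp_iso ((D.resComp g' g).inv.app Z)
  rw [Category.assoc, ← Functor.map_comp, Iso.hom_inv_id_app, CategoryTheory.Functor.map_id] at this
  exact (Category.comp_id ((D.res (p' ≫ p)).map φ ≫ sqApp (paste θ θ') Z)) ▸ this

lemma LExact.paste (h : LExact D θ) (h' : LExact D θ') : LExact D (paste θ θ') :=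
  fun _ _ φ hφ => (paste_isUniv_iff φ).1 (h' _ (h φ hφ))

end Exact

/-- Left exactness can be tested after pasting with left exact squares over a jointly conservative
family. -/
theorem LExact.of_local {p : P ⟶ A} {f : A ⟶ C} {q : P ⟶ B} {g : B ⟶ C} {θ : p ≫ f ⟶ q ≫ g}
    (hq : (D.res q).IsRightAdjoint) {ι : Type*} {P' B' : ι → Cat.{u, u}} {p' : ∀ i, P' i ⟶ P}
    {q' : ∀ i, P' i ⟶ B' i} {g' : ∀ i, B' i ⟶ B} (θ' : ∀ i, p' i ≫ q ⟶ q' i ≫ g' i)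
    (hg : ∀ {X Y : D.val B} (h : X ⟶ Y), (∀ i, IsIso ((D.res (g' i)).map h)) → IsIso h)
    (h' : ∀ i, LExact D (θ' i)) (h : ∀ i, LExact D (Prederivator.paste θ (θ' i))) : LExact D θ := by
  intro X Z φ hφ
  -- It suffices that the comparison `k` from a genuine universal arrow `χ` is invertible. After
  -- restriction along `g' i` it compares two universal arrows: one by exactness of `θ' i`, the
  -- other by exactness of the pasting.
  obtain ⟨W, χ, hχ⟩ := exists_isUniv (D.res q) hq ((D.res p).obj X)
  obtain ⟨k, hk⟩ := hχ.existsUnique ((D.res p).map φ ≫ sqApp θ Z)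
  have : IsIso k := hg k fun i => by
    refine IsUniv.isIso_of_comp (h' i χ hχ) _ ?_
    have h1 := (paste_isUniv_iff (θ' := θ' i) φ).2 (h i φ hφ)
    rw [← hk] at h1
    simpa [sqApp_naturality, reassoc_of% sqApp_naturality] using h1
  rw [← hk]
  exact hχ.comp_iso k

end Prederivator

/-- The left half of (Der4). -/
lemma IsDerivator.lexact_overCell {D : Prederivator.{u, v, w}} (hD : IsDerivator D) {A B : Cat.{u, u}}
    (f : A ⟶ B) (b : B) : D.LExact (overCell f b) := by
  have := hD.der3_left f
  have := hD.der3_left (toPt (overCat f b))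
  exact (Prederivator.isIso_mate_iff_lexact _ _).1 (hD.der4_left f b
    (Adjunction.ofIsRightAdjoint (D.res f))
    (Adjunction.ofIsRightAdjoint (D.res (toPt (overCat f b)))))

end

/-! ### Adjoint functors and reflective cells -/

section

/-- An adjunction `G ⊣ F` as an adjunction in `Catᵒᵖ`. -/
abbrev opAdj {S T : Cat.{u, u}} {G : T ⟶ S} {F : S ⟶ T} (adj : G.toFunctor ⊣ F.toFunctor) :
    Bicategory.Adjunction F.op G.op where
  unit := Bicategory.Opposite.op2 (Cat.Hom₂.ofNatTrans (F := 𝟙 T) (G := G ≫ F) adj.unit)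
  counit := Bicategory.Opposite.op2 (Cat.Hom₂.ofNatTrans (F := F ≫ G) (G := 𝟙 S) adj.counit)
  left_triangle := hom2_ext fun X => by
    simp [leftZigzag, bicategoricalComp]
  right_triangle := hom2_ext fun X => by
    simp [rightZigzag, bicategoricalComp]

namespace Prederivator

variable {D : Prederivator.{u, v, w}} {A B C E P Q : Cat.{u, u}}

lemma resComp_id_right' (f : A ⟶ B) (X : D.val B) :
    (D.resComp f (𝟙 B)).hom.app X = (D.res f).map ((D.resId B).inv.app X) :=
  (Iso.comp_hom_eq_id ((D.res f).mapIso ((D.resId B).app X))).1 (resComp_id_right f X)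

lemma resComp_id_left' (f : A ⟶ B) (X : D.val B) :
    (D.resComp (𝟙 A) f).hom.app X = (D.resId A).inv.app ((D.res f).obj X) :=
  (Iso.comp_hom_eq_id ((D.resId A).app ((D.res f).obj X))).1 (resComp_id_left f X)

lemma LExact.congr {p : P ⟶ A} {f : A ⟶ C} {q : P ⟶ B} {g : B ⟶ C} {θ θ' : p ≫ f ⟶ q ≫ g}
    (h : LExact D θ) (e : θ = θ') : LExact D θ' := e ▸ h

lemma hom_toPt_ext {S : Cat.{u, u}} {f g : S ⟶ ptCat.{u}} (α β : f ⟶ g) : α = β :=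
  Cat.Hom₂.ext (NatTrans.ext (funext fun s =>
    have (a b : Discrete PUnit.{u + 1}) : Subsingleton (a ⟶ b) := inferInstance
    (this _ _).elim _ _))

/-- A formal diagram chase with abstract arrows, so that the coherence laws of `D` can be supplied
as hypotheses up to definitional equality. -/
lemma unit_comp_aux {𝒞 : Type u₁} [Category.{v₁} 𝒞] {o₁ o₂ o₃ o₄ o₅ o₆ o₇ o₈ o₉ : 𝒞}
    {i i' : o₁ ⟶ o₂} {m : o₂ ⟶ o₃} {c : o₃ ⟶ o₄} {a : o₄ ⟶ o₅} {b : o₅ ⟶ o₆} {d : o₆ ⟶ o₇}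
    {x : o₁ ⟶ o₈} {y : o₈ ⟶ o₃} {z : o₈ ⟶ o₅} {a' : o₅ ⟶ o₄} {t : o₈ ⟶ o₁} {s : o₁ ⟶ o₆}
    {r r' : o₁ ⟶ o₉} {k : o₉ ⟶ o₇} (h₁ : x ≫ y = i' ≫ m) (h₁' : i' = i) (h₂ : y ≫ c = z ≫ a')
    (h₃ : a' ≫ a = 𝟙 _) (h₄ : t ≫ s = z ≫ b) (h₅ : r' ≫ k = s ≫ d) (h₅' : r' = r)
    (h₆ : x ≫ t = 𝟙 _) : (i ≫ m ≫ c) ≫ a ≫ b ≫ d = r ≫ k := by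
  subst h₁' h₅'
  rw [Category.assoc, Category.assoc, ← reassoc_of% h₁, reassoc_of% h₂, reassoc_of% h₃,
    ← reassoc_of% h₄, reassoc_of% h₆, h₅]

/-- Restriction along a right adjoint preserves colimits. -/
lemma lexact_of_adj {S T : Cat.{u, u}} {G : T ⟶ S} {F : S ⟶ T} (adj : G.toFunctor ⊣ F.toFunctor)
    (θ : F ≫ toPt T ⟶ toPt S ≫ 𝟙 ptCat) : LExact D θ := by
  intro X W φ hφ
  -- `D` reverses 1-cells and keeps 2-cells, so `G ⊣ F` yields `F^* ⊣ G^*`.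
  let A := Adjunction.ofCat (D.mapAdjunction (opAdj adj))
  have key : A.unit.app ((D.res (toPt T)).obj W) ≫ (D.res G).map (sqApp θ W) =
      (D.res (toPt T)).map ((D.resId _).inv.app W) ≫
        (D.resComp G (toPt S)).hom.app ((D.res (𝟙 ptCat)).obj W) := by
    have e : (D.res G).map (sqApp θ W) = (D.res G).map ((D.resComp F (toPt T)).inv.app W) ≫
        (D.res G).map ((D.resMap θ).app W) ≫ (D.res G).map ((D.resComp (toPt S) (𝟙 _)).hom.app W) := by
      rw [sqApp_eq, Functor.map_comp, Functor.map_comp]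
    rw [e]
    exact unit_comp_aux (resMap_whiskerRight (Cat.Hom₂.ofNatTrans adj.unit) (toPt T) W)
      (resComp_id_left' (toPt T) W)
      (resComp_assoc G F (toPt T) W)
      (by rw [← Functor.map_comp, Iso.hom_inv_id_app, CategoryTheory.Functor.map_id])
      (resMap_whiskerLeft G θ W) (resComp_assoc G (toPt S) (𝟙 _) W) (resComp_id_right' (toPt T) W)
      ((resMap_comp (D := D) (A := T) (B := ptCat) (f := toPt T) (g := toPt T) (h := toPt T)
        _ _ W).symm.trans ((congrArg (fun t => (D.resMap t).app W)
          (hom_toPt_ext _ (𝟙 (toPt T)))).trans (resMap_id _ W)))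
  -- Transposing along `F^* ⊣ G^*` replaces the target functor by `G^* (toPt S)^*`. This is
  -- isomorphic to `(toPt T)^*`, where `φ` provides the universal arrow.
  rw [← IsUniv.comp_iff (isUniv_unit A X)]
  refine ((hφ.comp_iso ((D.resId _).inv.app W)).of_natIso (D.resComp G (toPt S))).congr ?_
  have h2 := A.unit_naturality φ
  calc _ = φ ≫ A.unit.app _ ≫ (D.res G).map (sqApp θ W) := by
        rw [key]
        exact Category.assoc _ _ _
    _ = _ := by
      rw [Functor.map_comp]
      exact ((reassoc_of% h2) _).symm

section Cells

variable {S : Cat.{u, u}} {p : S ⟶ A} {f : A ⟶ C} {c : ptCat.{u} ⟶ C}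

/-- The object of `C` given by a functor from the terminal category. -/
abbrev ptVal (c : ptCat.{u} ⟶ C) : C := c.toFunctor.obj ⟨⟨⟩⟩

/-- The component of a cocone-shaped cell. -/
abbrev cellHom (θ : p ≫ f ⟶ toPt S ≫ c) (s : S) :
    f.toFunctor.obj (p.toFunctor.obj s) ⟶ ptVal c := θ.toNatTrans.app s

lemma cellHom_w (θ : p ≫ f ⟶ toPt S ≫ c) {s t : S} (k : s ⟶ t) :
    f.toFunctor.map (p.toFunctor.map k) ≫ cellHom θ t = cellHom θ s :=
  (θ.toNatTrans.naturality k).trans ((congrArg (_ ≫ ·) (c.toFunctor.map_id _)).trans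
    (Category.comp_id _))

/-- A cell `θ : f p ⟶ c` is reflective if the induced functor to `(f/c)` is a right adjoint. -/
def IsReflective (θ : p ≫ f ⟶ toPt S ≫ c) : Prop :=
  ∀ (a : A) (x : f.toFunctor.obj a ⟶ ptVal c), ∃ (s : S) (v : a ⟶ p.toFunctor.obj s),
    f.toFunctor.map v ≫ cellHom θ s = x ∧ ∀ (t : S) (v' : a ⟶ p.toFunctor.obj t),
      f.toFunctor.map v' ≫ cellHom θ t = x → ∃! k : s ⟶ t, v ≫ p.toFunctor.map k = v'

abbrev cellFunctor (θ : p ≫ f ⟶ toPt S ≫ c) : S ⟶ overCat f (ptVal c) :=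
  Functor.toCatHom
    { obj s := CostructuredArrow.mk (cellHom θ s)
      map k := CostructuredArrow.homMk (p.toFunctor.map k) (cellHom_w θ k) }

/-- The pair `(s, v)` attached to an object `y` of the slice is initial among the arrows from `y` to
values of `cellFunctor θ`; these initial objects give the left adjoint. -/
lemma IsReflective.isRightAdjoint {θ : p ≫ f ⟶ toPt S ≫ c} (h : IsReflective θ) :
    (cellFunctor θ).toFunctor.IsRightAdjoint := by
  have (y : overCat f (ptVal c)) :
      Limits.HasInitial (StructuredArrow y (cellFunctor θ).toFunctor) := by
    obtain ⟨s, v, hv, H⟩ := h y.left y.hom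
    let i : StructuredArrow y (cellFunctor θ).toFunctor :=
      StructuredArrow.mk (Y := s) (CostructuredArrow.homMk v hv)
    have (z : StructuredArrow y (cellFunctor θ).toFunctor) : Unique (i ⟶ z) := by
      have hz := H z.right z.hom.left (CostructuredArrow.w z.hom)
      refine ⟨⟨StructuredArrow.homMk hz.choose ?_⟩, fun k => ?_⟩
      · exact CostructuredArrow.hom_ext _ _ hz.choose_spec.1
      · ext
        exact hz.choose_spec.2 _ congr($(StructuredArrow.w k).left)
    exact Limits.hasInitial_of_unique i
  exact isRightAdjointOfStructuredArrowInitials _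

/-- A functor from the terminal category is isomorphic to the one classifying its value. -/
abbrev ptIso (c : ptCat.{u} ⟶ C) : c ≅ ptHom (ptVal c) :=
  Cat.Hom.isoMk (NatIso.ofComponents (fun _ => Iso.refl _) (by
    rintro ⟨⟨⟩⟩ ⟨⟨⟩⟩ k
    have h (a b : Discrete PUnit.{u + 1}) : Subsingleton (a ⟶ b) := inferInstance
    obtain rfl : k = 𝟙 _ := (h _ _).elim _ _
    exact (congrArg (· ≫ 𝟙 (ptVal c)) (c.toFunctor.map_id _))))

end Cells

instance {f g : A ⟶ B} (α : f ⟶ g) [IsIso α] (X : D.val B) : IsIso ((D.resMap α).app X) :=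
  ⟨(D.resMap (inv α)).app X, by rw [← resMap_comp, IsIso.hom_inv_id, resMap_id],
    by rw [← resMap_comp, IsIso.inv_hom_id, resMap_id]⟩

lemma LExact.of_comp_whiskerLeft {p : P ⟶ A} {f : A ⟶ C} {q : P ⟶ B} {g g' : B ⟶ C}
    {θ : p ≫ f ⟶ q ≫ g} (γ : g ≅ g') (h : LExact D (θ ≫ q ◁ γ.hom)) : LExact D θ := by
  intro X Z φ hφ
  have h1 := (h φ hφ).comp_iso ((D.resMap γ.inv).app Z)
  refine h1.congr ?_
  have h2 := resMap_whiskerLeft (D := D) q γ.hom Z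
  rw [sqApp_eq, sqApp_eq, resMap_comp]
  simp only [Category.assoc]
  rw [reassoc_of% h2, ← Functor.map_comp, ← resMap_comp, Iso.hom_inv_id, resMap_id,
    CategoryTheory.Functor.map_id, Category.comp_id]

end Prederivator

open Prederivator

/-- By (Der4) the value of a left Kan extension at `c` is a colimit over the slice `(f/c)`. Colimits
do not change under precomposition with the right adjoint `cellFunctor θ`, so `S` may replace the
slice. The isomorphism `ptIso` accounts for `c` being an arbitrary functor from the point. -/
theorem IsDerivator.lexact_of_isReflective {D : Prederivator.{u, v, w}} (hD : IsDerivator D)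
    {S A C : Cat.{u, u}} {p : S ⟶ A} {f : A ⟶ C} {c : ptCat.{u} ⟶ C} {θ : p ≫ f ⟶ toPt S ≫ c}
    (h : IsReflective θ) : D.LExact θ := by
  have : (cellFunctor θ).toFunctor.IsRightAdjoint := h.isRightAdjoint
  refine LExact.of_comp_whiskerLeft (ptIso c) (((hD.lexact_overCell f (ptVal c)).paste
    (lexact_of_adj (G := (Functor.leftAdjoint (cellFunctor θ).toFunctor).toCatHom)
      (F := cellFunctor θ) (CategoryTheory.Adjunction.ofIsRightAdjoint (cellFunctor θ).toFunctor)
      (𝟙 _))).congr ?_)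
  refine Cat.Hom₂.ext (NatTrans.ext (funext fun s => ?_))
  change cellHom θ s ≫ 𝟙 (ptVal c) = cellHom θ s ≫ 𝟙 _
  rfl

end

/-! ### Coreflective cells -/

section

namespace Prederivator

variable {D : Prederivator.{u, v, w}} {A B C E P Q : Cat.{u, u}}

section Cells

variable {S : Cat.{u, u}} {p : S ⟶ A} {f : A ⟶ C} {c : ptCat.{u} ⟶ C}

/-- The component of a cone-shaped cell. -/
abbrev cocellHom (θ : toPt S ≫ c ⟶ p ≫ f) (s : S) :
    ptVal c ⟶ f.toFunctor.obj (p.toFunctor.obj s) := θ.toNatTrans.app s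

lemma cocellHom_w (θ : toPt S ≫ c ⟶ p ≫ f) {s t : S} (k : s ⟶ t) :
    cocellHom θ s ≫ f.toFunctor.map (p.toFunctor.map k) = cocellHom θ t :=
  (θ.toNatTrans.naturality k).symm.trans ((congrArg (· ≫ _) (c.toFunctor.map_id _)).trans
    (Category.id_comp _))

/-- A cell `c ⟶ f p` is coreflective if the induced functor to `(c/f)` is a left adjoint. -/
def IsCoreflective (θ : toPt S ≫ c ⟶ p ≫ f) : Prop :=
  ∀ (a : A) (x : ptVal c ⟶ f.toFunctor.obj a), ∃ (s : S) (v : p.toFunctor.obj s ⟶ a),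
    cocellHom θ s ≫ f.toFunctor.map v = x ∧ ∀ (t : S) (v' : p.toFunctor.obj t ⟶ a),
      cocellHom θ t ≫ f.toFunctor.map v' = x → ∃! k : t ⟶ s, p.toFunctor.map k ≫ v = v'

end Cells

end Prederivator

open Prederivator

lemma discrete_hom_ext {α : Type u₁} {a b : Discrete α} (f g : a ⟶ b) : f = g :=
  Subsingleton.elim f g

variable {D : Prederivator.{u, v, w}}

/-- The claim compares `p_! (toPt S)^*` with `f^* c_!`. At `a : A` both are coproducts indexed by
the set of arrows from the value of `c` to `f a`: the slice of `c` over `f a` is discrete, and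
`(p/a)` splits into parts indexed by these arrows, each with the terminal object `(s a x, v a x)`.
So both sides are computed on the discrete category `T a`. The pointwise formula for right Kan
extensions then follows by `LExact.rexact`. -/
theorem IsDerivator.lexact_of_isCoreflective (hD : IsDerivator D)
    {S A C : Cat.{u, u}} {p : S ⟶ A} {f : A ⟶ C} {c : ptCat.{u} ⟶ C} {θ : toPt S ≫ c ⟶ p ≫ f}
    (h : IsCoreflective θ) : D.LExact θ := by
  choose s v hv H using h
  let T (a : A) : Cat.{u, u} := Cat.of (Discrete (ptVal c ⟶ f.toFunctor.obj a))
  let p' (a : A) : T a ⟶ S := (Discrete.functor fun x => s a x).toCatHom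
  let θ' (a : A) : p' a ≫ p ⟶ toPt (T a) ≫ ptHom a :=
    Cat.Hom₂.ofNatTrans (Discrete.natTrans fun x => v a x.as)
  refine LExact.of_local (hD.der3_left p) θ' (fun h => (hD.der2 h).2)
    (fun a => hD.lexact_of_isReflective fun t x => ?_)
    (fun a => hD.lexact_of_isReflective (θ := paste θ (θ' a))
      fun t x => ?_)
  · obtain ⟨k, hk, -⟩ := H a (cocellHom θ t ≫ f.toFunctor.map x) t x rfl
    refine ⟨⟨cocellHom θ t ≫ f.toFunctor.map x⟩, k, hk, fun ⟨y⟩ k' hk' => ?_⟩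
    have hy : cocellHom θ t ≫ f.toFunctor.map x = y := by
      subst hk'
      refine Eq.trans ?_ (hv a y)
      change _ ≫ f.toFunctor.map (p.toFunctor.map k' ≫ v a y) = _
      rw [Functor.map_comp, ← Category.assoc, cocellHom_w]
      rfl
    subst hy
    obtain ⟨k'', -, hk''⟩ := H a (cocellHom θ t ≫ f.toFunctor.map x) t x rfl
    refine ⟨𝟙 _, ?_, fun m _ => discrete_hom_ext (α := ptVal c ⟶ f.toFunctor.obj a) _ _⟩
    change k ≫ S.str.id _ = k'
    rw [Category.comp_id, hk'' k hk, hk'' k' hk']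
  · have key (y : T a) : cellHom (paste θ (θ' a)) y = y.as := by
      obtain ⟨y⟩ := y
      exact hv a y
    refine ⟨⟨x⟩, 𝟙 _, ?_, fun ⟨y⟩ k' hk' => ?_⟩
    · refine Eq.trans ?_ (key ⟨x⟩)
      exact (congrArg (· ≫ _) (c.toFunctor.map_id _)).trans (Category.id_comp _)
    · have : x = y := by
        refine hk'.symm.trans (Eq.trans ?_ (key ⟨y⟩))
        exact (congrArg (· ≫ _) (c.toFunctor.map_id _)).trans (Category.id_comp _)
      subst this
      exact ⟨𝟙 _, discrete_hom_ext (α := PUnit) _ _, fun m _ =>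
        discrete_hom_ext (α := ptVal c ⟶ f.toFunctor.obj a) _ _⟩

/-! ### Products of exact squares with categories -/

section Products

variable {K K' L A A' B C P : Cat.{u, u}}

abbrev sectRHom (k : K) (A : Cat.{u, u}) : A ⟶ prodCat K A := (CategoryTheory.Prod.sectR k A).toCatHom

abbrev sectLHom (K : Cat.{u, u}) (a : A) : K ⟶ prodCat K A := (CategoryTheory.Prod.sectL K a).toCatHom

lemma IsDerivator.isIso_of_sectR (hD : IsDerivator D) {X Y : D.val (prodCat K A)} (h : X ⟶ Y)
    (H : ∀ k : K, IsIso ((D.res (sectRHom k A)).map h)) : IsIso h := by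
  refine (hD.der2 h).2 fun ⟨k, a⟩ => ?_
  have := H k
  exact ((NatIso.isIso_map_iff (D.resComp (ptHom a) (sectRHom k A) ≪≫ Iso.refl _) h).2
    (inferInstanceAs (IsIso ((D.res (ptHom a)).map ((D.res (sectRHom k A)).map h)))))

lemma prod_hom_ext {X Y : Type u} [Category.{u} X] [Category.{u} Y] {a b : X × Y} {f g : a ⟶ b}
    (h₁ : f.1 = g.1) (h₂ : f.2 = g.2) : f = g := Prod.ext h₁ h₂

/-- A slice cell of `f` inserted at an object of `K` is reflective for `K × f`. -/
lemma isReflective_slice_right (h : K' ⟶ K) (k : K') (f : A ⟶ C) (c : C)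
    (θ : (overProj f c ≫ sectRHom k A ≫ prodMap h (𝟙 A)) ≫ prodMap (𝟙 K) f ⟶
      toPt (overCat f c) ≫ (ptHom c ≫ sectRHom k C ≫ prodMap h (𝟙 C)))
    (key : ∀ t, cellHom θ t = (𝟙 (h.toFunctor.obj k), t.hom)) : IsReflective θ := by
  rintro ⟨k', a⟩ ⟨x, y⟩
  refine ⟨CostructuredArrow.mk y, (x, 𝟙 a), ?_, fun t ⟨z, z'⟩ hz => ?_⟩
  · refine (congrArg (_ ≫ ·) (key (CostructuredArrow.mk y))).trans (prod_hom_ext ?_ ?_)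
    · exact Category.comp_id x
    · exact (congrArg (· ≫ y) (f.toFunctor.map_id a)).trans (Category.id_comp y)
  · have hz' := (congrArg (_ ≫ ·) (key t)).symm.trans hz
    have h1 : z ≫ 𝟙 (h.toFunctor.obj k) = x := congr($(hz').1)
    have h2 : f.toFunctor.map z' ≫ t.hom = y := congr($(hz').2)
    refine ⟨CostructuredArrow.homMk z' h2, prod_hom_ext ?_ ?_, fun m hm => ?_⟩
    · exact ((congrArg (x ≫ ·) (h.toFunctor.map_id k)).trans (Category.comp_id x)).trans
        (h1.symm.trans (Category.comp_id z))
    · exact Category.id_comp z'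
    · refine CostructuredArrow.hom_ext _ _ ?_
      have : 𝟙 a ≫ m.left = z' := congr($(hm).2)
      exact (Category.id_comp m.left).symm.trans this

/-- A slice cell of `f` inserted at an object of `A` is reflective for `f × A`. -/
lemma isReflective_slice_left (f : K ⟶ L) (l : L) (g : A' ⟶ A) (a : A')
    (θ : (overProj f l ≫ sectLHom K a ≫ prodMap (𝟙 K) g) ≫ prodMap f (𝟙 A) ⟶
      toPt (overCat f l) ≫ (ptHom l ≫ sectLHom L a ≫ prodMap (𝟙 L) g))
    (key : ∀ t, cellHom θ t = (t.hom, 𝟙 (g.toFunctor.obj a))) : IsReflective θ := by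
  rintro ⟨k, a'⟩ ⟨y, x⟩
  refine ⟨CostructuredArrow.mk y, (𝟙 k, x), ?_, fun t ⟨z', z⟩ hz => ?_⟩
  · refine (congrArg (_ ≫ ·) (key (CostructuredArrow.mk y))).trans (prod_hom_ext ?_ ?_)
    · exact (congrArg (· ≫ y) (f.toFunctor.map_id k)).trans (Category.id_comp y)
    · exact Category.comp_id x
  · have hz' := (congrArg (_ ≫ ·) (key t)).symm.trans hz
    have h1 : z ≫ 𝟙 (g.toFunctor.obj a) = x := congr($(hz').2)
    have h2 : f.toFunctor.map z' ≫ t.hom = y := congr($(hz').1)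
    refine ⟨CostructuredArrow.homMk z' h2, prod_hom_ext ?_ ?_, fun m hm => ?_⟩
    · exact Category.id_comp z'
    · exact ((congrArg (x ≫ ·) (g.toFunctor.map_id a)).trans (Category.comp_id x)).trans
        (h1.symm.trans (Category.comp_id z))
    · refine CostructuredArrow.hom_ext _ _ ?_
      have : 𝟙 k ≫ m.left = z' := congr($(hm).1)
      exact (Category.id_comp m.left).symm.trans this

/-- At each `c` this reduces to the slice of `f` over `c`, inserted at `k`: by
`isReflective_slice_right` it also computes the colimit over the slice of `K × f` over `(k, c)`. -/
lemma IsDerivator.lexact_sectR (hD : IsDerivator D) (k : K) (f : A ⟶ C) :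
    D.LExact (p := sectRHom k A) (f := prodMap (𝟙 K) f) (q := f) (g := sectRHom k C) (𝟙 _) :=
  LExact.of_local (hD.der3_left f) (fun c => overCell f c) (fun h => (hD.der2 h).2)
    (fun c => hD.lexact_overCell f c) (fun c => hD.lexact_of_isReflective
      (isReflective_slice_right (𝟙 K) k f c
        (paste (q := f) (g := sectRHom k C) (𝟙 (sectRHom k A ≫ prodMap (𝟙 K) f)) (overCell f c))
      fun t => prod_hom_ext (Category.id_comp (𝟙 k)) (Category.id_comp t.hom)))

/-- The square `h × f` is left exact. -/
lemma IsDerivator.lexact_prod_right (hD : IsDerivator D) (h : K' ⟶ K) (f : A ⟶ C) :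
    D.LExact (p := prodMap h (𝟙 A)) (f := prodMap (𝟙 K) f) (q := prodMap (𝟙 K') f)
      (g := prodMap h (𝟙 C)) (𝟙 (prodMap h f)) := by
  let θ (x : prodCat K' C) : (overProj f x.2 ≫ sectRHom x.1 A) ≫ prodMap (𝟙 K') f ⟶
      toPt _ ≫ (ptHom x.2 ≫ sectRHom x.1 C) :=
    paste (q := f) (g := sectRHom x.1 C) (𝟙 (sectRHom x.1 A ≫ prodMap (𝟙 K') f)) (overCell f x.2)
  refine LExact.of_local (ι := prodCat K' C) (hD.der3_left _) θ (fun h H => (hD.der2 h).2 H)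
    (fun x => (hD.lexact_sectR x.1 f).paste (hD.lexact_overCell f x.2)) (fun x => ?_)
  refine hD.lexact_of_isReflective ?_
  refine isReflective_slice_right h x.1 f x.2 (paste (p := prodMap h (𝟙 A))
    (f := prodMap (𝟙 K) f) (q := prodMap (𝟙 K') f) (g := prodMap h (𝟙 C))
    (𝟙 (prodMap h f)) (θ x)) fun t => prod_hom_ext ?_ ?_
  · exact (Category.id_comp _).trans ((congrArg _ (Category.id_comp (𝟙 x.1))).trans
      (h.toFunctor.map_id x.1))
  · exact (Category.id_comp _).trans (Category.id_comp t.hom)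

/-- The square `f × g` is left exact. -/
lemma IsDerivator.lexact_prod_left (hD : IsDerivator D) (f : K ⟶ L) (g : A' ⟶ A) :
    D.LExact (p := prodMap (𝟙 K) g) (f := prodMap f (𝟙 A)) (q := prodMap f (𝟙 A'))
      (g := prodMap (𝟙 L) g) (𝟙 (prodMap f g)) := by
  let θ (x : prodCat L A') : (overProj f x.1 ≫ sectLHom K x.2) ≫ prodMap f (𝟙 A') ⟶
      toPt _ ≫ (ptHom x.1 ≫ sectLHom L x.2) := overCell f x.1 ▷ sectLHom L x.2
  refine LExact.of_local (ι := prodCat L A') (hD.der3_left _) θ (fun h H => (hD.der2 h).2 H)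
    (fun x => hD.lexact_of_isReflective ?_) (fun x => hD.lexact_of_isReflective ?_)
  · exact isReflective_slice_left f x.1 (𝟙 A') x.2 (θ x) fun t => rfl
  · refine isReflective_slice_left f x.1 g x.2 (paste (p := prodMap (𝟙 K) g)
      (f := prodMap f (𝟙 A)) (q := prodMap f (𝟙 A')) (g := prodMap (𝟙 L) g)
      (𝟙 (prodMap f g)) (θ x)) fun t => prod_hom_ext ?_ ?_
    · exact Category.id_comp t.hom
    · exact (Category.id_comp _).trans (g.toFunctor.map_id x.2)

/-- The product of a category with a square. -/
abbrev prodCell (K : Cat.{u, u}) {p : P ⟶ A} {f : A ⟶ C} {q : P ⟶ B} {g : B ⟶ C}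
    (θ : p ≫ f ⟶ q ≫ g) :
    prodMap (𝟙 K) p ≫ prodMap (𝟙 K) f ⟶ prodMap (𝟙 K) q ≫ prodMap (𝟙 K) g :=
  Cat.Hom₂.ofNatTrans (NatTrans.prod (𝟙 (𝟭 K)) θ.toNatTrans)

/-- Isomorphisms over `K × B` are detected on the slices `{k} × B`. There the pasting with
`lexact_sectR` for `q` equals `lexact_sectR` for `f` pasted with `θ` itself. -/
theorem Prederivator.LExact.prod (hD : IsDerivator D) {p : P ⟶ A} {f : A ⟶ C} {q : P ⟶ B} {g : B ⟶ C}
    {θ : p ≫ f ⟶ q ≫ g} (h : D.LExact θ) (K : Cat.{u, u}) : D.LExact (prodCell K θ) := by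
  refine LExact.of_local (ι := K) (hD.der3_left _) (p' := fun k => sectRHom k P) (q' := fun k => q)
    (g' := fun k => sectRHom k B) (fun k => 𝟙 _) (fun h => hD.isIso_of_sectR h)
    (fun k => hD.lexact_sectR k q) (fun k => ?_)
  refine ((hD.lexact_sectR k f).paste h).congr ?_
  refine Cat.Hom₂.ext (NatTrans.ext (funext fun x => prod_hom_ext ?_ ?_))
  · rfl
  · exact (Category.id_comp (θ.toNatTrans.app x)).trans ((congrArg (θ.toNatTrans.app x ≫ ·)
      (g.toFunctor.map_id (q.toFunctor.obj x))).trans (Category.comp_id (θ.toNatTrans.app x))).symm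

end Products

end

/-! ### The derivator axioms in terms of left exact squares -/

section

variable {D : Prederivator.{u, v, w}}

/-- The right half of (Der4) is right exactness. It is transposed so that both halves concern
`LExact`, the notion shown to survive products and equivalences. -/
lemma IsDerivator.lexact_underCell (hD : IsDerivator D) {A B : Cat.{u, u}} (f : A ⟶ B) (b : B) :
    D.LExact (underCell f b) := by
  have := hD.der3_right f
  have := hD.der3_right (toPt (underCat f b))
  exact ((isIso_mate_iff_rexact _ _).1 (hD.der4_right f b
    (CategoryTheory.Adjunction.ofIsLeftAdjoint (D.res f))
    (CategoryTheory.Adjunction.ofIsLeftAdjoint (D.res (toPt (underCat f b)))))).lexact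
      (hD.der3_right f)

/-- Constructor for derivators, in terms of left exactness of the slice squares. -/
lemma IsDerivator.of_lexact
    (der1 : ∀ (ι : Type u) (A : ι → Cat.{u, u}),
      (Functor.pi' fun i => D.res (B := Cat.of (Σ i, A i))
        (CategoryTheory.Sigma.incl (C := fun i => A i) i).toCatHom).IsEquivalence)
    (der2 : ∀ {A : Cat.{u, u}} {X Y : D.val A} (f : X ⟶ Y),
      IsIso f ↔ ∀ a : A, IsIso ((D.res (ptHom a)).map f))
    (der3_left : ∀ {A B : Cat.{u, u}} (f : A ⟶ B), (D.res f).IsRightAdjoint)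
    (der3_right : ∀ {A B : Cat.{u, u}} (f : A ⟶ B), (D.res f).IsLeftAdjoint)
    (h : ∀ {A B : Cat.{u, u}} (f : A ⟶ B) (b : B), D.LExact (overCell f b))
    (h' : ∀ {A B : Cat.{u, u}} (f : A ⟶ B) (b : B), D.LExact (underCell f b)) :
    IsDerivator D where
  der1 := der1
  der2 := der2
  der3_left := der3_left
  der3_right := der3_right
  der4_left f b _ adj _ adj' := (isIso_mate_iff_lexact adj adj').2 (h f b)
  der4_right f b _ adj _ adj' := (isIso_mate_iff_rexact adj adj').2
    ((h' f b).rexact (der3_left _))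

namespace Prederivator

variable {A B C P : Cat.{u, u}}

/-- Isomorphic functors have isomorphic restrictions. -/
abbrev resMapIso (D : Prederivator.{u, v, w}) {f g : A ⟶ B} (α : f ≅ g) : D.res f ≅ D.res g :=
  NatIso.ofComponents
    (fun X => ⟨(D.resMap α.hom).app X, (D.resMap α.inv).app X,
      by rw [← resMap_comp, Iso.hom_inv_id, resMap_id],
      by rw [← resMap_comp, Iso.inv_hom_id, resMap_id]⟩) (fun k => (D.resMap α.hom).naturality k)

/-- Restriction along an equivalence of categories. -/
def resEquivalence (D : Prederivator.{u, v, w}) (e : A ⥤ B) [e.IsEquivalence] :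
    CategoryTheory.Equivalence (D.val B) (D.val A) :=
  CategoryTheory.Equivalence.mk (D.res e.toCatHom) (D.res e.inv.toCatHom)
    ((D.resId B).symm ≪≫ D.resMapIso (Cat.Hom.isoMk (F := 𝟭 _) (G := e.inv ⋙ e) e.asEquivalence.counitIso.symm) ≪≫
      D.resComp e.inv.toCatHom e.toCatHom)
    ((D.resComp e.toCatHom e.inv.toCatHom).symm ≪≫
      D.resMapIso (Cat.Hom.isoMk (F := e ⋙ e.inv) (G := 𝟭 _) e.asEquivalence.unitIso.symm) ≪≫ D.resId A)

lemma res_isEquivalence (f : A ⟶ B) (h : f.toFunctor.IsEquivalence) : (D.res f).IsEquivalence :=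
  (D.resEquivalence f.toFunctor).isEquivalence_functor

end Prederivator

/-! ### Shifted derivators -/

section Shift

variable {A B C P : Cat.{u, u}}

/-- The comparison cells of the 2-functor `K × -` have identity components, so the shifted structure
maps differ from those of `D` only by restrictions of identities. -/
lemma shift_sqApp (K : Cat.{u, u}) {p : P ⟶ A} {f : A ⟶ C} {q : P ⟶ B} {g : B ⟶ C}
    (θ : p ≫ f ⟶ q ≫ g) (Z : D.val (prodCat K C)) :
    (sqApp (D := D.shift K) θ Z : _) = sqApp (D := D) (prodCell K θ) Z := by
  have h1 : ((D.shift K).resComp p f).inv.app Z =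
      (D.resComp (prodMap (𝟙 K) p) (prodMap (𝟙 K) f)).inv.app Z ≫ (D.resMap (𝟙 _)).app Z := rfl
  have h2 : ((D.shift K).resComp q g).hom.app Z = (D.resMap (𝟙 _)).app Z ≫
      (D.resComp (prodMap (𝟙 K) q) (prodMap (𝟙 K) g)).hom.app Z := rfl
  rw [sqApp_eq, sqApp_eq, h1, h2, resMap_id, resMap_id]
  exact congrArg₂ (· ≫ ·) (Category.comp_id _) (congrArg _ (Category.id_comp _))

lemma Prederivator.LExact.shift (K : Cat.{u, u}) {p : P ⟶ A} {f : A ⟶ C} {q : P ⟶ B} {g : B ⟶ C}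
    {θ : p ≫ f ⟶ q ≫ g} (h : D.LExact (prodCell K θ)) : (D.shift K).LExact θ := by
  intro X Z φ hφ
  exact (h φ hφ).congr (by rw [shift_sqApp]; rfl)

/-- The functor `Σ i, K × A i ⥤ K × Σ i, A i`. -/
abbrev sigmaProd (K : Cat.{u, u}) {ι : Type u} (A : ι → Cat.{u, u}) :
    (Σ i, (prodCat K (A i) : Cat.{u, u})) ⥤ K × (Σ i, A i) :=
  CategoryTheory.Sigma.desc fun i => (𝟭 K).prod (CategoryTheory.Sigma.incl (C := fun i => A i) i)

lemma sigmaProd_isEquivalence (K : Cat.{u, u}) {ι : Type u} (A : ι → Cat.{u, u}) :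
    (sigmaProd K A).IsEquivalence where
  faithful := ⟨by
    rintro ⟨i, k, a⟩ ⟨j, k', a'⟩ ⟨f, f'⟩ ⟨g, g'⟩ h
    have h₁ : f = g := congr($(h).1)
    have h₂ : (CategoryTheory.Sigma.incl (C := fun i => A i) i).map f' =
        (CategoryTheory.Sigma.incl (C := fun i => A i) i).map g' := congr($(h).2)
    obtain rfl := h₁
    obtain rfl := Functor.map_injective _ h₂
    rfl⟩
  full := ⟨by
    rintro ⟨i, k, a⟩ ⟨j, k', a'⟩ ⟨f, ⟨g⟩⟩
    exact ⟨Sigma.SigmaHom.mk (f, g), rfl⟩⟩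
  essSurj := ⟨by
    rintro ⟨k, i, a⟩
    exact ⟨⟨i, k, a⟩, ⟨Iso.refl _⟩⟩⟩

/-- (Der1) uses that `K × -` distributes over coproducts. For (Der2), isomorphisms over `K × A` are
detected at the points `(k, a)`, and these factor through `K × {a}`. (Der4) is `LExact.prod` for the
slice squares. -/
theorem IsDerivator.shift (hD : IsDerivator D) (K : Cat.{u, u}) : IsDerivator (D.shift K) :=
  IsDerivator.of_lexact
    (fun ι A => by
      have h1 := hD.der1 ι (fun i => prodCat K (A i))
      have h2 := res_isEquivalence (D := D) (sigmaProd K A).toCatHom (sigmaProd_isEquivalence K A)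
      refine Functor.isEquivalence_of_iso (F := D.res (sigmaProd K A).toCatHom ⋙ Functor.pi' fun i =>
        D.res (B := Cat.of (Σ i, prodCat K (A i)))
          (CategoryTheory.Sigma.incl (C := fun i => prodCat K (A i)) i).toCatHom) ?_
      exact NatIso.pi' fun i => (D.resComp (C := prodCat K (Cat.of (Σ i, A i)))
        (CategoryTheory.Sigma.incl (C := fun i => prodCat K (A i)) i).toCatHom
        (sigmaProd K A).toCatHom).symm)
    (fun {A X Y} f => ⟨fun h a => Functor.map_isIso ((D.shift K).res (ptHom a)) f,
      fun h => (hD.der2 f).2 fun ⟨k, a⟩ => by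
        let q : ptCat.{u} ⟶ prodCat K ptCat.{u} := ptHom k ≫ sectLHom K (⟨⟨⟩⟩ : ptCat.{u})
        have h1 : IsIso ((D.res (prodMap (𝟙 K) (ptHom a))).map f) := h a
        have h2 : IsIso ((D.res (prodMap (𝟙 K) (ptHom a)) ⋙ D.res q).map f) :=
          Functor.map_isIso (D.res q) ((D.res (prodMap (𝟙 K) (ptHom a))).map f)
        exact (NatIso.isIso_map_iff (D.resComp q (prodMap (𝟙 K) (ptHom a))) f).2 h2⟩)
    (fun f => hD.der3_left _) (fun f => hD.der3_right _)
    (fun f b => ((hD.lexact_overCell f b).prod hD K).shift)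
    (fun f b => ((hD.lexact_underCell f b).prod hD K).shift)

end Shift

end

/-! ### Universal arrows across equivalences of categories -/

section

section Equivalences

variable {𝒞 : Type u₁} [Category.{v₁} 𝒞] {𝒟 : Type u₂} [Category.{v₂} 𝒟]
  {𝒞' : Type u₁} [Category.{v₁} 𝒞'] {𝒟' : Type u₂} [Category.{v₂} 𝒟']

lemma isUniv_comp_iff_of_fullyFaithful {R : 𝒟 ⥤ 𝒞} {X : 𝒞} {Z : 𝒟} (φ : X ⟶ R.obj Z) (G : 𝒞 ⥤ 𝒞')
    [G.Full] [G.Faithful] : IsUniv (R ⋙ G) (G.map φ) ↔ IsUniv R φ := by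
  refine forall_congr' fun Y => ?_
  have : (fun k : Z ⟶ Y => G.map φ ≫ (R ⋙ G).map k) =
      G.map ∘ fun k : Z ⟶ Y => φ ≫ R.map k := by
    ext k; simp
  rw [this]
  exact Function.Bijective.of_comp_iff' ⟨G.map_injective, G.map_surjective⟩ _

lemma isUniv_iff_of_isEquivalence {R : 𝒟' ⥤ 𝒞} {X : 𝒞} (F : 𝒟 ⥤ 𝒟') [F.IsEquivalence] {Z : 𝒟}
    (φ : X ⟶ R.obj (F.obj Z)) : IsUniv (F ⋙ R) φ ↔ IsUniv R φ := by
  have key (Y : 𝒟) : (fun k : Z ⟶ Y => φ ≫ (F ⋙ R).map k) =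
      (fun k : F.obj Z ⟶ F.obj Y => φ ≫ R.map k) ∘ F.map := rfl
  have hF (Y : 𝒟) : Function.Bijective (F.map : (Z ⟶ Y) → _) := ⟨F.map_injective, F.map_surjective⟩
  refine ⟨fun h Y => ?_, fun h Y => ?_⟩
  · obtain ⟨W, ⟨e⟩⟩ := Functor.EssSurj.mem_essImage (F := F) Y
    have h1 := h W
    rw [key, Function.Bijective.of_comp_iff _ (hF W)] at h1
    have : (fun k : F.obj Z ⟶ Y => φ ≫ R.map k) =
        (fun k => k ≫ R.map e.hom) ∘ (fun k : F.obj Z ⟶ F.obj W => φ ≫ R.map k) ∘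
          fun k => k ≫ e.inv := by
      ext k; simp [← Functor.map_comp]
    rw [this]
    exact ((R.mapIso e).homToEquiv (Z := X)).bijective.comp
      (h1.comp (e.symm.homToEquiv (Z := F.obj Z)).bijective)
  · rw [key, Function.Bijective.of_comp_iff _ (hF Y)]
    exact h _

/-- On the side of `G` full faithfulness is enough, since the arrow already lies in its image; `F`
must also be essentially surjective because universality quantifies over all objects. -/
lemma isUniv_iff_of_square {R : 𝒟 ⥤ 𝒞} {R' : 𝒟' ⥤ 𝒞'} {F : 𝒟 ⥤ 𝒟'} {G : 𝒞 ⥤ 𝒞'} [F.IsEquivalence]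
    [G.Full] [G.Faithful] (e : R ⋙ G ≅ F ⋙ R') {X : 𝒞} {Z : 𝒟} (φ : X ⟶ R.obj Z) :
    IsUniv R' (X := G.obj X) (Z := F.obj Z) (G.map φ ≫ e.hom.app Z) ↔ IsUniv R φ := by
  rw [← isUniv_comp_iff_of_fullyFaithful φ G, ← isUniv_iff_of_isEquivalence F]
  refine ⟨fun h => ?_, fun h => h.of_natIso e⟩
  have := h.of_natIso e.symm
  refine this.congr ?_
  simp

lemma isCouniv_comp_iff_of_fullyFaithful {R : 𝒟 ⥤ 𝒞} {X : 𝒞} {Z : 𝒟} (φ : R.obj Z ⟶ X) (G : 𝒞 ⥤ 𝒞')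
    [G.Full] [G.Faithful] : IsCouniv (R ⋙ G) (G.map φ) ↔ IsCouniv R φ := by
  refine forall_congr' fun Y => ?_
  have : (fun k : Y ⟶ Z => (R ⋙ G).map k ≫ G.map φ) =
      G.map ∘ fun k : Y ⟶ Z => R.map k ≫ φ := by
    ext k; simp
  rw [this]
  exact Function.Bijective.of_comp_iff' ⟨G.map_injective, G.map_surjective⟩ _

lemma isCouniv_iff_of_isEquivalence {R : 𝒟' ⥤ 𝒞} {X : 𝒞} (F : 𝒟 ⥤ 𝒟') [F.IsEquivalence] {Z : 𝒟}
    (φ : R.obj (F.obj Z) ⟶ X) : IsCouniv (F ⋙ R) φ ↔ IsCouniv R φ := by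
  have key (Y : 𝒟) : (fun k : Y ⟶ Z => (F ⋙ R).map k ≫ φ) =
      (fun k : F.obj Y ⟶ F.obj Z => R.map k ≫ φ) ∘ F.map := rfl
  have hF (Y : 𝒟) : Function.Bijective (F.map : (Y ⟶ Z) → _) := ⟨F.map_injective, F.map_surjective⟩
  refine ⟨fun h Y => ?_, fun h Y => ?_⟩
  · obtain ⟨W, ⟨e⟩⟩ := Functor.EssSurj.mem_essImage (F := F) Y
    have h1 := h W
    rw [key, Function.Bijective.of_comp_iff _ (hF W)] at h1
    have : (fun k : Y ⟶ F.obj Z => R.map k ≫ φ) =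
        (fun k => R.map e.inv ≫ k) ∘ (fun k : F.obj W ⟶ F.obj Z => R.map k ≫ φ) ∘
          fun k => e.hom ≫ k := by
      ext k; simp only [Function.comp_apply, ← Category.assoc, ← Functor.map_comp, Iso.inv_hom_id, Category.id_comp]
    rw [this]
    exact ((R.mapIso e).homFromEquiv (Z := X)).bijective.comp
      (h1.comp (e.symm.homFromEquiv (Z := F.obj Z)).bijective)
  · rw [key, Function.Bijective.of_comp_iff _ (hF Y)]
    exact h _

lemma isCouniv_iff_of_square {R : 𝒟 ⥤ 𝒞} {R' : 𝒟' ⥤ 𝒞'} {F : 𝒟 ⥤ 𝒟'} {G : 𝒞 ⥤ 𝒞'} [F.IsEquivalence]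
    [G.Full] [G.Faithful] (e : R ⋙ G ≅ F ⋙ R') {X : 𝒞} {Z : 𝒟} (φ : R.obj Z ⟶ X) :
    IsCouniv R' (X := G.obj X) (Z := F.obj Z) (e.inv.app Z ≫ G.map φ) ↔ IsCouniv R φ := by
  rw [← isCouniv_comp_iff_of_fullyFaithful φ G, ← isCouniv_iff_of_isEquivalence F]
  refine ⟨fun h => ?_, fun h => h.of_natIso e⟩
  have := h.of_natIso e.symm
  refine this.congr ?_
  simp

lemma IsCouniv.of_isIso {R : 𝒟 ⥤ 𝒞} {X : 𝒞} {Z : 𝒟} {φ : R.obj Z ⟶ X} [R.Full] [R.Faithful]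
    [IsIso φ] : IsCouniv R φ := by
  have h : IsCouniv R (𝟙 (R.obj Z)) := fun Y => by
    simpa using ⟨R.map_injective, R.map_surjective⟩
  simpa using (IsCouniv.comp_iso_iff φ).2 h

end Equivalences

namespace Prederivator

variable {D : Prederivator.{u, v, w}} {A B C E P Q K L : Cat.{u, u}}

/-! ### Objects that are Kan extensions of their restrictions -/

/-- `X` is a left Kan extension of its restriction along `f`. -/
def IsLKE (D : Prederivator.{u, v, w}) (f : A ⟶ B) (X : D.val B) : Prop :=
  ∀ Y, Function.Bijective fun k : X ⟶ Y => (D.res f).map k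

/-- `X` is a right Kan extension of its restriction along `f`. -/
def IsRKE (D : Prederivator.{u, v, w}) (f : A ⟶ B) (X : D.val B) : Prop :=
  ∀ Y, Function.Bijective fun k : Y ⟶ X => (D.res f).map k

lemma isLKE_iff {f : A ⟶ B} {X : D.val B} :
    D.IsLKE f X ↔ IsUniv (D.res f) (𝟙 ((D.res f).obj X)) := by
  simp only [IsLKE, IsUniv, Category.id_comp]

lemma isRKE_iff {f : A ⟶ B} {X : D.val B} :
    D.IsRKE f X ↔ IsCouniv (D.res f) (𝟙 ((D.res f).obj X)) := by
  simp only [IsRKE, IsCouniv, Category.comp_id]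

lemma IsUniv.isLKE {f : A ⟶ B} {X : D.val A} {Z : D.val B} {φ : X ⟶ (D.res f).obj Z}
    (h : IsUniv (D.res f) φ) [IsIso φ] : D.IsLKE f Z :=
  isLKE_iff.2 ((IsUniv.iso_comp_iff φ).1 (h.congr (Category.comp_id _).symm))

lemma IsCouniv.isRKE {f : A ⟶ B} {X : D.val A} {Z : D.val B} {φ : (D.res f).obj Z ⟶ X}
    (h : IsCouniv (D.res f) φ) [IsIso φ] : D.IsRKE f Z :=
  isRKE_iff.2 ((IsCouniv.comp_iso_iff φ).1 (h.congr (Category.id_comp _).symm))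

lemma IsLKE.isUniv {f : A ⟶ B} {X : D.val A} {Z : D.val B} (h : D.IsLKE f Z)
    (φ : X ⟶ (D.res f).obj Z) [IsIso φ] : IsUniv (D.res f) φ :=
  ((IsUniv.iso_comp_iff φ).2 (isLKE_iff.1 h)).congr (Category.comp_id _)

lemma IsRKE.isCouniv {f : A ⟶ B} {X : D.val A} {Z : D.val B} (h : D.IsRKE f Z)
    (φ : (D.res f).obj Z ⟶ X) [IsIso φ] : IsCouniv (D.res f) φ :=
  ((IsCouniv.comp_iso_iff φ).2 (isRKE_iff.1 h)).congr (Category.id_comp _)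

lemma IsLKE.of_iso {f : A ⟶ B} {X Y : D.val B} (h : D.IsLKE f X) (e : X ≅ Y) : D.IsLKE f Y :=
  IsUniv.isLKE (φ := (D.res f).map e.hom) (((isLKE_iff.1 h).comp_iso e.hom).congr
    (Category.id_comp _))

lemma IsRKE.of_iso {f : A ⟶ B} {X Y : D.val B} (h : D.IsRKE f X) (e : X ≅ Y) : D.IsRKE f Y :=
  IsCouniv.isRKE (φ := (D.res f).map e.inv) (((isRKE_iff.1 h).iso_comp e.inv).congr
    (Category.comp_id _))

lemma IsLKE.isIso {f : A ⟶ B} {X Y : D.val B} (hX : D.IsLKE f X) (hY : D.IsLKE f Y) (h : X ⟶ Y)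
    [IsIso ((D.res f).map h)] : IsIso h :=
  (isLKE_iff.1 hX).isIso_of_comp h ((hY.isUniv ((D.res f).map h)).congr (Category.id_comp _).symm)

lemma IsRKE.isIso {f : A ⟶ B} {X Y : D.val B} (hX : D.IsRKE f X) (hY : D.IsRKE f Y) (h : X ⟶ Y)
    [IsIso ((D.res f).map h)] : IsIso h :=
  (isRKE_iff.1 hY).isIso_of_comp h ((hX.isCouniv ((D.res f).map h)).congr (Category.comp_id _).symm)

/-- Objects that are left Kan extended from isomorphic objects are isomorphic. -/
lemma IsLKE.exists_iso {f : A ⟶ B} {X Y : D.val B} (hX : D.IsLKE f X) (hY : D.IsLKE f Y)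
    (e : (D.res f).obj X ≅ (D.res f).obj Y) : ∃ e' : X ≅ Y, (D.res f).map e'.hom = e.hom := by
  obtain ⟨k, hk : (D.res f).map k = e.hom⟩ := (hX Y).2 e.hom
  have : IsIso ((D.res f).map k) := hk ▸ inferInstance
  have := hX.isIso hY k
  exact ⟨asIso k, hk⟩

lemma IsRKE.exists_iso {f : A ⟶ B} {X Y : D.val B} (hX : D.IsRKE f X) (hY : D.IsRKE f Y)
    (e : (D.res f).obj X ≅ (D.res f).obj Y) : ∃ e' : X ≅ Y, (D.res f).map e'.hom = e.hom := by
  obtain ⟨k, hk : (D.res f).map k = e.hom⟩ := (hY X).2 e.hom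
  have : IsIso ((D.res f).map k) := hk ▸ inferInstance
  have := hX.isIso hY k
  exact ⟨asIso k, hk⟩

/-- Up to `resComp`, the map on morphisms for `f ≫ g` is the one for `g` followed by the one for
`f`, and the latter is bijective by hypothesis. -/
lemma isLKE_comp_iff {f : A ⟶ B} {g : B ⟶ C} {X : D.val C} (h : D.IsLKE f ((D.res g).obj X)) :
    D.IsLKE (f ≫ g) X ↔ D.IsLKE g X := by
  refine forall_congr' fun Y => ?_
  rw [← Function.Bijective.of_comp_iff' (h _)]
  have : (fun k : X ⟶ Y => (D.res (f ≫ g)).map k) =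
    (fun l => (D.resComp f g).hom.app X ≫ l ≫ (D.resComp f g).inv.app Y) ∘
      ((fun k => (D.res f).map k) ∘ fun k : X ⟶ Y => (D.res g).map k) := by
    ext k
    exact (NatIso.naturality_2 (D.resComp f g) k).symm
  rw [this]
  exact Function.Bijective.of_comp_iff'
    (((D.resComp f g).app X).homCongr ((D.resComp f g).app Y)).symm.bijective _

lemma isRKE_comp_iff {f : A ⟶ B} {g : B ⟶ C} {X : D.val C} (h : D.IsRKE f ((D.res g).obj X)) :
    D.IsRKE (f ≫ g) X ↔ D.IsRKE g X := by
  refine forall_congr' fun Y => ?_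
  rw [← Function.Bijective.of_comp_iff' (h _)]
  have : (fun k : Y ⟶ X => (D.res (f ≫ g)).map k) =
    (fun l => (D.resComp f g).hom.app Y ≫ l ≫ (D.resComp f g).inv.app X) ∘
      ((fun k => (D.res f).map k) ∘ fun k : Y ⟶ X => (D.res g).map k) := by
    ext k
    exact (NatIso.naturality_2 (D.resComp f g) k).symm
  rw [this]
  exact Function.Bijective.of_comp_iff'
    (((D.resComp f g).app Y).homCongr ((D.resComp f g).app X)).symm.bijective _

/-- The cell exhibiting the value of a left Kan extension at an object in the image. -/
lemma isReflective_ptHom (f : A ⟶ B) (hf : f.toFunctor.FullyFaithful) (a : A) :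
    IsReflective (p := ptHom a) (f := f) (c := ptHom a ≫ f)
      (Cat.Hom₂.ofNatTrans (F := ptHom a ≫ f) (G := toPt ptCat ≫ (ptHom a ≫ f))
        { app := fun _ => 𝟙 _ }) := by
  intro b x
  refine ⟨⟨⟨⟩⟩, hf.preimage x, ?_, fun t v hv => ⟨𝟙 _, ?_, fun m _ => ?_⟩⟩
  · exact (Category.comp_id _).trans (hf.map_preimage x)
  · refine (Category.comp_id _).trans (hf.map_injective ((hf.map_preimage x).trans ?_))
    exact hv.symm.trans (Category.comp_id _)
  · exact discrete_hom_ext (α := PUnit) _ _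

end Prederivator

open Prederivator

variable {D : Prederivator.{u, v, w}} {A B : Cat.{u, u}}

lemma toPt_isEquivalence : (toPt ptCat.{u}).toFunctor.IsEquivalence :=
  Functor.isEquivalence_of_iso (F := 𝟭 _) (NatIso.ofComponents (fun _ => eqToIso rfl)
    (fun _ => discrete_hom_ext (α := PUnit) _ _))

/-- Left Kan extensions along fully faithful functors do not change the given values. -/
lemma IsDerivator.isIso_of_isUniv (hD : IsDerivator D) {f : A ⟶ B} (hf : f.toFunctor.FullyFaithful)
    {X : D.val A} {Z : D.val B} (φ : X ⟶ (D.res f).obj Z) (hφ : IsUniv (D.res f) φ) : IsIso φ := by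
  refine (hD.der2 φ).2 fun a => ?_
  -- At a point in the image of `f` the slice may be replaced by a single point. Restriction along
  -- `toPt ptCat` is an equivalence, so the universal arrow over it is invertible.
  have h := (hD.lexact_of_isReflective (isReflective_ptHom f hf a)) φ hφ
  have := res_isEquivalence (D := D) _ toPt_isEquivalence
  have h1 := h.isIso_of_isEquivalence
  let θ : ptHom a ≫ f ⟶ toPt ptCat ≫ (ptHom a ≫ f) :=
    Cat.Hom₂.ofNatTrans (F := ptHom a ≫ f) (G := toPt ptCat ≫ (ptHom a ≫ f)) { app := fun _ => 𝟙 _ }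
  have : IsIso θ := by
    refine ⟨Cat.Hom₂.ofNatTrans (G := ptHom a ≫ f) (F := toPt ptCat ≫ (ptHom a ≫ f))
      { app := fun _ => 𝟙 _ }, ?_, ?_⟩ <;>
    exact Cat.Hom₂.ext (NatTrans.ext (funext fun s => Category.id_comp _))
  have : IsIso (sqApp (D := D) θ Z) := by
    rw [sqApp_eq]
    infer_instance
  exact IsIso.of_isIso_comp_right _ (sqApp (D := D) θ Z)

end

/-! ### Right Kan extensions along fully faithful functors; cocartesian squares as Kan extensions -/

section

namespace Prederivator

variable {D : Prederivator.{u, v, w}} {A B C E P Q K L : Cat.{u, u}}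

lemma isCoreflective_ptHom (f : A ⟶ B) (hf : f.toFunctor.FullyFaithful) (a : A) :
    IsCoreflective (p := ptHom a) (f := f) (c := ptHom a ≫ f)
      (Cat.Hom₂.ofNatTrans (F := toPt ptCat ≫ (ptHom a ≫ f)) (G := ptHom a ≫ f)
        { app := fun _ => 𝟙 _ }) := by
  intro b x
  refine ⟨⟨⟨⟩⟩, hf.preimage x, ?_, fun t v hv => ⟨𝟙 _, ?_, fun m _ => ?_⟩⟩
  · exact (Category.id_comp _).trans (hf.map_preimage x)
  · refine (Category.id_comp _).trans (hf.map_injective ((hf.map_preimage x).trans ?_))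
    exact hv.symm.trans (Category.id_comp _)
  · exact discrete_hom_ext (α := PUnit) _ _

end Prederivator

section

variable {D : Prederivator.{u, v, w}} {A B C : Cat.{u, u}}

/-- Right Kan extensions along fully faithful functors do not change the given values. -/
lemma IsDerivator.isIso_of_isCouniv (hD : IsDerivator D) {f : A ⟶ B}
    (hf : f.toFunctor.FullyFaithful)
    {X : D.val A} {Z : D.val B} (φ : (D.res f).obj Z ⟶ X) (hφ : IsCouniv (D.res f) φ) :
    IsIso φ := by
  refine (hD.der2 φ).2 fun a => ?_
  have h := ((hD.lexact_of_isCoreflective (isCoreflective_ptHom f hf a)).rexact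
    (hD.der3_left _)) φ hφ
  have := res_isEquivalence (D := D) _ toPt_isEquivalence
  have h1 := h.isIso_of_isEquivalence
  let θ : toPt ptCat ≫ (ptHom a ≫ f) ⟶ ptHom a ≫ f :=
    Cat.Hom₂.ofNatTrans (F := toPt ptCat ≫ (ptHom a ≫ f)) (G := ptHom a ≫ f) { app := fun _ => 𝟙 _ }
  have : IsIso θ := by
    refine ⟨Cat.Hom₂.ofNatTrans (F := ptHom a ≫ f) (G := toPt ptCat ≫ (ptHom a ≫ f))
      { app := fun _ => 𝟙 _ }, ?_, ?_⟩ <;>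
    exact Cat.Hom₂.ext (NatTrans.ext (funext fun s => Category.id_comp _))
  have : IsIso (sqApp (D := D) θ Z) := by
    rw [sqApp_eq]
    infer_instance
  exact IsIso.of_isIso_comp_left (sqApp (D := D) θ Z) _

lemma IsDerivator.exists_isLKE (hD : IsDerivator D) {f : A ⟶ B} (hf : f.toFunctor.FullyFaithful)
    (X : D.val A) : ∃ Z, D.IsLKE f Z ∧ Nonempty ((D.res f).obj Z ≅ X) := by
  obtain ⟨Z, φ, hφ⟩ := exists_isUniv (D.res f) (hD.der3_left f) X
  have := hD.isIso_of_isUniv hf φ hφ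
  exact ⟨Z, IsUniv.isLKE hφ, ⟨(asIso φ).symm⟩⟩

lemma IsDerivator.exists_isRKE (hD : IsDerivator D) {f : A ⟶ B} (hf : f.toFunctor.FullyFaithful)
    (X : D.val A) : ∃ Z, D.IsRKE f Z ∧ Nonempty ((D.res f).obj Z ≅ X) := by
  obtain ⟨Z, φ, hφ⟩ := exists_isCouniv (D.res f) (hD.der3_right f) X
  have := hD.isIso_of_isCouniv hf φ hφ
  exact ⟨Z, IsCouniv.isRKE hφ, ⟨asIso φ⟩⟩

/-- Along a fully faithful functor the unit is invertible, so the essential image of any left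
adjoint consists of the objects extended from their own restriction. This frees the notion of
cocartesian square from a choice of adjoint. -/
lemma IsDerivator.isLKE_iff_essImage (hD : IsDerivator D) {f : A ⟶ B}
    (hf : f.toFunctor.FullyFaithful) (Z : D.val B) :
    D.IsLKE f Z ↔ ∃ (F : D.val A ⥤ D.val B) (_ : F ⊣ D.res f), F.essImage Z := by
  constructor
  · intro h
    have := hD.der3_left f
    refine ⟨_, CategoryTheory.Adjunction.ofIsRightAdjoint (D.res f), ⟨(D.res f).obj Z, ?_⟩⟩
    obtain ⟨e, -⟩ := (isUniv_unit (CategoryTheory.Adjunction.ofIsRightAdjoint (D.res f))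
      ((D.res f).obj Z)).exists_iso (isLKE_iff.1 h)
    exact ⟨e⟩
  · rintro ⟨F, adj, X, ⟨e⟩⟩
    have := hD.isIso_of_isUniv hf _ (isUniv_unit adj X)
    exact IsLKE.of_iso (IsUniv.isLKE (isUniv_unit adj X)) e

lemma IsDerivator.isRKE_iff_essImage (hD : IsDerivator D) {f : A ⟶ B}
    (hf : f.toFunctor.FullyFaithful) (Z : D.val B) :
    D.IsRKE f Z ↔ ∃ (F : D.val A ⥤ D.val B) (_ : D.res f ⊣ F), F.essImage Z := by
  constructor
  · intro h
    have := hD.der3_right f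
    refine ⟨_, CategoryTheory.Adjunction.ofIsLeftAdjoint (D.res f), ⟨(D.res f).obj Z, ?_⟩⟩
    obtain ⟨e, -⟩ := (isRKE_iff.1 h).exists_iso
      (isCouniv_counit (CategoryTheory.Adjunction.ofIsLeftAdjoint (D.res f)) ((D.res f).obj Z))
    exact ⟨e⟩
  · rintro ⟨F, adj, X, ⟨e⟩⟩
    have := hD.isIso_of_isCouniv hf _ (isCouniv_counit adj X)
    exact IsRKE.of_iso (IsCouniv.isRKE (isCouniv_counit adj X)) e

/-- The product of a fully faithful functor with an identity is fully faithful. -/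
def fullyFaithfulProd (f : A ⟶ B) (hf : f.toFunctor.FullyFaithful) (C : Cat.{u, u}) :
    (prodMap f (𝟙 C)).toFunctor.FullyFaithful where
  preimage k := (hf.preimage k.1, k.2)
  map_preimage k := prod_hom_ext (hf.map_preimage k.1) rfl
  preimage_map k := prod_hom_ext (hf.preimage_map k.1) rfl

def fullyFaithfulProd' (f : A ⟶ B) (hf : f.toFunctor.FullyFaithful) (C : Cat.{u, u}) :
    (prodMap (𝟙 C) f).toFunctor.FullyFaithful where
  preimage k := (k.1, hf.preimage k.2)
  map_preimage k := prod_hom_ext rfl (hf.map_preimage k.2)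
  preimage_map k := prod_hom_ext rfl (hf.preimage_map k.2)

/-- An order embedding is a fully faithful functor. -/
def fullyFaithfulOfLe {X Y : Type u} [Preorder X] [Preorder Y] (F : X ⥤ Y)
    (h : ∀ x y : X, F.obj x ≤ F.obj y → x ≤ y) : F.FullyFaithful where
  preimage k := homOfLE (h _ _ (leOfHom k))
  map_preimage _ := Subsingleton.elim _ _
  preimage_map _ := Subsingleton.elim _ _

def spanInclFF : spanIncl.{u}.toFunctor.FullyFaithful := fullyFaithfulOfLe (X := {x : Sq.{u} // x ≠ ⟨1, 1⟩}) (Y := Sq.{u}) _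
  fun _ _ h => h

def cospanInclFF : cospanIncl.{u}.toFunctor.FullyFaithful := fullyFaithfulOfLe (X := {x : Sq.{u} // x ≠ ⟨0, 0⟩})
  (Y := Sq.{u}) _ fun _ _ h => h

lemma IsDerivator.isCocartesian_iff (hD : IsDerivator D) (Q : D.val (prodCat sqCat A)) :
    D.IsCocartesian Q ↔ D.IsLKE (prodMap spanIncl (𝟙 A)) Q :=
  (hD.isLKE_iff_essImage (fullyFaithfulProd _ spanInclFF A) Q).symm

lemma IsDerivator.isCartesian_iff (hD : IsDerivator D) (Q : D.val (prodCat sqCat A)) :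
    D.IsCartesian Q ↔ D.IsRKE (prodMap cospanIncl (𝟙 A)) Q :=
  (hD.isRKE_iff_essImage (fullyFaithfulProd _ cospanInclFF A) Q).symm

end

/-! ### Transfer along levelwise equivalences -/

section Transfer

variable {E D : Prederivator.{u, v, w}} (ζ : E ⟶ D) {A B C P : Cat.{u, u}}

/-- The component of a morphism of prederivators. -/
abbrev trApp (A : Cat.{u, u}) : E.val A ⥤ D.val A := (ζ.app (op A)).toFunctor

lemma resIso_naturality (f : A ⟶ B) {X Y : E.val B} (k : X ⟶ Y) :
    (trApp ζ A).map ((E.res f).map k) ≫ (resIso ζ f Y).hom =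
      (resIso ζ f X).hom ≫ (D.res f).map ((trApp ζ B).map k) :=
  (Cat.Hom.toNatIso (ζ.naturality f.op)).hom.naturality k

lemma resIso_resMap {f g : A ⟶ B} (α : f ⟶ g) (X : E.val B) :
    (trApp ζ A).map ((E.resMap α).app X) ≫ (resIso ζ g X).hom =
      (resIso ζ f X).hom ≫ (D.resMap α).app ((trApp ζ B).obj X) :=
  congr($(ζ.naturality_naturality (Bicategory.Opposite.op2 α)).toNatTrans.app X)

lemma resIso_resComp (f : A ⟶ B) (g : B ⟶ C) (X : E.val C) :
    (resIso ζ (f ≫ g) X).hom ≫ (D.resComp f g).hom.app ((trApp ζ C).obj X) =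
      (trApp ζ A).map ((E.resComp f g).hom.app X) ≫ (resIso ζ f ((E.res g).obj X)).hom ≫
        (D.res f).map (resIso ζ g X).hom := by
  have h : _ = (trApp ζ A).map ((E.resComp f g).hom.app X) ≫ 𝟙 _ ≫
    (resIso ζ f ((E.res g).obj X)).hom ≫ 𝟙 _ ≫ (D.res f).map (resIso ζ g X).hom ≫ 𝟙 _ :=
      congr($(ζ.naturality_comp g.op f.op).toNatTrans.app X)
  rw [Category.id_comp, Category.id_comp, Category.comp_id] at h
  exact h

lemma resIso_resComp_inv (f : A ⟶ B) (g : B ⟶ C) (X : E.val C) :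
    (trApp ζ A).map ((E.resComp f g).inv.app X) ≫ (resIso ζ (f ≫ g) X).hom =
      (resIso ζ f ((E.res g).obj X)).hom ≫ (D.res f).map (resIso ζ g X).hom ≫
        (D.resComp f g).inv.app ((trApp ζ C).obj X) := by
  rw [← cancel_mono ((D.resComp f g).hom.app ((trApp ζ C).obj X)), Category.assoc, resIso_resComp,
    ← Functor.map_comp_assoc, Iso.inv_hom_id_app, CategoryTheory.Functor.map_id]
  simp

lemma resIso_sqApp {p : P ⟶ A} {f : A ⟶ C} {q : P ⟶ B} {g : B ⟶ C}
    (θ : p ≫ f ⟶ q ≫ g) (Z : E.val C) :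
    (trApp ζ P).map (sqApp θ Z) ≫ (resIso ζ q _).hom ≫ (D.res q).map (resIso ζ g Z).hom =
      (resIso ζ p _).hom ≫ (D.res p).map (resIso ζ f Z).hom ≫ sqApp θ ((trApp ζ C).obj Z) := by
  rw [sqApp_eq, sqApp_eq, Functor.map_comp, Functor.map_comp, Category.assoc, Category.assoc,
    ← resIso_resComp, reassoc_of% resIso_resMap, reassoc_of% resIso_resComp_inv]

variable {ζ} (hζ : ∀ A, (trApp ζ A).IsEquivalence)
include hζ

lemma isUniv_map_iff (f : A ⟶ B) {X : E.val A} {Z : E.val B} (φ : X ⟶ (E.res f).obj Z) :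
    IsUniv (D.res f) ((trApp ζ A).map φ ≫ (resIso ζ f Z).hom) ↔ IsUniv (E.res f) φ := by
  have := hζ A
  have : (ζ.app (op B)).toFunctor.IsEquivalence := hζ B
  exact isUniv_iff_of_square (R := E.res f) (R' := D.res f) (F := trApp ζ B) (G := trApp ζ A)
    (Cat.Hom.toNatIso (ζ.naturality f.op)) φ

lemma isCouniv_map_iff (f : A ⟶ B) {X : E.val A} {Z : E.val B} (φ : (E.res f).obj Z ⟶ X) :
    IsCouniv (D.res f) ((resIso ζ f Z).inv ≫ (trApp ζ A).map φ) ↔ IsCouniv (E.res f) φ := by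
  have := hζ A
  have : (ζ.app (op B)).toFunctor.IsEquivalence := hζ B
  exact isCouniv_iff_of_square (R := E.res f) (R' := D.res f) (F := trApp ζ B) (G := trApp ζ A)
    (Cat.Hom.toNatIso (ζ.naturality f.op)) φ

/-- Universal arrows are preserved and reflected by `ζ`, and `resIso_sqApp` identifies the image of
the base-changed arrow in `E` with the base change in `D`. -/
lemma LExact.of_equivalence {p : P ⟶ A} {f : A ⟶ C} {q : P ⟶ B} {g : B ⟶ C} {θ : p ≫ f ⟶ q ≫ g}
    (h : D.LExact θ) : E.LExact θ := by
  intro X Z φ hφ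
  have h1 := h _ ((isUniv_map_iff hζ f φ).2 hφ)
  rw [← isUniv_map_iff hζ]
  rw [← IsUniv.iso_comp_iff (resIso ζ p X).hom] at h1
  have h2 := h1.comp_iso (resIso ζ g Z).inv
  refine h2.congr ?_
  have h3 := resIso_naturality ζ p φ
  have h4 := resIso_sqApp ζ θ Z
  rw [Functor.map_comp, Functor.map_comp, Category.assoc, Category.assoc, Category.assoc,
    Category.assoc, ← reassoc_of% h3, ← reassoc_of% h4, ← Functor.map_comp, Iso.hom_inv_id,
    CategoryTheory.Functor.map_id, Category.comp_id]

lemma isLKE_map_iff (f : A ⟶ B) (X : E.val B) :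
    D.IsLKE f ((trApp ζ B).obj X) ↔ E.IsLKE f X := by
  rw [isLKE_iff (D := E), ← isUniv_map_iff hζ f (𝟙 _)]
  exact ⟨fun h => h.isUniv _, fun h => IsUniv.isLKE h⟩

lemma isRKE_map_iff (f : A ⟶ B) (X : E.val B) :
    D.IsRKE f ((trApp ζ B).obj X) ↔ E.IsRKE f X := by
  rw [isRKE_iff (D := E), ← isCouniv_map_iff hζ f (𝟙 _)]
  exact ⟨fun h => h.isCouniv _, fun h => IsCouniv.isRKE h⟩

/-- A prederivator equivalent to a derivator is a derivator. -/
theorem IsDerivator.of_equivalence (hD : IsDerivator D) : IsDerivator E := by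
  have := hζ
  refine IsDerivator.of_lexact (fun ι A => ?_) (fun {A X Y} f => ?_) (fun {A B} f => ?_)
    (fun {A B} f => ?_)
    (fun f b => LExact.of_equivalence hζ (hD.lexact_overCell f b))
    (fun f b => LExact.of_equivalence hζ (hD.lexact_underCell f b))
  · have := hD.der1 ι A
    have (i : ι) := hζ (A i)
    have h' : (Functor.pi (C := fun i => ↑(E.val (A i))) (D := fun i => ↑(D.val (A i)))
      fun i => trApp ζ (A i)).IsEquivalence := inferInstance
    have h : ((Functor.pi' fun i => E.res (B := Cat.of (Σ i, A i))
      (CategoryTheory.Sigma.incl (C := fun i => A i) i).toCatHom) ⋙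
        Functor.pi fun i => trApp ζ (A i)).IsEquivalence :=
      Functor.isEquivalence_of_iso (F := trApp ζ (Cat.of (Σ i, A i)) ⋙
        Functor.pi' fun i => D.res (B := Cat.of (Σ i, A i))
          (CategoryTheory.Sigma.incl (C := fun i => A i) i).toCatHom)
        (NatIso.pi' fun i => (Cat.Hom.toNatIso (ζ.naturality
          (CategoryTheory.Sigma.incl (C := fun i => A i) i).toCatHom.op)).symm)
    exact @Functor.isEquivalence_of_comp_right _ _ _ _ _ _ _ _ h' h
  · rw [← isIso_iff_of_reflects_iso f (trApp ζ A), hD.der2]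
    refine forall_congr' fun a => ?_
    rw [← isIso_iff_of_reflects_iso _ (trApp ζ ptCat)]
    exact (NatIso.isIso_map_iff (Cat.Hom.toNatIso (ζ.naturality (ptHom a).op)) f).symm
  · have := hD.der3_left f
    refine Functor.isRightAdjoint_of_iso (F := (trApp ζ B ⋙ D.res f) ⋙ (trApp ζ A).inv) ?_
    exact Functor.isoWhiskerRight (Cat.Hom.toNatIso (ζ.naturality f.op)).symm _ ≪≫
      Functor.associator _ _ _ ≪≫
      Functor.isoWhiskerLeft (E.res f) (trApp ζ A).asEquivalence.unitIso.symm ≪≫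
      Functor.rightUnitor _
  · have := hD.der3_right f
    refine Functor.isLeftAdjoint_of_iso (F := (trApp ζ B ⋙ D.res f) ⋙ (trApp ζ A).inv) ?_
    exact Functor.isoWhiskerRight (Cat.Hom.toNatIso (ζ.naturality f.op)).symm _ ≪≫
      Functor.associator _ _ _ ≪≫
      Functor.isoWhiskerLeft (E.res f) (trApp ζ A).asEquivalence.unitIso.symm ≪≫
      Functor.rightUnitor _

/-- A prederivator equivalent to a stable derivator is a stable derivator. -/
theorem IsStableDerivator.of_equivalence (hD : IsStableDerivator D) : IsStableDerivator E := by
  have hE := IsDerivator.of_equivalence hζ hD.toIsDerivator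
  refine { hE with pointed := ?_, stable := fun {A} Q => ?_ }
  · have := hD.pointed
    have := hζ ptCat
    obtain ⟨Z, hZ⟩ := hD.pointed.zero
    obtain ⟨X, ⟨e⟩⟩ := Functor.EssSurj.mem_essImage (F := trApp ζ ptCat) Z
    exact ⟨X, Limits.IsZero.of_full_of_faithful_of_isZero (trApp ζ ptCat) X (hZ.of_iso e)⟩
  · rw [hE.isCocartesian_iff, hE.isCartesian_iff, ← isLKE_map_iff hζ, ← isRKE_map_iff hζ,
      ← hD.isCocartesian_iff, ← hD.isCartesian_iff, hD.stable]

end Transfer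

end

section

/-! ### The product with a fixed category on the right -/

/-- The 2-functor `- × A : Catᵒᵖ → Catᵒᵖ`. -/
abbrev prodPsRight (A : Cat.{u, u}) : Cat.{u, u}ᵒᵖ ⥤ᵖ Cat.{u, u}ᵒᵖ where
  obj K := op (prodCat K.unop A)
  map f := (prodMap f.unop (𝟙 A)).op
  map₂ θ := Bicategory.Opposite.op2 (NatTrans.prod θ.unop2.toNatTrans (𝟙 (𝟭 A))).toCatHom₂
  mapId K := Iso.op2 (Cat.Hom.isoMk (NatIso.ofComponents (fun X => Iso.refl _)))
  mapComp f g := Iso.op2 (Cat.Hom.isoMk (NatIso.ofComponents (fun X => Iso.refl _)))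
  map₂_id f := rfl
  map₂_comp f g := hom2_ext fun ⟨k, a⟩ => Prod.ext rfl (Category.id_comp (𝟙 a)).symm
  map₂_whisker_left f g h η := hom2_ext fun ⟨k, a⟩ => by
    refine Prod.ext ?_ ?_
    · change f.unop.toFunctor.map (η.unop2.toNatTrans.app k) =
        𝟙 _ ≫ f.unop.toFunctor.map (η.unop2.toNatTrans.app k) ≫ 𝟙 _
      simp
    · change 𝟙 a = 𝟙 a ≫ 𝟙 a ≫ 𝟙 a
      simp
  map₂_whisker_right {A B C f g} η h := hom2_ext fun ⟨k, a⟩ => by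
    refine Prod.ext ?_ ?_
    · change η.unop2.toNatTrans.app (h.unop.toFunctor.obj k) =
        𝟙 _ ≫ η.unop2.toNatTrans.app (h.unop.toFunctor.obj k) ≫ 𝟙 _
      simp
    · change 𝟙 a = 𝟙 a ≫ 𝟙 a ≫ 𝟙 a
      simp
  map₂_associator f g h := hom2_ext fun ⟨k, a⟩ => by
    refine Prod.ext ?_ ?_
    · change 𝟙 (f.unop.toFunctor.obj (g.unop.toFunctor.obj (h.unop.toFunctor.obj k))) =
        𝟙 _ ≫ 𝟙 _ ≫ 𝟙 _ ≫ f.unop.toFunctor.map (𝟙 _) ≫ 𝟙 _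
      simp
    · change 𝟙 a = 𝟙 a ≫ 𝟙 a ≫ 𝟙 a ≫ 𝟙 a ≫ 𝟙 a
      simp
  map₂_left_unitor f := hom2_ext fun ⟨k, a⟩ => by
    refine Prod.ext ?_ ?_
    · change 𝟙 (f.unop.toFunctor.obj k) = 𝟙 _ ≫ 𝟙 _ ≫ 𝟙 _
      simp
    · change 𝟙 a = 𝟙 a ≫ 𝟙 a ≫ 𝟙 a
      simp
  map₂_right_unitor f := hom2_ext fun ⟨k, a⟩ => by
    refine Prod.ext ?_ ?_
    · change 𝟙 (f.unop.toFunctor.obj k) = 𝟙 _ ≫ f.unop.toFunctor.map (𝟙 _) ≫ 𝟙 _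
      simp
    · change 𝟙 a = 𝟙 a ≫ 𝟙 a ≫ 𝟙 a
      simp

/-- The swap equivalence `A × K ⥤ K × A`. -/
abbrev swapHom (A K : Cat.{u, u}) : prodCat A K ⟶ prodCat K A := (CategoryTheory.Prod.swap A K).toCatHom

abbrev swapTrans (A : Cat.{u, u}) : prodPsRight A ⟶ prodPs A where
  app K := (swapHom A K.unop).op
  naturality {K L} g := Iso.op2 (Cat.Hom.isoMk (NatIso.ofComponents (fun X => Iso.refl _)
    (fun _ => (Category.comp_id _).trans (Category.id_comp _).symm)))
  naturality_naturality θ := hom2_ext fun ⟨a, k⟩ => by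
    refine Prod.ext ?_ ?_
    · change θ.unop2.toNatTrans.app k ≫ 𝟙 _ = 𝟙 _ ≫ θ.unop2.toNatTrans.app k
      simp
    · change 𝟙 a ≫ 𝟙 a = 𝟙 a ≫ 𝟙 a
      rfl
  naturality_id K := hom2_ext fun ⟨a, k⟩ => by
    refine Prod.ext ?_ ?_
    · change 𝟙 k ≫ 𝟙 k = 𝟙 _ ≫ 𝟙 _ ≫ 𝟙 _
      simp
    · change 𝟙 a ≫ 𝟙 a = 𝟙 _ ≫ 𝟙 _ ≫ 𝟙 _
      simp
  naturality_comp g h := hom2_ext fun ⟨a, k⟩ => by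
    refine Prod.ext ?_ ?_
    · change 𝟙 (g.unop.toFunctor.obj (h.unop.toFunctor.obj k)) ≫ 𝟙 _ =
        𝟙 _ ≫ 𝟙 _ ≫ g.unop.toFunctor.map (𝟙 _) ≫ 𝟙 _ ≫ 𝟙 _ ≫ 𝟙 _
      simp
    · change 𝟙 a ≫ 𝟙 a = 𝟙 _ ≫ 𝟙 _ ≫ 𝟙 _ ≫ 𝟙 _ ≫ 𝟙 _ ≫ 𝟙 _
      simp

/-- The prederivator `K ↦ D(K × A)`. -/
abbrev Prederivator.shiftRight (D : Prederivator.{u, v, w}) (A : Cat.{u, u}) :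
    Prederivator.{u, v, w} := compPs (prodPsRight A) D

section

variable {D : Prederivator.{u, v, w}}

/-- Swapping the factors gives a levelwise equivalence with `D.shift A`. In this form the shape
varies and `A` is a passive parameter, as needed for diagrams on `M_n × A`. -/
theorem IsDerivator.shiftRight (hD : IsDerivator D) (A : Cat.{u, u}) :
    IsDerivator (D.shiftRight A) :=
  IsDerivator.of_equivalence (ζ := postcompTrans (swapTrans A) D)
    (fun K => res_isEquivalence (D := D) (swapHom A K)
      (inferInstanceAs (CategoryTheory.Prod.swap A K).IsEquivalence)) (hD.shift A)

end

/-! ### Zero objects -/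

/-- The empty category. -/
abbrev emptyCat : Cat.{u, u} := Cat.of (Σ i : PEmpty.{u + 1}, (i.elim : Cat.{u, u}))

abbrev emptyHom (A : Cat.{u, u}) : emptyCat.{u} ⟶ A :=
  (CategoryTheory.Sigma.desc (C := fun i : PEmpty.{u + 1} => (i.elim : Cat.{u, u}))
    fun i => i.elim).toCatHom

section

variable {D : Prederivator.{u, v, w}} {A B C : Cat.{u, u}}

/-- (Der1) for the empty family: the value of `D` at the empty category is equivalent to an empty
product of categories. -/
lemma IsDerivator.existsUnique_emptyCat (hD : IsDerivator D) (X Y : D.val emptyCat) :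
    Nonempty (Unique (X ⟶ Y)) := by
  have := hD.der1 PEmpty.{u + 1} (fun i => (i.elim : Cat.{u, u}))
  let F := (Functor.pi' fun i => D.res (B := emptyCat)
        (CategoryTheory.Sigma.incl (C := fun i : PEmpty.{u + 1} => (i.elim : Cat.{u, u})) i).toCatHom)
  have hF : F.IsEquivalence := this
  refine ⟨⟨⟨F.preimage fun i => i.elim⟩, fun g => F.map_injective (funext fun i => i.elim)⟩⟩

/-- A left Kan extension from the empty category is initial. -/
lemma IsDerivator.unique_to_of_isUniv (hD : IsDerivator D) {f : emptyCat.{u} ⟶ A}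
    {X : D.val emptyCat} {Z : D.val A} {φ : X ⟶ (D.res f).obj Z} (h : IsUniv (D.res f) φ)
    (Y : D.val A) : Nonempty (Unique (Z ⟶ Y)) := by
  obtain ⟨i⟩ := hD.existsUnique_emptyCat X ((D.res f).obj Y)
  exact ⟨(Equiv.ofBijective _ (h Y)).unique⟩

lemma IsDerivator.unique_from_of_isCouniv (hD : IsDerivator D) {f : emptyCat.{u} ⟶ A}
    {X : D.val emptyCat} {Z : D.val A} {φ : (D.res f).obj Z ⟶ X} (h : IsCouniv (D.res f) φ)
    (Y : D.val A) : Nonempty (Unique (Y ⟶ Z)) := by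
  obtain ⟨i⟩ := hD.existsUnique_emptyCat ((D.res f).obj Y) X
  exact ⟨(Equiv.ofBijective _ (h Y)).unique⟩

/-- Restriction has adjoints on both sides, so it preserves both initial and terminal objects. -/
lemma IsDerivator.isZero_res (hD : IsDerivator D) (f : A ⟶ B) {X : D.val B}
    (h : Limits.IsZero X) : Limits.IsZero ((D.res f).obj X) where
  unique_to Y := by
    obtain ⟨Z, φ, hφ⟩ := exists_isCouniv (D.res f) (hD.der3_right f) Y
    obtain ⟨i⟩ := h.unique_to Z
    exact ⟨(Equiv.ofBijective _ (hφ X)).symm.unique⟩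
  unique_from Y := by
    obtain ⟨Z, φ, hφ⟩ := exists_isUniv (D.res f) (hD.der3_left f) Y
    obtain ⟨i⟩ := h.unique_from Z
    exact ⟨(Equiv.ofBijective _ (hφ X)).symm.unique⟩

lemma isZero_of_unique_to {𝒞 : Type*} [Category* 𝒞] [Limits.HasZeroObject 𝒞] {X : 𝒞}
    (h : ∀ Y, Nonempty (Unique (X ⟶ Y))) : Limits.IsZero X := by
  obtain ⟨Z, hZ⟩ := Limits.HasZeroObject.zero (C := 𝒞)
  have hX : Limits.IsInitial X := Limits.IsInitial.ofUniqueHom (fun Y => (h Y).some.default)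
    fun Y m => (h Y).some.uniq m
  exact hZ.of_iso (hX.uniqueUpToIso hZ.isInitial)

lemma isZero_of_unique_from {𝒞 : Type*} [Category* 𝒞] [Limits.HasZeroObject 𝒞] {X : 𝒞}
    (h : ∀ Y, Nonempty (Unique (Y ⟶ X))) : Limits.IsZero X := by
  obtain ⟨Z, hZ⟩ := Limits.HasZeroObject.zero (C := 𝒞)
  have hX : Limits.IsTerminal X := Limits.IsTerminal.ofUniqueHom (fun Y => (h Y).some.default)
    fun Y m => (h Y).some.uniq m
  exact hZ.of_iso (hX.uniqueUpToIso hZ.isTerminal)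

end

/-- A pointed derivator. -/
structure IsPointedDerivator (D : Prederivator.{u, v, w}) : Prop extends IsDerivator D where
  pointed : Limits.HasZeroObject (D.val ptCat)

lemma IsStableDerivator.isPointed {D : Prederivator.{u, v, w}} (h : IsStableDerivator D) :
    IsPointedDerivator D := { h with }

section

variable {D : Prederivator.{u, v, w}} {A B C : Cat.{u, u}}

lemma IsPointedDerivator.hasZeroObject (hD : IsPointedDerivator D) (A : Cat.{u, u}) :
    Limits.HasZeroObject (D.val A) := by
  obtain ⟨Z, hZ⟩ := hD.pointed.zero
  exact ⟨_, hD.isZero_res (toPt A) hZ⟩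

theorem IsPointedDerivator.shift (hD : IsPointedDerivator D) (K : Cat.{u, u}) :
    IsPointedDerivator (D.shift K) :=
  { hD.toIsDerivator.shift K with pointed := hD.hasZeroObject (prodCat K ptCat) }

theorem IsPointedDerivator.shiftRight (hD : IsPointedDerivator D) (A : Cat.{u, u}) :
    IsPointedDerivator (D.shiftRight A) :=
  { hD.toIsDerivator.shiftRight A with pointed := hD.hasZeroObject (prodCat ptCat A) }

end

end

section

namespace Prederivator

variable {D : Prederivator.{u, v, w}} {A B C E P Q K L : Cat.{u, u}}

/-! ### Pointwise criteria for Kan extensions -/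

lemma isIso_res_comp_iff (f : A ⟶ B) (g : B ⟶ C) {X Y : D.val C} (h : X ⟶ Y) :
    IsIso ((D.res (f ≫ g)).map h) ↔ IsIso ((D.res f).map ((D.res g).map h)) :=
  NatIso.isIso_map_iff (D.resComp f g) h

lemma isIso_res_pt_iff (c : ptCat.{u} ⟶ C) {X Y : D.val C} (h : X ⟶ Y) :
    IsIso ((D.res c).map h) ↔ IsIso ((D.res (ptHom (ptVal c))).map h) :=
  NatIso.isIso_map_iff (D.resMapIso (ptIso c)) h

lemma isIso_res_ptHom_comp_iff (a : A) (f : A ⟶ B) {X Y : D.val B} (h : X ⟶ Y) :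
    IsIso ((D.res (ptHom a)).map ((D.res f).map h)) ↔
      IsIso ((D.res (ptHom (f.toFunctor.obj a))).map h) :=
  (isIso_res_comp_iff _ _ h).symm.trans (isIso_res_pt_iff (ptHom a ≫ f) h)

lemma IsLKE.isUniv_sqApp {p : P ⟶ A} {f : A ⟶ C} {q : P ⟶ B} {g : B ⟶ C} {θ : p ≫ f ⟶ q ≫ g}
    {X : D.val C} (hX : D.IsLKE f X) (h : D.LExact θ) : IsUniv (D.res q) (sqApp (D := D) θ X) :=
  (h _ (isLKE_iff.1 hX)).congr (by rw [CategoryTheory.Functor.map_id, Category.id_comp])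

lemma IsRKE.isCouniv_sqApp {p : P ⟶ A} {f : A ⟶ C} {q : P ⟶ B} {g : B ⟶ C} {θ : p ≫ f ⟶ q ≫ g}
    {X : D.val C} (hX : D.IsRKE g X) (h : D.RExact θ) : IsCouniv (D.res p) (sqApp (D := D) θ X) :=
  (h _ (isRKE_iff.1 hX)).congr (by rw [CategoryTheory.Functor.map_id, Category.comp_id])

/-- The restriction of `X` has some left Kan extension `W`, with a comparison `k : W ⟶ X`. Each left
exact cell makes the restriction of `k` along `g i` a map between universal arrows, hence
invertible. -/
lemma isLKE_of_local {f : A ⟶ C} (hf : (D.res f).IsRightAdjoint) {ι : Type*}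
    {P B : ι → Cat.{u, u}} {p : ∀ i, P i ⟶ A} {q : ∀ i, P i ⟶ B i} {g : ∀ i, B i ⟶ C}
    (θ : ∀ i, p i ≫ f ⟶ q i ≫ g i)
    (hg : ∀ {X Y : D.val C} (h : X ⟶ Y), (∀ i, IsIso ((D.res (g i)).map h)) → IsIso h)
    (hθ : ∀ i, D.LExact (θ i)) {X : D.val C}
    (h : ∀ i, IsUniv (D.res (q i)) (sqApp (D := D) (θ i) X)) : D.IsLKE f X := by
  obtain ⟨W, χ, hχ⟩ := exists_isUniv (D.res f) hf ((D.res f).obj X)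
  obtain ⟨k, hk⟩ := hχ.existsUnique (𝟙 _)
  have : IsIso k := hg k fun i => by
    refine IsUniv.isIso_of_comp (hθ i χ hχ) _ ((h i).congr ?_)
    rw [Category.assoc, ← sqApp_naturality, ← Functor.map_comp_assoc, hk,
      CategoryTheory.Functor.map_id, Category.id_comp]
  exact isLKE_iff.2 (hk ▸ hχ.comp_iso k)

lemma isRKE_of_local {g : B ⟶ C} (hg' : (D.res g).IsLeftAdjoint) {ι : Type*}
    {P A : ι → Cat.{u, u}} {p : ∀ i, P i ⟶ A i} {q : ∀ i, P i ⟶ B} {f : ∀ i, A i ⟶ C}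
    (θ : ∀ i, p i ≫ f i ⟶ q i ≫ g)
    (hf : ∀ {X Y : D.val C} (h : X ⟶ Y), (∀ i, IsIso ((D.res (f i)).map h)) → IsIso h)
    (hθ : ∀ i, D.RExact (θ i)) {X : D.val C}
    (h : ∀ i, IsCouniv (D.res (p i)) (sqApp (D := D) (θ i) X)) : D.IsRKE g X := by
  obtain ⟨W, χ, hχ⟩ := exists_isCouniv (D.res g) hg' ((D.res g).obj X)
  obtain ⟨k, hk⟩ := hχ.existsUnique (𝟙 _)
  have : IsIso k := hf k fun i => by
    refine IsCouniv.isIso_of_comp (hθ i χ hχ) _ ((h i).congr ?_)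
    rw [reassoc_of% sqApp_naturality, ← Functor.map_comp, hk,
      CategoryTheory.Functor.map_id, Category.comp_id]
  exact isRKE_iff.2 (hk ▸ hχ.iso_comp k)

lemma isIso_sqApp {p : P ⟶ A} {f : A ⟶ C} {q : P ⟶ B} {g : B ⟶ C} (θ : p ≫ f ⟶ q ≫ g)
    [IsIso θ] (Z : D.val C) : IsIso (sqApp θ Z) := by
  rw [sqApp_eq]; infer_instance

/-- Since `θ` is invertible, restricting `X` along `g` first changes the cocone only by
isomorphisms. It lets the colimit property of a restricted square be read in the ambient diagram. -/
lemma isUniv_sqApp_paste_iff {P' B' : Cat.{u, u}} {p : P ⟶ A} {f : A ⟶ C} {q : P ⟶ B} {g : B ⟶ C}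
    (θ : p ≫ f ⟶ q ≫ g) [IsIso θ] {p' : P' ⟶ P} {q' : P' ⟶ B'} {g' : B' ⟶ B}
    (θ' : p' ≫ q ⟶ q' ≫ g') (X : D.val C) :
    IsUniv (D.res q') (sqApp (D := D) θ' ((D.res g).obj X)) ↔
      IsUniv (D.res q') (sqApp (D := D) (paste θ θ') X) := by
  have h := paste_isUniv_iff (θ := θ) (θ' := θ') (𝟙 ((D.res f).obj X))
  simp only [CategoryTheory.Functor.map_id, Category.id_comp] at h
  have := isIso_sqApp θ X
  rw [IsUniv.iso_comp_iff] at h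
  exact h

/-- Pasting of squares in the other direction. -/
abbrev paste' {P' A' : Cat.{u, u}} {p : P ⟶ A} {f : A ⟶ C} {q : P ⟶ B} {g : B ⟶ C}
    (θ : p ≫ f ⟶ q ≫ g) {p' : P' ⟶ A'} {f' : A' ⟶ A} {q' : P' ⟶ P} (θ' : p' ≫ f' ⟶ q' ≫ p) :
    p' ≫ (f' ≫ f) ⟶ (q' ≫ q) ≫ g :=
  CategoryStruct.comp (X := (p' ≫ f') ≫ f) (Y := q' ≫ p ≫ f) (θ' ▷ f) (q' ◁ θ)

lemma sqApp_paste' {P' A' : Cat.{u, u}} {p : P ⟶ A} {f : A ⟶ C} {q : P ⟶ B} {g : B ⟶ C}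
    (θ : p ≫ f ⟶ q ≫ g) {p' : P' ⟶ A'} {f' : A' ⟶ A} {q' : P' ⟶ P} (θ' : p' ≫ f' ⟶ q' ≫ p)
    (Z : D.val C) :
    (D.res p').map ((D.resComp f' f).hom.app Z) ≫ sqApp θ' ((D.res f).obj Z) ≫
      (D.res q').map (sqApp θ Z) =
    sqApp (paste' θ θ') Z ≫ (D.resComp q' q).hom.app ((D.res g).obj Z) := by
  rw [← cancel_epi ((D.resComp p' (f' ≫ f)).hom.app Z)]
  have h1 := D.resComp_assoc p' f' f Z
  have h2 := resMap_whiskerLeft (D := D) q' θ Z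
  have h3 := D.resComp_assoc q' p f Z
  have h4 := resMap_whiskerRight (D := D) θ' f Z
  have h5 := D.resComp_assoc q' q g Z
  have h6 := resMap_comp (D := D) (f := (p' ≫ f') ≫ f) (g := q' ≫ p ≫ f) (θ' ▷ f) (q' ◁ θ) Z
  rw [← reassoc_of% h1, sqApp_eq, sqApp_eq, sqApp_eq]
  simp only [Functor.map_comp, Category.assoc]
  rw [Iso.hom_inv_id_app_assoc, ← reassoc_of% h4, reassoc_of% h3, ← Functor.map_comp_assoc,
    Iso.hom_inv_id_app, CategoryTheory.Functor.map_id, Category.id_comp, ← reassoc_of% h2, ← h5,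
    Iso.hom_inv_id_app_assoc, h6]
  simp only [Category.assoc]

lemma isCouniv_sqApp_paste'_iff {P' A' : Cat.{u, u}} {p : P ⟶ A} {f : A ⟶ C} {q : P ⟶ B}
    {g : B ⟶ C} (θ : p ≫ f ⟶ q ≫ g) [IsIso θ] {p' : P' ⟶ A'} {f' : A' ⟶ A} {q' : P' ⟶ P}
    (θ' : p' ≫ f' ⟶ q' ≫ p) (X : D.val C) :
    IsCouniv (D.res p') (sqApp (D := D) θ' ((D.res f).obj X)) ↔
      IsCouniv (D.res p') (sqApp (D := D) (paste' θ θ') X) := by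
  have h := sqApp_paste' (D := D) θ θ' X
  have := isIso_sqApp θ X
  rw [← IsCouniv.comp_iso_iff ((D.resComp q' q).hom.app ((D.res g).obj X)), ← h,
    ← IsCouniv.comp_iso_iff ((D.res q').map (sqApp θ X))]
  refine ⟨fun h => h.iso_comp ((D.resComp f' f).hom.app X), fun h => ?_⟩
  have h2 := h.iso_comp ((D.resComp f' f).inv.app X)
  refine h2.congr ?_
  rw [← Functor.map_comp_assoc, Iso.inv_hom_id_app, CategoryTheory.Functor.map_id,
    Category.id_comp]

end Prederivator

section

variable {D : Prederivator.{u, v, w}} {A B C : Cat.{u, u}}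

lemma IsDerivator.isLKE_of_cells (hD : IsDerivator D) {f : A ⟶ B} {X : D.val B}
    (h : ∀ b : B, ∃ (S : Cat.{u, u}) (p : S ⟶ A) (θ : p ≫ f ⟶ toPt S ≫ ptHom b),
      IsReflective θ ∧ IsUniv (D.res (toPt S)) (sqApp (D := D) θ X)) : D.IsLKE f X := by
  choose S p θ hθ hX using h
  exact isLKE_of_local (hD.der3_left f) θ (fun h => (hD.der2 h).2)
    (fun b => hD.lexact_of_isReflective (hθ b)) hX

lemma IsDerivator.isRKE_of_cells (hD : IsDerivator D) {f : A ⟶ B} {X : D.val B}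
    (h : ∀ b : B, ∃ (S : Cat.{u, u}) (p : S ⟶ A) (θ : toPt S ≫ ptHom b ⟶ p ≫ f),
      IsCoreflective θ ∧ IsCouniv (D.res (toPt S)) (sqApp (D := D) θ X)) : D.IsRKE f X := by
  choose S p θ hθ hX using h
  exact isRKE_of_local (hD.der3_right f) θ (fun h => (hD.der2 h).2)
    (fun b => (hD.lexact_of_isCoreflective (hθ b)).rexact (hD.der3_left _)) hX

variable (D) in
lemma exists_reflective_cell {f : A ⟶ B} (hf : f.toFunctor.FullyFaithful) (a : A) (X : D.val B) :
    ∃ (S : Cat.{u, u}) (p : S ⟶ A) (θ : p ≫ f ⟶ toPt S ≫ ptHom (f.toFunctor.obj a)),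
      IsReflective θ ∧ IsUniv (D.res (toPt S)) (sqApp (D := D) θ X) := by
  let θ : ptHom a ≫ f ⟶ toPt ptCat ≫ ptHom (f.toFunctor.obj a) :=
    (ptIso (ptHom a ≫ f)).hom
  have h : IsReflective θ := isReflective_ptHom f hf a
  have : IsIso θ := inferInstanceAs (IsIso (ptIso (ptHom a ≫ f)).hom)
  have := isIso_sqApp (D := D) θ X
  have := res_isEquivalence (D := D) _ toPt_isEquivalence
  exact ⟨_, _, θ, h, IsUniv.of_isIso⟩

variable (D) in
lemma exists_coreflective_cell {f : A ⟶ B} (hf : f.toFunctor.FullyFaithful) (a : A) (X : D.val B) :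
    ∃ (S : Cat.{u, u}) (p : S ⟶ A) (θ : toPt S ≫ ptHom (f.toFunctor.obj a) ⟶ p ≫ f),
      IsCoreflective θ ∧ IsCouniv (D.res (toPt S)) (sqApp (D := D) θ X) := by
  let θ : toPt ptCat ≫ ptHom (f.toFunctor.obj a) ⟶ ptHom a ≫ f :=
    (ptIso (ptHom a ≫ f)).inv
  have h : IsCoreflective θ := isCoreflective_ptHom f hf a
  have : IsIso θ := inferInstanceAs (IsIso (ptIso (ptHom a ≫ f)).inv)
  have := isIso_sqApp (D := D) θ X
  have := res_isEquivalence (D := D) _ toPt_isEquivalence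
  exact ⟨_, _, θ, h, IsCouniv.of_isIso⟩

/-- Left Kan extension along a cosieve is extension by zero. -/
lemma IsPointedDerivator.isLKE_iff_isZero (hD : IsPointedDerivator D) {f : A ⟶ B}
    (hf : f.toFunctor.FullyFaithful)
    (h : ∀ a b, (∀ a', f.toFunctor.obj a' ≠ b) → IsEmpty (f.toFunctor.obj a ⟶ b)) (X : D.val B) :
    D.IsLKE f X ↔ ∀ b, (∀ a, f.toFunctor.obj a ≠ b) → Limits.IsZero ((D.res (ptHom b)).obj X) := by
  -- Outside the image of a cosieve the slice over `b` is empty, so the value there is the colimit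
  -- of an empty diagram.
  let θ (b : B) : emptyHom A ≫ f ⟶ toPt emptyCat ≫ ptHom b :=
    Cat.Hom₂.ofNatTrans { app := fun s => s.1.elim, naturality := fun s => s.1.elim }
  have hθ (b : B) (hb : ∀ a', f.toFunctor.obj a' ≠ b) : IsReflective (θ b) :=
    fun a x => ((h a b hb).false x).elim
  constructor
  · intro hX b hb
    have h1 := hX.isUniv_sqApp (hD.lexact_of_isReflective (hθ b hb))
    have := hD.pointed
    exact isZero_of_unique_to (hD.unique_to_of_isUniv h1)
  · intro hX
    refine hD.isLKE_of_cells fun b => ?_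
    by_cases hb : ∀ a', f.toFunctor.obj a' ≠ b
    · refine ⟨_, _, θ b, hθ b hb, fun Y => ?_⟩
      obtain ⟨i⟩ := (hX b hb).unique_to Y
      obtain ⟨j⟩ := hD.existsUnique_emptyCat ((D.res (emptyHom A)).obj ((D.res f).obj X))
        ((D.res (toPt emptyCat)).obj Y)
      exact ⟨fun _ _ _ => Subsingleton.elim _ _, fun y => ⟨default, Subsingleton.elim _ _⟩⟩
    · push Not at hb
      obtain ⟨a, rfl⟩ := hb
      exact exists_reflective_cell D hf a X

/-- Right Kan extension along a sieve is extension by zero. -/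
lemma IsPointedDerivator.isRKE_iff_isZero (hD : IsPointedDerivator D) {f : A ⟶ B}
    (hf : f.toFunctor.FullyFaithful)
    (h : ∀ a b, (∀ a', f.toFunctor.obj a' ≠ b) → IsEmpty (b ⟶ f.toFunctor.obj a)) (X : D.val B) :
    D.IsRKE f X ↔ ∀ b, (∀ a, f.toFunctor.obj a ≠ b) → Limits.IsZero ((D.res (ptHom b)).obj X) := by
  let θ (b : B) : toPt emptyCat ≫ ptHom b ⟶ emptyHom A ≫ f :=
    Cat.Hom₂.ofNatTrans { app := fun s => s.1.elim, naturality := fun s => s.1.elim }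
  have hθ (b : B) (hb : ∀ a', f.toFunctor.obj a' ≠ b) : IsCoreflective (θ b) :=
    fun a x => ((h a b hb).false x).elim
  constructor
  · intro hX b hb
    have h1 := hX.isCouniv_sqApp ((hD.lexact_of_isCoreflective (hθ b hb)).rexact (hD.der3_left _))
    have := hD.pointed
    exact isZero_of_unique_from (hD.unique_from_of_isCouniv h1)
  · intro hX
    refine hD.isRKE_of_cells fun b => ?_
    by_cases hb : ∀ a', f.toFunctor.obj a' ≠ b
    · refine ⟨_, _, θ b, hθ b hb, fun Y => ?_⟩
      obtain ⟨i⟩ := (hX b hb).unique_from Y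
      obtain ⟨j⟩ := hD.existsUnique_emptyCat ((D.res (toPt emptyCat)).obj Y)
        ((D.res (emptyHom A)).obj ((D.res f).obj X))
      exact ⟨fun _ _ _ => Subsingleton.elim _ _, fun y => ⟨default, Subsingleton.elim _ _⟩⟩
    · push Not at hb
      obtain ⟨a, rfl⟩ := hb
      exact exists_coreflective_cell D hf a X

/-- If `X` is left Kan extended along a composite, it is so along the second functor. -/
lemma IsDerivator.isLKE_of_comp (hD : IsDerivator D) {f : A ⟶ B} {g : B ⟶ C}
    (hf : f.toFunctor.FullyFaithful) (hg : g.toFunctor.FullyFaithful) {X : D.val C}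
    (hX : D.IsLKE (f ≫ g) X) : D.IsLKE g X := by
  -- Extend the restriction of `X` in two stages. The result `Z` is extended along `f ≫ g` from the
  -- same object as `X`, so the two are isomorphic, and `Z` is extended along `g` by construction.
  obtain ⟨W, hW, ⟨e⟩⟩ := hD.exists_isLKE hf ((D.res (f ≫ g)).obj X)
  obtain ⟨Z, hZ, ⟨e'⟩⟩ := hD.exists_isLKE hg W
  have hZ' := (isLKE_comp_iff (hW.of_iso e'.symm)).2 hZ
  obtain ⟨i, -⟩ := hX.exists_iso hZ'
    (e.symm ≪≫ (D.res f).mapIso e'.symm ≪≫ (D.resComp f g).symm.app Z)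
  exact hZ.of_iso i.symm

lemma IsDerivator.isRKE_of_comp (hD : IsDerivator D) {f : A ⟶ B} {g : B ⟶ C}
    (hf : f.toFunctor.FullyFaithful) (hg : g.toFunctor.FullyFaithful) {X : D.val C}
    (hX : D.IsRKE (f ≫ g) X) : D.IsRKE g X := by
  obtain ⟨W, hW, ⟨e⟩⟩ := hD.exists_isRKE hf ((D.res (f ≫ g)).obj X)
  obtain ⟨Z, hZ, ⟨e'⟩⟩ := hD.exists_isRKE hg W
  have hZ' := (isRKE_comp_iff (hW.of_iso e'.symm)).2 hZ
  obtain ⟨i, -⟩ := hX.exists_iso hZ'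
    (e.symm ≪≫ (D.res f).mapIso e'.symm ≪≫ (D.resComp f g).symm.app Z)
  exact hZ.of_iso i.symm

end

end

section

/-! ### Squares in posets and Kan extensions -/

section Posets

variable {I J : Type u} [Preorder I] [Preorder J]

lemma preorder_hom_ext (X : Type u) [Preorder X] {x y : X} (f g : x ⟶ y) : f = g :=
  Subsingleton.elim f g

/-- The functor of small categories given by a monotone map. -/
abbrev monoHom {m : I → J} (hm : Monotone m) : Cat.of I ⟶ Cat.of J := hm.functor.toCatHom

/-- The elements strictly below the final vertex of the square are generated by the span. -/
structure IsFinalSquare (s : Sq.{u} → J) : Prop where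
  mono : Monotone s
  ne : ∀ x, x ≠ ⟨1, 1⟩ → s x ≠ s ⟨1, 1⟩
  cover : ∀ y ≤ s ⟨1, 1⟩, y ≠ s ⟨1, 1⟩ → y ≤ s ⟨1, 0⟩ ∨ y ≤ s ⟨0, 1⟩
  inter : ∀ y, y ≤ s ⟨1, 0⟩ → y ≤ s ⟨0, 1⟩ → y ≤ s ⟨0, 0⟩

/-- The elements strictly above the initial vertex of the square are generated by the cospan. -/
structure IsInitialSquare (s : Sq.{u} → J) : Prop where
  mono : Monotone s
  ne : ∀ x, x ≠ ⟨0, 0⟩ → s x ≠ s ⟨0, 0⟩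
  cover : ∀ y, s ⟨0, 0⟩ ≤ y → y ≠ s ⟨0, 0⟩ → s ⟨1, 0⟩ ≤ y ∨ s ⟨0, 1⟩ ≤ y
  inter : ∀ y, s ⟨1, 0⟩ ≤ y → s ⟨0, 1⟩ ≤ y → s ⟨1, 1⟩ ≤ y

lemma Sq.cases (x : Sq.{u}) : x = ⟨0, 0⟩ ∨ x = ⟨1, 0⟩ ∨ x = ⟨0, 1⟩ ∨ x = ⟨1, 1⟩ := by
  obtain ⟨i, j⟩ := x
  fin_cases i <;> fin_cases j <;> simp

lemma Sq.le_iff {x y : Sq.{u}} : x ≤ y ↔ x.i ≤ y.i ∧ x.j ≤ y.j := Iff.rfl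

lemma Sq.bot_le (x : Sq.{u}) : ⟨0, 0⟩ ≤ x := Sq.le_iff.2 ⟨Fin.zero_le _, Fin.zero_le _⟩

lemma Sq.le_top (x : Sq.{u}) : x ≤ ⟨1, 1⟩ := Sq.le_iff.2 ⟨Fin.le_last _, Fin.le_last _⟩

/-- By `inter`, an element below both arms is already below their common source, so the span
vertices above `y` have a least element. This says that the span maps to the part of the poset
strictly below the corner by a right adjoint. -/
lemma IsFinalSquare.exists_least {s : Sq.{u} → J} (h : IsFinalSquare s) {y : J}
    (hy : y ≤ s ⟨1, 1⟩) (hy' : y ≠ s ⟨1, 1⟩) :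
    ∃ x : {x : Sq.{u} // x ≠ ⟨1, 1⟩}, y ≤ s x.1 ∧
      ∀ z : {x : Sq.{u} // x ≠ ⟨1, 1⟩}, y ≤ s z.1 → x ≤ z := by
  have h00 : (⟨0, 0⟩ : Sq.{u}) ≠ ⟨1, 1⟩ := by simp
  have h10 : (⟨1, 0⟩ : Sq.{u}) ≠ ⟨1, 1⟩ := by simp
  have h01 : (⟨0, 1⟩ : Sq.{u}) ≠ ⟨1, 1⟩ := by simp
  by_cases h0 : y ≤ s ⟨0, 0⟩
  · exact ⟨⟨_, h00⟩, h0, fun z _ => Sq.bot_le z.1⟩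
  · have key : ∀ x : Sq.{u}, x ≠ ⟨1, 1⟩ → (y ≤ s x → x = ⟨1, 0⟩ ∨ x = ⟨0, 1⟩) := fun x hx hyx => by
      rcases x.cases with rfl | rfl | rfl | rfl <;> simp_all
    rcases h.cover y hy hy' with h1 | h1
    · refine ⟨⟨_, h10⟩, h1, fun ⟨z, hz⟩ hyz => ?_⟩
      rcases key z hz hyz with rfl | rfl
      · exact le_rfl
      · exact (h0 (h.inter y h1 hyz)).elim
    · refine ⟨⟨_, h01⟩, h1, fun ⟨z, hz⟩ hyz => ?_⟩
      rcases key z hz hyz with rfl | rfl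
      · exact (h0 (h.inter y hyz h1)).elim
      · exact le_rfl

lemma IsInitialSquare.exists_greatest {s : Sq.{u} → J} (h : IsInitialSquare s) {y : J}
    (hy : s ⟨0, 0⟩ ≤ y) (hy' : y ≠ s ⟨0, 0⟩) :
    ∃ x : {x : Sq.{u} // x ≠ ⟨0, 0⟩}, s x.1 ≤ y ∧
      ∀ z : {x : Sq.{u} // x ≠ ⟨0, 0⟩}, s z.1 ≤ y → z ≤ x := by
  have h11 : (⟨1, 1⟩ : Sq.{u}) ≠ ⟨0, 0⟩ := by simp
  have h10 : (⟨1, 0⟩ : Sq.{u}) ≠ ⟨0, 0⟩ := by simp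
  have h01 : (⟨0, 1⟩ : Sq.{u}) ≠ ⟨0, 0⟩ := by simp
  by_cases h0 : s ⟨1, 1⟩ ≤ y
  · exact ⟨⟨_, h11⟩, h0, fun z _ => Sq.le_top z.1⟩
  · have key : ∀ x : Sq.{u}, x ≠ ⟨0, 0⟩ → (s x ≤ y → x = ⟨1, 0⟩ ∨ x = ⟨0, 1⟩) := fun x hx hyx => by
      rcases x.cases with rfl | rfl | rfl | rfl <;> simp_all
    rcases h.cover y hy hy' with h1 | h1
    · refine ⟨⟨_, h10⟩, h1, fun ⟨z, hz⟩ hyz => ?_⟩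
      rcases key z hz hyz with rfl | rfl
      · exact le_rfl
      · exact (h0 (h.inter y h1 hyz)).elim
    · refine ⟨⟨_, h01⟩, h1, fun ⟨z, hz⟩ hyz => ?_⟩
      rcases key z hz hyz with rfl | rfl
      · exact (h0 (h.inter y hyz h1)).elim
      · exact le_rfl

end Posets

section

variable {D : Prederivator.{u, v, w}} {I J : Type u} [Preorder I] [Preorder J]

/-- The cone of the span over the final vertex of the square. -/
abbrev spanCell : 𝟙 spanCat.{u} ≫ spanIncl ⟶ toPt spanCat ≫ ptHom (A := sqCat.{u}) ⟨1, 1⟩ :=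
  Cat.Hom₂.ofNatTrans
    { app := fun x => homOfLE (X := Sq.{u}) (Sq.le_top x.1),
      naturality := fun _ _ _ => preorder_hom_ext Sq.{u} _ _ }

abbrev cospanCell : toPt cospanCat ≫ ptHom (A := sqCat.{u}) ⟨0, 0⟩ ⟶ 𝟙 cospanCat.{u} ≫ cospanIncl :=
  Cat.Hom₂.ofNatTrans
    { app := fun x => homOfLE (X := Sq.{u}) (Sq.bot_le x.1),
      naturality := fun _ _ _ => preorder_hom_ext Sq.{u} _ _ }

lemma isReflective_spanCell : IsReflective spanCell.{u} := by
  intro a x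
  exact ⟨a, 𝟙 _, preorder_hom_ext Sq.{u} _ _, fun t v _ => ⟨v,
    preorder_hom_ext {x : Sq.{u} // x ≠ ⟨1, 1⟩} _ _, fun _ _ => preorder_hom_ext {x : Sq.{u} // x ≠ ⟨1, 1⟩} _ _⟩⟩

lemma isCoreflective_cospanCell : IsCoreflective cospanCell.{u} := by
  intro a x
  exact ⟨a, 𝟙 _, preorder_hom_ext Sq.{u} _ _, fun t v _ => ⟨v,
    preorder_hom_ext {x : Sq.{u} // x ≠ ⟨0, 0⟩} _ _, fun _ _ => preorder_hom_ext {x : Sq.{u} // x ≠ ⟨0, 0⟩} _ _⟩⟩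

/-- A square is left Kan extended from the span if it satisfies the colimit property. -/
lemma IsDerivator.isLKE_spanIncl (hD : IsDerivator D) {Q : D.val sqCat}
    (h : IsUniv (D.res (toPt spanCat)) (sqApp (D := D) spanCell Q)) : D.IsLKE spanIncl Q := by
  refine hD.isLKE_of_cells fun b => ?_
  by_cases hb : b = ⟨1, 1⟩
  · subst hb
    exact ⟨_, _, _, isReflective_spanCell, h⟩
  · exact exists_reflective_cell D spanInclFF ⟨b, hb⟩ Q

lemma IsDerivator.isRKE_cospanIncl (hD : IsDerivator D) {Q : D.val sqCat}
    (h : IsCouniv (D.res (toPt cospanCat)) (sqApp (D := D) cospanCell Q)) :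
    D.IsRKE cospanIncl Q := by
  refine hD.isRKE_of_cells fun b => ?_
  by_cases hb : b = ⟨0, 0⟩
  · subst hb
    exact ⟨_, _, _, isCoreflective_cospanCell, h⟩
  · exact exists_coreflective_cell D cospanInclFF ⟨b, hb⟩ Q

/-- Left Kan extensions produce cocartesian squares. -/
theorem IsDerivator.isLKE_spanIncl_of_isLKE (hD : IsDerivator D) {m : I → J} (hm : Monotone m)
    (hm' : ∀ x y, m x ≤ m y → x ≤ y) {s : Sq.{u} → J} (hs : IsFinalSquare s)
    (hI : ∀ a, m a ≠ s ⟨1, 1⟩) {X : D.val (Cat.of J)} (hX : D.IsLKE (monoHom hm) X) :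
    D.IsLKE spanIncl ((D.res (monoHom hs.mono)).obj X) := by
  -- Removing only the corner from `J` isolates one value: `X` is still extended from `J'`, and the
  -- slice of `J'` over the corner reduces to the span by `exists_least`.
  let J' := {y : J // y ≠ s ⟨1, 1⟩}
  let j : Cat.of J' ⟶ Cat.of J := monoHom (m := (Subtype.val : J' → J)) fun _ _ h => h
  let f' : Cat.of I ⟶ Cat.of J' := monoHom (m := fun a => (⟨m a, hI a⟩ : J')) hm
  let s' : spanCat.{u} ⟶ Cat.of J' :=
    monoHom (m := fun x : {x : Sq.{u} // x ≠ ⟨1, 1⟩} => (⟨s x.1, hs.ne _ x.2⟩ : J'))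
      fun _ _ h => hs.mono h
  have hX' : D.IsLKE j X := hD.isLKE_of_comp (f := f') (g := j)
    (fullyFaithfulOfLe (X := I) (Y := J') _ hm') (fullyFaithfulOfLe (X := J') (Y := J) _ fun _ _ h => h) hX
  apply hD.isLKE_spanIncl
  let θ : s' ≫ j ⟶ spanIncl ≫ monoHom hs.mono := 𝟙 (s' ≫ j)
  have : IsIso θ := inferInstanceAs (IsIso (𝟙 (s' ≫ j)))
  rw [isUniv_sqApp_paste_iff θ]
  refine hX'.isUniv_sqApp (hD.lexact_of_isReflective ?_)
  rintro ⟨y, hy⟩ x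
  obtain ⟨z, hz, hz'⟩ := hs.exists_least (y := y) (leOfHom x) hy
  exact ⟨z, homOfLE (X := J') hz, preorder_hom_ext J _ _, fun t v _ =>
    ⟨homOfLE (X := {x : Sq.{u} // x ≠ ⟨1, 1⟩}) (hz' t (leOfHom (X := J') v)),
      preorder_hom_ext J' _ _, fun _ _ => preorder_hom_ext {x : Sq.{u} // x ≠ ⟨1, 1⟩} _ _⟩⟩

/-- Right Kan extensions produce cartesian squares. -/
theorem IsDerivator.isRKE_cospanIncl_of_isRKE (hD : IsDerivator D) {m : I → J} (hm : Monotone m)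
    (hm' : ∀ x y, m x ≤ m y → x ≤ y) {s : Sq.{u} → J} (hs : IsInitialSquare s)
    (hI : ∀ a, m a ≠ s ⟨0, 0⟩) {X : D.val (Cat.of J)} (hX : D.IsRKE (monoHom hm) X) :
    D.IsRKE cospanIncl ((D.res (monoHom hs.mono)).obj X) := by
  let J' := {y : J // y ≠ s ⟨0, 0⟩}
  let j : Cat.of J' ⟶ Cat.of J := monoHom (m := (Subtype.val : J' → J)) fun _ _ h => h
  let f' : Cat.of I ⟶ Cat.of J' := monoHom (m := fun a => (⟨m a, hI a⟩ : J')) hm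
  let s' : cospanCat.{u} ⟶ Cat.of J' :=
    monoHom (m := fun x : {x : Sq.{u} // x ≠ ⟨0, 0⟩} => (⟨s x.1, hs.ne _ x.2⟩ : J'))
      fun _ _ h => hs.mono h
  have hX' : D.IsRKE j X := hD.isRKE_of_comp (f := f') (g := j)
    (fullyFaithfulOfLe (X := I) (Y := J') _ hm') (fullyFaithfulOfLe (X := J') (Y := J) _ fun _ _ h => h) hX
  apply hD.isRKE_cospanIncl
  let θ : cospanIncl ≫ monoHom hs.mono ⟶ s' ≫ j := 𝟙 (s' ≫ j)
  have : IsIso θ := inferInstanceAs (IsIso (𝟙 (s' ≫ j)))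
  rw [isCouniv_sqApp_paste'_iff θ]
  refine hX'.isCouniv_sqApp ((hD.lexact_of_isCoreflective ?_).rexact (hD.der3_left _))
  rintro ⟨y, hy⟩ x
  obtain ⟨z, hz, hz'⟩ := hs.exists_greatest (y := y) (leOfHom x) hy
  exact ⟨z, homOfLE (X := J') hz, preorder_hom_ext J _ _, fun t v _ =>
    ⟨homOfLE (X := {x : Sq.{u} // x ≠ ⟨0, 0⟩}) (hz' t (leOfHom (X := J') v)),
      preorder_hom_ext J' _ _, fun _ _ => preorder_hom_ext {x : Sq.{u} // x ≠ ⟨0, 0⟩} _ _⟩⟩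

/-- A diagram all of whose new values are determined by cocartesian squares is a left Kan
extension. -/
theorem IsDerivator.isLKE_of_squares (hD : IsDerivator D) {m : I → J} (hm : Monotone m)
    (hm' : ∀ x y, m x ≤ m y → x ≤ y) (μ : J → ℕ) {X : D.val (Cat.of J)}
    (h : ∀ b : J, (∀ a, m a ≠ b) → ∃ (s : Sq.{u} → J) (hs : IsFinalSquare s), s ⟨1, 1⟩ = b ∧
      (∀ x, x ≠ ⟨1, 1⟩ → μ (s x) < μ b) ∧
      D.IsLKE spanIncl ((D.res (monoHom hs.mono)).obj X)) : D.IsLKE (monoHom hm) X := by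
  obtain ⟨W, hW, ⟨e⟩⟩ := hD.exists_isLKE (f := monoHom hm) (fullyFaithfulOfLe (X := I) (Y := J) _ hm')
    ((D.res (monoHom hm)).obj X)
  obtain ⟨k, hk : (D.res (monoHom hm)).map k = e.hom⟩ := (hW X).2 e.hom
  have hk' : IsIso ((D.res (monoHom hm)).map k) := hk ▸ inferInstance
  -- Induction on the weight `μ`. By hypothesis on smaller weights `k` is invertible on the span of
  -- `s`; both restricted squares are left Kan extended from that span, so `k` is invertible at the
  -- corner.
  have key : ∀ (N : ℕ) (b : J), μ b < N → IsIso ((D.res (ptHom (A := Cat.of J) b)).map k) := by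
    intro N
    induction N with
    | zero => intro b hb; omega
    | succ N ih =>
      intro b hb
      by_cases hb' : ∀ a, m a ≠ b
      · obtain ⟨s, hs, rfl, hμ, hX⟩ := h b hb'
        have hW' := hD.isLKE_spanIncl_of_isLKE hm hm' hs hb' hW
        have h1 : IsIso ((D.res spanIncl).map ((D.res (monoHom hs.mono)).map k)) :=
          (hD.der2 _).2 fun x => by
            have := hμ x.1 x.2
            exact (isIso_res_ptHom_comp_iff x spanIncl _).2
              ((isIso_res_ptHom_comp_iff (A := sqCat) x.1 (monoHom hs.mono) k).2
                (ih (s x.1) (by omega)))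
        have h2 := hW'.isIso hX ((D.res (monoHom hs.mono)).map k)
        exact (isIso_res_ptHom_comp_iff (A := sqCat) ⟨1, 1⟩ (monoHom hs.mono) k).1 inferInstance
      · push Not at hb'
        obtain ⟨a, rfl⟩ := hb'
        exact (isIso_res_ptHom_comp_iff (A := Cat.of I) a (monoHom hm) k).1 inferInstance
  have : IsIso k := (hD.der2 k).2 fun b => key _ b (Nat.lt_succ_self _)
  exact hW.of_iso (asIso k)

theorem IsDerivator.isRKE_of_squares (hD : IsDerivator D) {m : I → J} (hm : Monotone m)
    (hm' : ∀ x y, m x ≤ m y → x ≤ y) (μ : J → ℕ) {X : D.val (Cat.of J)}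
    (h : ∀ b : J, (∀ a, m a ≠ b) → ∃ (s : Sq.{u} → J) (hs : IsInitialSquare s), s ⟨0, 0⟩ = b ∧
      (∀ x, x ≠ ⟨0, 0⟩ → μ (s x) < μ b) ∧
      D.IsRKE cospanIncl ((D.res (monoHom hs.mono)).obj X)) : D.IsRKE (monoHom hm) X := by
  obtain ⟨W, hW, ⟨e⟩⟩ := hD.exists_isRKE (f := monoHom hm) (fullyFaithfulOfLe (X := I) (Y := J) _ hm')
    ((D.res (monoHom hm)).obj X)
  obtain ⟨k, hk : (D.res (monoHom hm)).map k = e.inv⟩ := (hW X).2 e.inv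
  have hk' : IsIso ((D.res (monoHom hm)).map k) := hk ▸ inferInstance
  have key : ∀ (N : ℕ) (b : J), μ b < N → IsIso ((D.res (ptHom (A := Cat.of J) b)).map k) := by
    intro N
    induction N with
    | zero => intro b hb; omega
    | succ N ih =>
      intro b hb
      by_cases hb' : ∀ a, m a ≠ b
      · obtain ⟨s, hs, rfl, hμ, hX⟩ := h b hb'
        have hW' := hD.isRKE_cospanIncl_of_isRKE hm hm' hs hb' hW
        have h1 : IsIso ((D.res cospanIncl).map ((D.res (monoHom hs.mono)).map k)) :=
          (hD.der2 _).2 fun x => by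
            have := hμ x.1 x.2
            exact (isIso_res_ptHom_comp_iff x cospanIncl _).2
              ((isIso_res_ptHom_comp_iff (A := sqCat) x.1 (monoHom hs.mono) k).2
                (ih (s x.1) (by omega)))
        have h2 := hX.isIso hW' ((D.res (monoHom hs.mono)).map k)
        exact (isIso_res_ptHom_comp_iff (A := sqCat) ⟨0, 0⟩ (monoHom hs.mono) k).1 inferInstance
      · push Not at hb'
        obtain ⟨a, rfl⟩ := hb'
        exact (isIso_res_ptHom_comp_iff (A := Cat.of I) a (monoHom hm) k).1 inferInstance
  have : IsIso k := (hD.der2 k).2 fun b => key _ b (Nat.lt_succ_self _)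
  exact hW.of_iso (asIso k).symm

end

end

section

/-! ### Exact diagrams on the mesh category as iterated Kan extensions -/

section Mesh

variable {n : ℕ}

/-- The vertices of `meshSquare`. -/
def meshSq (n : ℕ) (k : ℤ) (l : ℕ) (h₁ : 1 ≤ l) (h₂ : l ≤ n) (x : Sq.{u}) : Mesh.{u} n :=
  ⟨k + (x.j : ℕ), l + (x.i : ℕ) - (x.j : ℕ), by omega⟩

lemma meshSq_mono (k : ℤ) (l : ℕ) (h₁ : 1 ≤ l) (h₂ : l ≤ n) : Monotone (meshSq.{u} n k l h₁ h₂) :=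
  fun x y h => Mesh.le_iff.2 (by
    have h₃ : (x.i : ℕ) ≤ y.i := h.1
    have h₄ : (x.j : ℕ) ≤ y.j := h.2
    simp only [meshSq]
    omega)

/-- An element strictly below `(k + 1, l)` either lies in a column at most `k`, and then below `(k,
l + 1)`, or lies in column `k + 1` at a smaller height, and then below `(k + 1, l - 1)`. -/
lemma isFinalSquare_meshSq (k : ℤ) (l : ℕ) (h₁ : 1 ≤ l) (h₂ : l ≤ n) :
    IsFinalSquare (meshSq.{u} n k l h₁ h₂) where
  mono := meshSq_mono k l h₁ h₂
  ne x hx h := by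
    rcases x.cases with rfl | rfl | rfl | rfl <;> simp [meshSq, Mesh.ext_iff] at h hx; omega
  cover y hy hy' := by
    simp only [meshSq, Mesh.le_iff, ne_eq, Mesh.ext_iff] at *
    simp at *
    omega
  inter y hy hy' := by
    simp only [meshSq, Mesh.le_iff] at *
    simp at *
    omega

lemma isInitialSquare_meshSq (k : ℤ) (l : ℕ) (h₁ : 1 ≤ l) (h₂ : l ≤ n) :
    IsInitialSquare (meshSq.{u} n k l h₁ h₂) where
  mono := meshSq_mono k l h₁ h₂
  ne x hx h := by
    rcases x.cases with rfl | rfl | rfl | rfl <;> simp [meshSq, Mesh.ext_iff] at h hx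
  cover y hy hy' := by
    simp only [meshSq, Mesh.le_iff, ne_eq, Mesh.ext_iff] at *
    simp at *
    omega
  inter y hy hy' := by
    simp only [meshSq, Mesh.le_iff] at *
    simp at *
    omega

/-- Each generating arrow of `M_n` raises `2k + l` by one, so this number serves as the weight in
inductions along mesh squares. -/
lemma meshSq_weight (k : ℤ) (l : ℕ) (h₁ : 1 ≤ l) (h₂ : l ≤ n) (x : Sq.{u}) :
    2 * (meshSq n k l h₁ h₂ x).k + (meshSq n k l h₁ h₂ x).l = 2 * k + l + (x.i : ℕ) + (x.j : ℕ) := by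
  simp only [meshSq]
  omega

lemma IsFinalSquare.of_val {J : Type u} [Preorder J] {P : J → Prop} {s : Sq.{u} → {x // P x}}
    (h : IsFinalSquare fun x => (s x).1) : IsFinalSquare s where
  mono := h.mono
  ne x hx e := h.ne x hx (congrArg Subtype.val e)
  cover y hy hy' := h.cover y.1 hy fun e => hy' (Subtype.ext e)
  inter y hy hy' := h.inter y.1 hy hy'

lemma meshSq_inK₂ (k : ℤ) (hk : 0 ≤ k) (l : ℕ) (h₁ : 1 ≤ l) (h₂ : l ≤ n) (x : Sq.{u}) :
    (meshSq n k l h₁ h₂ x).InK₂ := by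
  simp only [Mesh.InK₂, Mesh.InK₁, Mesh.InChain, meshSq]
  omega

/-- The mesh squares in nonnegative columns, inside `K₂`. -/
def meshSqK₂ (n : ℕ) (k : ℤ) (hk : 0 ≤ k) (l : ℕ) (h₁ : 1 ≤ l) (h₂ : l ≤ n) (x : Sq.{u}) :
    {x : Mesh.{u} n // x.InK₂} := ⟨meshSq n k l h₁ h₂ x, meshSq_inK₂ k hk l h₁ h₂ x⟩

lemma isFinalSquare_meshSqK₂ (k : ℤ) (hk : 0 ≤ k) (l : ℕ) (h₁ : 1 ≤ l) (h₂ : l ≤ n) :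
    IsFinalSquare (meshSqK₂.{u} n k hk l h₁ h₂) :=
  IsFinalSquare.of_val (isFinalSquare_meshSq k l h₁ h₂)

end Mesh

section

variable {n : ℕ} {D : Prederivator.{u, v, w}} {A B : Cat.{u, u}}

/-- Exactness of a diagram `X ∈ D(M_n)`. -/
structure MeshExact (n : ℕ) (D : Prederivator.{u, v, w}) (X : D.val (meshCat n)) : Prop where
  bot : ∀ k : ℤ, Limits.IsZero ((D.res (ptHom (A := meshCat n) ⟨k, 0, Nat.zero_le _⟩)).obj X)
  top : ∀ k : ℤ, Limits.IsZero ((D.res (ptHom (A := meshCat n) ⟨k, n + 1, le_rfl⟩)).obj X)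
  square : ∀ (k : ℤ) (l : ℕ) (h₁ : 1 ≤ l) (h₂ : l ≤ n),
    D.IsLKE spanIncl ((D.res (meshSquare n k l h₁ h₂)).obj X)

/-- The diagram `X ∈ D(M_n)` is obtained from its restriction to `A_n` by the Kan extensions along
`incl₁`, …, `incl₄`. -/
structure MeshKan (n : ℕ) (D : Prederivator.{u, v, w}) (X : D.val (meshCat n)) : Prop where
  kan₁ : D.IsRKE (incl₁ n) ((D.res (incl₂ n)).obj ((D.res (incl₃ n)).obj ((D.res (incl₄ n)).obj X)))
  kan₂ : D.IsLKE (incl₂ n) ((D.res (incl₃ n)).obj ((D.res (incl₄ n)).obj X))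
  kan₃ : D.IsLKE (incl₃ n) ((D.res (incl₄ n)).obj X)
  kan₄ : D.IsRKE (incl₄ n) X

lemma isZero_res_ptHom_comp_iff (a : A) (f : A ⟶ B) (X : D.val B) :
    Limits.IsZero ((D.res (ptHom a)).obj ((D.res f).obj X)) ↔
      Limits.IsZero ((D.res (ptHom (f.toFunctor.obj a))).obj X) :=
  (((D.resComp (ptHom a) f).symm ≪≫ D.resMapIso (ptIso (ptHom a ≫ f))).app X).isZero_iff

def incl₁FF (n : ℕ) : (incl₁.{u} n).toFunctor.FullyFaithful :=
  fullyFaithfulOfLe (X := Chain.{u} n) (Y := {x : Mesh.{u} n // x.InK₁}) _ fun x y h => by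
    have := (Mesh.le_iff.1 h).2
    simp only [incl₁] at this
    change x.l ≤ y.l
    simp at this
    exact this

def incl₂FF (n : ℕ) : (incl₂.{u} n).toFunctor.FullyFaithful :=
  fullyFaithfulOfLe (X := {x : Mesh.{u} n // x.InK₁}) (Y := {x : Mesh.{u} n // x.InK₂}) _
    fun _ _ h => h

def incl₃FF (n : ℕ) : (incl₃.{u} n).toFunctor.FullyFaithful :=
  fullyFaithfulOfLe (X := {x : Mesh.{u} n // x.InK₂}) (Y := {x : Mesh.{u} n // x.InK₃}) _
    fun _ _ h => h

def incl₄FF (n : ℕ) : (incl₄.{u} n).toFunctor.FullyFaithful :=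
  fullyFaithfulOfLe (X := {x : Mesh.{u} n // x.InK₃}) (Y := Mesh.{u} n) _
    fun _ _ h => h

/-- The zero conditions for `(k, 0)`, `k > 0` and `(k, n + 1)`, `k ≥ 0`. -/
lemma IsPointedDerivator.isRKE_incl₁_iff (hD : IsPointedDerivator D) (X : D.val (catK₁ n)) :
    D.IsRKE (incl₁ n) X ↔ ∀ b : {x : Mesh.{u} n // x.InK₁}, ¬ b.1.InChain →
      Limits.IsZero ((D.res (ptHom (A := catK₁ n) b)).obj X) := by
  rw [hD.isRKE_iff_isZero (incl₁FF n)]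
  · refine forall_congr' fun b => imp_congr_left ⟨fun h hb => ?_, ?_⟩
    · exact h ⟨b.1.l, hb.2.1, hb.2.2⟩ (Subtype.ext (Mesh.ext hb.1.symm rfl))
    · rintro h a rfl
      exact h ⟨rfl, a.one_le, a.le⟩
  -- `A_n` is a sieve in `K₁`: the added vertex `(0, n + 1)` lies above the chain, and the other
  -- added vertices are in columns `k > 0`.
  · rintro a ⟨b, hb⟩ h
    refine ⟨fun k => ?_⟩
    have hba := Mesh.le_iff.1 (leOfHom (X := {x : Mesh.{u} n // x.InK₁}) k)
    have ha : ((incl₁ n).toFunctor.obj a).1.k = 0 := rfl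
    have ha' : ((incl₁ n).toFunctor.obj a).1.l = a.l := rfl
    have := a.le
    have h' : ¬ b.InChain := fun hb' =>
      h ⟨b.l, hb'.2.1, hb'.2.2⟩ (Subtype.ext (Mesh.ext hb'.1.symm rfl))
    rw [ha, ha'] at hba
    simp only [Mesh.InK₁, Mesh.InChain] at hb h' hba
    omega

/-- `K₂` is a cosieve in `K₃`. No vertex of `K₂` has negative column, and those in column `0` have
`l ≥ 1`, so none of them lies below an added vertex `(k, n + 1)`, `k < 0`, or `(k, 0)`, `k ≤ 0`. -/
lemma IsPointedDerivator.isLKE_incl₃_iff (hD : IsPointedDerivator D) (X : D.val (catK₃ n)) :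
    D.IsLKE (incl₃ n) X ↔ ∀ b : {x : Mesh.{u} n // x.InK₃}, ¬ b.1.InK₂ →
      Limits.IsZero ((D.res (ptHom (A := catK₃ n) b)).obj X) := by
  rw [hD.isLKE_iff_isZero (incl₃FF n)]
  · refine forall_congr' fun b => imp_congr_left ⟨fun h hb => ?_, ?_⟩
    · exact h ⟨b.1, hb⟩ rfl
    · rintro h a rfl
      exact h a.2
  · rintro ⟨a, ha⟩ ⟨b, hb⟩ h
    refine ⟨fun k => ?_⟩
    have hba : a.k ≤ b.k ∧ a.k + a.l ≤ b.k + b.l :=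
      Mesh.le_iff.1 (leOfHom (X := {x : Mesh.{u} n // x.InK₃}) k)
    have h' : ¬ b.InK₂ := fun hb' => h ⟨b, hb'⟩ rfl
    simp only [Mesh.InK₃, Mesh.InK₂, Mesh.InK₁, Mesh.InChain] at ha hb h'
    omega

/-- Exact diagrams are the iterated Kan extensions. -/
theorem IsPointedDerivator.meshExact_iff (hD : IsPointedDerivator D)
    (hst : ∀ Q : D.val sqCat, D.IsLKE spanIncl Q ↔ D.IsRKE cospanIncl Q) (X : D.val (meshCat n)) :
    MeshExact n D X ↔ MeshKan n D X := by
  have zero₁ (b : {x : Mesh.{u} n // x.InK₁}) :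
      Limits.IsZero ((D.res (ptHom (A := catK₁ n) b)).obj
        ((D.res (incl₂ n)).obj ((D.res (incl₃ n)).obj ((D.res (incl₄ n)).obj X)))) ↔
      Limits.IsZero ((D.res (ptHom (A := meshCat n) b.1)).obj X) :=
    (isZero_res_ptHom_comp_iff (A := catK₁ n) b _ _).trans
      ((isZero_res_ptHom_comp_iff (A := catK₂ n) ⟨b.1, .inl b.2⟩ _ _).trans
        (isZero_res_ptHom_comp_iff (A := catK₃ n) ⟨b.1, .inl (.inl b.2)⟩ _ _))
  have zero₃ (b : {x : Mesh.{u} n // x.InK₃}) :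
      Limits.IsZero ((D.res (ptHom (A := catK₃ n) b)).obj ((D.res (incl₄ n)).obj X)) ↔
      Limits.IsZero ((D.res (ptHom (A := meshCat n) b.1)).obj X) :=
    isZero_res_ptHom_comp_iff (A := catK₃ n) b _ _
  have sq₂ (k : ℤ) (hk : 0 ≤ k) (l : ℕ) (h₁ : 1 ≤ l) (h₂ : l ≤ n) :
      Nonempty ((D.res (meshSquare n k l h₁ h₂)).obj X ≅
        (D.res (monoHom (isFinalSquare_meshSqK₂ k hk l h₁ h₂).mono)).obj
          ((D.res (incl₃ n)).obj ((D.res (incl₄ n)).obj X))) :=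
    ⟨(D.resComp (monoHom (isFinalSquare_meshSqK₂ k hk l h₁ h₂).mono) (incl₃ n ≫ incl₄ n)).app X ≪≫
      (D.res _).mapIso ((D.resComp (incl₃ n) (incl₄ n)).app X)⟩
  constructor
  · intro hX
    have hz (b : Mesh.{u} n) (hb : b.l = 0 ∨ b.l = n + 1) :
        Limits.IsZero ((D.res (ptHom (A := meshCat n) b)).obj X) := by
      obtain ⟨k, l, hl⟩ := b
      rcases hb with rfl | rfl
      · exact hX.bot k
      · exact hX.top k
    refine ⟨?_, ?_, ?_, ?_⟩
    · refine (hD.isRKE_incl₁_iff _).2 fun b hb => (zero₁ b).2 (hz _ ?_)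
      have := b.2
      simp only [Mesh.InK₁, Mesh.InChain] at hb this
      omega
    -- A new vertex `(k, l)` of `K₂` has `k > 0` and `1 ≤ l ≤ n`, and is the final corner of the
    -- square starting in column `k - 1`. Columns in `K₂` are nonnegative, so truncating `2k + l` to
    -- a natural number loses nothing.
    · refine hD.isLKE_of_squares (I := {x : Mesh.{u} n // x.InK₁})
        (m := fun x => (⟨x.1, .inl x.2⟩ : {x : Mesh.{u} n // x.InK₂})) (fun _ _ h => h)
        (fun _ _ h => h) (fun b => (2 * b.1.k + b.1.l).toNat) ?_
      rintro ⟨⟨k, l, hl⟩, hb⟩ hb'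
      have h' : ¬ (⟨k, l, hl⟩ : Mesh.{u} n).InK₁ := fun h => hb' ⟨_, h⟩ rfl
      simp only [Mesh.InK₂, Mesh.InK₁, Mesh.InChain] at hb h'
      have h₁ : 1 ≤ l := by omega
      have h₂ : l ≤ n := by omega
      refine ⟨meshSqK₂ n (k - 1) (by omega) l h₁ h₂, isFinalSquare_meshSqK₂ _ _ _ h₁ h₂,
        Subtype.ext ?_, fun x hx => ?_, ?_⟩
      · simp [meshSqK₂, meshSq]
      · have hw := meshSq_weight (k - 1) l h₁ h₂ x
        simp only [meshSqK₂]
        rw [hw]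
        rcases x.cases with rfl | rfl | rfl | rfl <;> simp at hx ⊢ <;> omega
      · obtain ⟨e⟩ := sq₂ (k - 1) (by omega) l h₁ h₂
        exact (hX.square (k - 1) l h₁ h₂).of_iso e
    · refine (hD.isLKE_incl₃_iff _).2 fun b hb => (zero₃ b).2 (hz _ ?_)
      have := b.2
      simp only [Mesh.InK₃, Mesh.InK₂, Mesh.InK₁, Mesh.InChain] at hb this
      omega
    -- Leftwards the weight is reversed. New vertices have `k ≤ -1` and `l ≤ n`, so the largest
    -- value of `2k + l` on their square is at most `n`; the offset `n + 2` keeps the truncated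
    -- weight strictly monotone there. The squares are cartesian by `hst`.
    · refine hD.isRKE_of_squares (I := {x : Mesh.{u} n // x.InK₃}) (m := Subtype.val)
        (fun _ _ h => h) (fun _ _ h => h) (fun b => (n + 2 - (2 * b.k + b.l)).toNat) ?_
      rintro ⟨k, l, hl⟩ hb'
      have h' : ¬ (⟨k, l, hl⟩ : Mesh.{u} n).InK₃ := fun h => hb' ⟨_, h⟩ rfl
      simp only [Mesh.InK₃, Mesh.InK₂, Mesh.InK₁, Mesh.InChain] at h'
      have h₁ : 1 ≤ l := by omega
      have h₂ : l ≤ n := by omega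
      refine ⟨meshSq n k l h₁ h₂, isInitialSquare_meshSq _ _ h₁ h₂, ?_, fun x hx => ?_,
        (hst _).1 (hX.square k l h₁ h₂)⟩
      · simp [meshSq]
      · have hw := meshSq_weight k l h₁ h₂ x
        rw [hw]
        rcases x.cases with rfl | rfl | rfl | rfl <;> simp at hx ⊢ <;> omega
  · intro hX
    have z₁ (b : Mesh.{u} n) (hb : b.InK₁) (hb' : ¬ b.InChain) :
        Limits.IsZero ((D.res (ptHom (A := meshCat n) b)).obj X) :=
      (zero₁ ⟨b, hb⟩).1 ((hD.isRKE_incl₁_iff _).1 hX.kan₁ ⟨b, hb⟩ hb')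
    have z₃ (b : Mesh.{u} n) (hb : b.InK₃) (hb' : ¬ b.InK₂) :
        Limits.IsZero ((D.res (ptHom (A := meshCat n) b)).obj X) :=
      (zero₃ ⟨b, hb⟩).1 ((hD.isLKE_incl₃_iff _).1 hX.kan₃ ⟨b, hb⟩ hb')
    refine ⟨fun k => ?_, fun k => ?_, fun k l h₁ h₂ => ?_⟩
    · by_cases hk : 0 < k
      · exact z₁ _ (by simp only [Mesh.InK₁, Mesh.InChain, and_true]; omega)
          (by simp only [Mesh.InChain]; omega)
      · exact z₃ _ (by simp only [Mesh.InK₃, Mesh.InK₂, Mesh.InK₁, Mesh.InChain, and_true]; omega)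
          (by simp only [Mesh.InK₂, Mesh.InK₁, Mesh.InChain, and_true]; omega)
    · by_cases hk : 0 ≤ k
      · exact z₁ _ (by simp only [Mesh.InK₁, Mesh.InChain, and_true]; omega)
          (by simp only [Mesh.InChain]; omega)
      · exact z₃ _ (by simp only [Mesh.InK₃, Mesh.InK₂, Mesh.InK₁, Mesh.InChain, and_true]; omega)
          (by simp only [Mesh.InK₂, Mesh.InK₁, Mesh.InChain, and_true]; omega)
    -- Squares starting in columns `k ≥ 0` are produced by the left Kan extension along `incl₂`. For
    -- `k < 0` the right Kan extension along `incl₄` gives cartesian squares, which are cocartesian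
    -- by `hst`.
    · by_cases hk : 0 ≤ k
      · obtain ⟨e⟩ := sq₂ k hk l h₁ h₂
        refine IsLKE.of_iso ?_ e.symm
        refine hD.isLKE_spanIncl_of_isLKE (I := {x : Mesh.{u} n // x.InK₁})
          (m := fun x => (⟨x.1, .inl x.2⟩ : {x : Mesh.{u} n // x.InK₂})) (fun _ _ h => h)
          (fun _ _ h => h) (isFinalSquare_meshSqK₂ k hk l h₁ h₂) (fun a ha => ?_) hX.kan₂
        have h3 := a.2
        rw [show a.1 = meshSq n k l h₁ h₂ ⟨1, 1⟩ from congrArg Subtype.val ha] at h3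
        simp only [Mesh.InK₁, Mesh.InChain, meshSq] at h3
        simp at h3
        omega
      · refine (hst _).2 ?_
        refine hD.isRKE_cospanIncl_of_isRKE (I := {x : Mesh.{u} n // x.InK₃})
          (m := Subtype.val) (fun _ _ h => h)
          (fun _ _ h => h) (isInitialSquare_meshSq k l h₁ h₂) (fun a ha => ?_) hX.kan₄
        have h3 := a.2
        rw [ha] at h3
        simp only [Mesh.InK₃, Mesh.InK₂, Mesh.InK₁, Mesh.InChain, meshSq] at h3
        simp at h3
        omega

end

end

/-! ### Restriction to the chain as a levelwise equivalence -/

section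

namespace Prederivator

variable {D : Prederivator.{u, v, w}} {A B C P : Cat.{u, u}}

lemma bijective_res_comp_iff (f : A ⟶ B) (g : B ⟶ C) (X Y : D.val C) :
    (Function.Bijective fun k : X ⟶ Y => (D.res (f ≫ g)).map k) ↔
      Function.Bijective fun k : X ⟶ Y => (D.res f).map ((D.res g).map k) := by
  have : (fun k : X ⟶ Y => (D.res (f ≫ g)).map k) =
    (fun l => (D.resComp f g).hom.app X ≫ l ≫ (D.resComp f g).inv.app Y) ∘
      fun k : X ⟶ Y => (D.res f).map ((D.res g).map k) := by
    ext k
    exact (NatIso.naturality_2 (D.resComp f g) k).symm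
  rw [this]
  exact Function.Bijective.of_comp_iff'
    (((D.resComp f g).app X).homCongr ((D.resComp f g).app Y)).symm.bijective _

/-- The base-changed universal arrow is the component of the invertible cell `θ`, so it exhibits a
Kan extension with unchanged values. -/
lemma IsLKE.res {p : P ⟶ A} {f : A ⟶ C} {q : P ⟶ B} {g : B ⟶ C} {θ : p ≫ f ⟶ q ≫ g} [IsIso θ]
    {X : D.val C} (hX : D.IsLKE f X) (hθ : D.LExact θ) : D.IsLKE q ((D.res g).obj X) := by
  have := isIso_sqApp θ X
  exact IsUniv.isLKE (hX.isUniv_sqApp hθ)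

lemma isLKE_of_isEquivalence {w : A ⟶ B} (hw : w.toFunctor.IsEquivalence) (X : D.val B) :
    D.IsLKE w X := fun Y =>
  have := res_isEquivalence (D := D) w hw
  ⟨(D.res w).map_injective, (D.res w).map_surjective⟩

lemma isRKE_of_isEquivalence {w : A ⟶ B} (hw : w.toFunctor.IsEquivalence) (X : D.val B) :
    D.IsRKE w X := fun Y =>
  have := res_isEquivalence (D := D) w hw
  ⟨(D.res w).map_injective, (D.res w).map_surjective⟩

/-- Being a left Kan extension is invariant under equivalences of categories. -/
lemma isLKE_iff_of_isEquivalence {f : A ⟶ B} {w : B ⟶ C} {w' : A ⟶ P} {g : P ⟶ C}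
    (hw : w.toFunctor.IsEquivalence) (hw' : w'.toFunctor.IsEquivalence) (e : f ≫ w = w' ≫ g)
    (X : D.val C) : D.IsLKE f ((D.res w).obj X) ↔ D.IsLKE g X := by
  rw [← isLKE_comp_iff (isLKE_of_isEquivalence hw' _), ← e]
  have := res_isEquivalence (D := D) w hw
  refine ⟨fun h => (isLKE_comp_iff h).2 (isLKE_of_isEquivalence hw X), fun h => ?_⟩
  rw [isLKE_iff, ← isUniv_iff_of_isEquivalence (D.res w)]
  intro Y
  have h1 := (bijective_res_comp_iff f w X Y).1 (h Y)
  simpa using h1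

lemma isRKE_iff_of_isEquivalence {f : A ⟶ B} {w : B ⟶ C} {w' : A ⟶ P} {g : P ⟶ C}
    (hw : w.toFunctor.IsEquivalence) (hw' : w'.toFunctor.IsEquivalence) (e : f ≫ w = w' ≫ g)
    (X : D.val C) : D.IsRKE f ((D.res w).obj X) ↔ D.IsRKE g X := by
  rw [← isRKE_comp_iff (isRKE_of_isEquivalence hw' _), ← e]
  have := res_isEquivalence (D := D) w hw
  refine ⟨fun h => (isRKE_comp_iff h).2 (isRKE_of_isEquivalence hw X), fun h => ?_⟩
  rw [isRKE_iff, ← isCouniv_iff_of_isEquivalence (D.res w)]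
  intro Y
  have h1 := (bijective_res_comp_iff f w Y X).1 (h Y)
  simpa using h1

end Prederivator

section

variable {D : Prederivator.{u, v, w}} {n : ℕ}

/-- The equivalence `L × (K × A) ⥤ K × (L × A)`. -/
abbrev prodLeftComm (K L A : Cat.{u, u}) :
    prodCat L (prodCat K A) ⟶ prodCat K (prodCat L A) :=
  Functor.toCatHom
    { obj x := (x.2.1, (x.1, x.2.2))
      map f := (f.2.1, (f.1, f.2.2)) }

lemma prodLeftComm_isEquivalence (K L A : Cat.{u, u}) :
    (prodLeftComm K L A).toFunctor.IsEquivalence where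
  faithful := ⟨fun {x y} f g h => Prod.ext congr($(h).2.1) (Prod.ext congr($(h).1) congr($(h).2.2))⟩
  full := ⟨fun f => ⟨(f.2.1, (f.1, f.2.2)), rfl⟩⟩
  essSurj := ⟨fun x => ⟨(x.2.1, (x.1, x.2.2)), ⟨Iso.refl _⟩⟩⟩

/-- The shift of a stable derivator is a stable derivator. -/
theorem IsStableDerivator.shift (hD : IsStableDerivator D) (K : Cat.{u, u}) :
    IsStableDerivator (D.shift K) := by
  have hK := hD.isPointed.shift K
  refine { hK with stable := fun {A} Q => ?_ }
  rw [hK.isCocartesian_iff, hK.isCartesian_iff]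
  -- Reordering the factors turns a square of `D^K` over `A` into a square of `D` over `K × A`, so
  -- stability of `D` applies.
  have h1 := isLKE_iff_of_isEquivalence (D := D) (f := prodMap spanIncl (𝟙 (prodCat K A)))
    (g := prodMap (𝟙 K) (prodMap spanIncl (𝟙 A))) (prodLeftComm_isEquivalence K sqCat A)
    (prodLeftComm_isEquivalence K spanCat A) rfl Q
  have h2 := isRKE_iff_of_isEquivalence (D := D) (f := prodMap cospanIncl (𝟙 (prodCat K A)))
    (g := prodMap (𝟙 K) (prodMap cospanIncl (𝟙 A))) (prodLeftComm_isEquivalence K sqCat A)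
    (prodLeftComm_isEquivalence K cospanCat A) rfl Q
  exact h1.symm.trans ((hD.isCocartesian_iff _).symm.trans ((hD.stable _).trans
    ((hD.isCartesian_iff _).trans h2)))

lemma sectRPt_isEquivalence (A : Cat.{u, u}) :
    (sectRHom (K := ptCat.{u}) ⟨⟨⟩⟩ A).toFunctor.IsEquivalence where
  faithful := ⟨fun {x y} f g h => congr($(h).2)⟩
  full := ⟨fun f => ⟨f.2, Prod.ext (discrete_hom_ext (α := PUnit) _ _) rfl⟩⟩
  essSurj := ⟨fun ⟨⟨⟨⟩⟩, x⟩ => ⟨x, ⟨Iso.refl _⟩⟩⟩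

/-- `D.eval` lands in `D(A)`, whereas the value of `K ↦ D(K × A)` at a point lands in the equivalent
category of diagrams on the product of the point with `A`. -/
lemma IsDerivator.isZero_eval_iff (hD : IsDerivator D) {K A : Cat.{u, u}} (k : K) (X : D.val (prodCat K A)) :
    Limits.IsZero ((D.eval k A).obj X) ↔
      Limits.IsZero (((D.shiftRight A).res (ptHom k)).obj X) := by
  have := res_isEquivalence (D := D) _ (sectRPt_isEquivalence A)
  have e : (D.eval k A).obj X ≅
      (D.res (sectRHom (K := ptCat.{u}) ⟨⟨⟩⟩ A)).obj ((D.res (prodMap (ptHom k) (𝟙 A))).obj X) :=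
    (D.resComp (sectRHom (K := ptCat.{u}) ⟨⟨⟩⟩ A) (prodMap (ptHom k) (𝟙 A))).app X
  rw [e.isZero_iff]
  exact ⟨fun h => Limits.IsZero.of_full_of_faithful_of_isZero _ _ h, fun h => hD.isZero_res _ h⟩

lemma IsStableDerivator.isLKE_iff_isRKE (hD : IsStableDerivator D) (A : Cat.{u, u})
    (Q : (D.shiftRight A).val sqCat) :
    (D.shiftRight A).IsLKE spanIncl Q ↔ (D.shiftRight A).IsRKE cospanIncl Q :=
  (hD.isCocartesian_iff _).symm.trans ((hD.stable _).trans (hD.isCartesian_iff _))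

lemma IsStableDerivator.isBicartesian_iff (hD : IsStableDerivator D) {A : Cat.{u, u}}
    (Q : D.val (prodCat sqCat A)) :
    D.IsBicartesian Q ↔ D.IsLKE (prodMap spanIncl (𝟙 A)) Q := by
  rw [IsBicartesian, ← hD.stable, and_self, hD.isCocartesian_iff]

lemma IsStableDerivator.isExactDiagram_iff (hD : IsStableDerivator D) {A : Cat.{u, u}}
    (X : D.val (prodCat (meshCat n) A)) :
    IsExactDiagram n D A X ↔ MeshExact n (D.shiftRight A) X :=
  ⟨fun h => ⟨fun k => (hD.isZero_eval_iff _ _).1 (h.bot k), fun k => (hD.isZero_eval_iff _ _).1 (h.top k),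
    fun k l h₁ h₂ => (hD.isBicartesian_iff _).1 (h.square k l h₁ h₂)⟩,
  fun h => ⟨fun k => (hD.isZero_eval_iff _ _).2 (h.bot k), fun k => (hD.isZero_eval_iff _ _).2 (h.top k),
    fun k l h₁ h₂ => (hD.isBicartesian_iff _).2 (h.square k l h₁ h₂)⟩⟩

lemma IsStableDerivator.isExactDiagram_iff_meshKan (hD : IsStableDerivator D) {A : Cat.{u, u}}
    (X : D.val (prodCat (meshCat n) A)) :
    IsExactDiagram n D A X ↔ MeshKan n (D.shiftRight A) X :=
  (hD.isExactDiagram_iff X).trans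
    ((hD.isPointed.shiftRight A).meshExact_iff (hD.isLKE_iff_isRKE A) X)

/-- Exact diagrams are stable under restriction. -/
lemma IsStableDerivator.isExactDiagram_res (hD : IsStableDerivator D) {A A' : Cat.{u, u}}
    (f : A' ⟶ A) {X : D.val (prodCat (meshCat n) A)} (hX : IsExactDiagram n D A X) :
    IsExactDiagram n D A' ((D.res (prodMap (𝟙 (meshCat n)) f)).obj X) where
  bot k := (hD.isZero_res f (hX.bot k)).of_iso
    ((D.resComp (sectRHom _ A') (prodMap (𝟙 (meshCat n)) f)).symm.app X ≪≫
      (D.resComp f (sectRHom (K := meshCat n) _ A)).app X)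
  top k := (hD.isZero_res f (hX.top k)).of_iso
    ((D.resComp (sectRHom _ A') (prodMap (𝟙 (meshCat n)) f)).symm.app X ≪≫
      (D.resComp f (sectRHom (K := meshCat n) _ A)).app X)
  square k l h₁ h₂ := by
    rw [hD.isBicartesian_iff]
    have h := (hD.isBicartesian_iff _).1 (hX.square k l h₁ h₂)
    let θ : prodMap (𝟙 spanCat) f ≫ prodMap spanIncl (𝟙 A) ⟶
      prodMap spanIncl (𝟙 A') ≫ prodMap (𝟙 sqCat) f := 𝟙 (prodMap spanIncl f)
    have : IsIso θ := inferInstanceAs (IsIso (𝟙 (prodMap spanIncl f)))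
    -- Restriction in the parameter commutes with left Kan extension in the direction of the square.
    have h' := IsLKE.res (θ := θ) h (hD.lexact_prod_left spanIncl f)
    exact h'.of_iso ((D.resComp (prodMap (𝟙 sqCat) f) (prodMap (meshSquare n k l h₁ h₂) (𝟙 A))).symm.app X
      ≪≫ (D.resComp (prodMap (meshSquare n k l h₁ h₂) (𝟙 A')) (prodMap (𝟙 (meshCat n)) f)).app X)

/-- The closure under restriction built into `exProp` is automatic by `isExactDiagram_res`;
conversely it is applied to the identity. -/
theorem IsStableDerivator.exProp_iff (hD : IsStableDerivator D) (A : Cat.{u, u})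
    (X : D.val (prodCat (meshCat n) A)) :
    (exProp n D).prop (op A) X ↔ IsExactDiagram n D A X :=
  ⟨fun h => (h (op A) (𝟙 _)).of_iso ((D.resId (prodCat (meshCat n) A)).app X),
    fun h A' f => hD.isExactDiagram_res f.unop h⟩

/-- The restriction `i^* : D^{M_n,ex} ⟶ D^{A_n}` is an equivalence at every category. -/
theorem IsStableDerivator.res_incl_isEquivalence (hD : IsStableDerivator D) (n : ℕ)
    (A : Cat.{u, u}) :
    (((exProp n D).prop (op A)).ι ⋙ D.res (prodMap (incl n) (𝟙 A))).IsEquivalence := by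
  have kan (X : ((exProp n D).prop (op A)).FullSubcategory) : MeshKan n (D.shiftRight A) X.obj :=
    (hD.isExactDiagram_iff_meshKan X.obj).1 ((hD.exProp_iff A X.obj).1 X.property)
  have hA := hD.toIsDerivator.shiftRight A
  -- One inclusion is removed at a time. For a right Kan extension the target `Y` supplies the
  -- bijection on morphisms, for a left one the source `X`.
  have key (X Y : ((exProp n D).prop (op A)).FullSubcategory) :
      Function.Bijective fun k : X.obj ⟶ Y.obj => (D.res (prodMap (incl n) (𝟙 A))).map k := by
    refine (bijective_res_comp_iff (D := D.shiftRight A) (incl₁ n ≫ incl₂ n ≫ incl₃ n) (incl₄ n)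
      X.obj Y.obj).2 (Function.Bijective.comp (g := fun k => _) ?_ ((kan Y).kan₄ X.obj))
    refine (bijective_res_comp_iff (D := D.shiftRight A) (incl₁ n ≫ incl₂ n) (incl₃ n)
      _ _).2 (Function.Bijective.comp (g := fun k => _) ?_ ((kan X).kan₃ _))
    refine (bijective_res_comp_iff (D := D.shiftRight A) (incl₁ n) (incl₂ n)
      _ _).2 (Function.Bijective.comp (g := fun k => _) ?_ ((kan X).kan₂ _))
    exact (kan Y).kan₁ _
  refine ⟨⟨fun {X Y} f g h => ?_⟩, ⟨fun {X Y} f => ?_⟩, ⟨fun X => ?_⟩⟩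
  · exact ObjectProperty.hom_ext _ ((key X Y).1 h)
  · obtain ⟨k, hk⟩ := (key X Y).2 f
    exact ⟨ObjectProperty.homMk k, hk⟩
  -- Essential surjectivity: extend through the four inclusions. Each extension keeps the values
  -- already given, so the earlier Kan conditions persist in `X₄`.
  · obtain ⟨X₁, h₁, ⟨e₁⟩⟩ := hA.exists_isRKE (incl₁FF n) X
    obtain ⟨X₂, h₂, ⟨e₂⟩⟩ := hA.exists_isLKE (incl₂FF n) X₁
    obtain ⟨X₃, h₃, ⟨e₃⟩⟩ := hA.exists_isLKE (incl₃FF n) X₂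
    obtain ⟨X₄, h₄, ⟨e₄⟩⟩ := hA.exists_isRKE (incl₄FF n) X₃
    let E := D.shiftRight A
    let e₃' := (E.res (incl₃ n)).mapIso e₄ ≪≫ e₃
    let e₂' := (E.res (incl₂ n)).mapIso e₃' ≪≫ e₂
    have hX : MeshKan n (D.shiftRight A) X₄ :=
      ⟨h₁.of_iso e₂'.symm, h₂.of_iso e₃'.symm, h₃.of_iso e₄.symm, h₄⟩
    refine ⟨⟨X₄, (hD.exProp_iff A X₄).2 ((hD.isExactDiagram_iff_meshKan X₄).2 hX)⟩, ⟨?_⟩⟩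
    exact (E.resComp (incl₁ n ≫ incl₂ n ≫ incl₃ n) (incl₄ n)).app X₄ ≪≫
      (E.resComp (incl₁ n ≫ incl₂ n) (incl₃ n)).app _ ≪≫
      (E.resComp (incl₁ n) (incl₂ n)).app _ ≪≫ (E.res (incl₁ n)).mapIso e₂' ≪≫ e₁

/-- All the axioms are transferred from `D^{A_n}` along the levelwise equivalence `i^*`; no Kan
extension of exact diagrams has to be constructed. -/
theorem IsStableDerivator.exMesh (hD : IsStableDerivator D) (n : ℕ) :
    IsStableDerivator (exMesh n D) :=
  IsStableDerivator.of_equivalence (ζ := exMeshι n D ≫ D.shiftRes (incl n))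
    (fun A => hD.res_incl_isEquivalence n A) (hD.shift (chainCat n))

end

end

section

/-! ### Exactness of the inclusion of the exact diagrams -/

section

variable {D : Prederivator.{u, v, w}} {n : ℕ} {A B : Cat.{u, u}}

lemma IsPointedDerivator.isLKE_of_isZero (hD : IsPointedDerivator D) (f : A ⟶ B) {X : D.val B}
    (hX : Limits.IsZero X) : D.IsLKE f X := fun Y => by
  have h := hD.isZero_res f hX
  exact ⟨fun _ _ _ => hX.eq_of_src _ _, fun y => ⟨hX.to_ Y, h.eq_of_src _ _⟩⟩

lemma IsPointedDerivator.isZero_of_isLKE (hD : IsPointedDerivator D) {f : A ⟶ B} {X : D.val B}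
    (hX : D.IsLKE f X) (h : Limits.IsZero ((D.res f).obj X)) : Limits.IsZero X := by
  have := hD.hasZeroObject B
  refine isZero_of_unique_to fun Y => ?_
  obtain ⟨i⟩ := h.unique_to ((D.res f).obj Y)
  exact ⟨(Equiv.ofBijective _ (hX Y)).unique⟩

lemma IsStableDerivator.isExactDiagram_of_isZero (hD : IsStableDerivator D)
    {X : D.val (prodCat (meshCat n) A)} (hX : Limits.IsZero X) : IsExactDiagram n D A X where
  bot k := hD.isZero_res _ hX
  top k := hD.isZero_res _ hX
  square k l h₁ h₂ := (hD.isBicartesian_iff _).2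
    (hD.isPointed.isLKE_of_isZero _ (hD.isZero_res _ hX))

/-- The exact diagrams are closed under left Kan extensions along fully faithful functors. -/
lemma IsStableDerivator.isExactDiagram_of_isLKE (hD : IsStableDerivator D) {g : A ⟶ B}
    (hg : g.toFunctor.FullyFaithful) {Z : D.val (prodCat (meshCat n) B)}
    (hZ : D.IsLKE (prodMap (𝟙 (meshCat n)) g) Z)
    (h : IsExactDiagram n D A ((D.res (prodMap (𝟙 (meshCat n)) g)).obj Z)) :
    IsExactDiagram n D B Z := by
  -- Left Kan extension in the parameter commutes with evaluation at `x`, so the value at `x` is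
  -- extended from a zero object.
  have zero (x : Mesh.{u} n)
      (hx : Limits.IsZero ((D.eval x A).obj ((D.res (prodMap (𝟙 (meshCat n)) g)).obj Z))) :
      Limits.IsZero ((D.eval x B).obj Z) := by
    let θ : sectRHom (K := meshCat n) x A ≫ prodMap (𝟙 (meshCat n)) g ⟶
      g ≫ sectRHom (K := meshCat n) x B := 𝟙 (g ≫ sectRHom (K := meshCat n) x B)
    have : IsIso θ := inferInstanceAs (IsIso (𝟙 (g ≫ sectRHom (K := meshCat n) x B)))
    have h1 := IsLKE.res (θ := θ) hZ (hD.lexact_sectR (K := meshCat n) x g)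
    refine hD.isPointed.isZero_of_isLKE h1 (hx.of_iso ?_)
    exact (D.resComp g (sectRHom (K := meshCat n) x B)).symm.app Z ≪≫
      (D.resComp (sectRHom (K := meshCat n) x A) (prodMap (𝟙 (meshCat n)) g)).app Z
  refine ⟨fun k => zero _ (h.bot k), fun k => zero _ (h.top k), fun k l h₁ h₂ => ?_⟩
  rw [hD.isBicartesian_iff]
  have hs := (hD.isBicartesian_iff _).1 (h.square k l h₁ h₂)
  let s := meshSquare.{u} n k l h₁ h₂
  let θ : prodMap s (𝟙 A) ≫ prodMap (𝟙 (meshCat n)) g ⟶ prodMap (𝟙 sqCat) g ≫ prodMap s (𝟙 B) :=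
    𝟙 (prodMap s g)
  have : IsIso θ := inferInstanceAs (IsIso (𝟙 (prodMap s g)))
  have h1 := IsLKE.res (θ := θ) hZ (hD.lexact_prod_right s g)
  have e : (D.res (prodMap s (𝟙 A))).obj ((D.res (prodMap (𝟙 (meshCat n)) g)).obj Z) ≅
      (D.res (prodMap (𝟙 sqCat) g)).obj ((D.res (prodMap s (𝟙 B))).obj Z) :=
    (D.resComp (prodMap s (𝟙 A)) (prodMap (𝟙 (meshCat n)) g)).symm.app Z ≪≫
      (D.resComp (prodMap (𝟙 sqCat) g) (prodMap s (𝟙 B))).app Z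
  -- The square is extended from the span over `A`, and then from `A` to `B`. The composite
  -- inclusion also factors through the span over `B`, and cancelling the first factor gives the
  -- claim.
  have h2 := (isLKE_comp_iff (hs.of_iso e)).2 h1
  exact hD.isLKE_of_comp (f := prodMap (𝟙 spanCat) g) (g := prodMap spanIncl (𝟙 B))
    (fullyFaithfulProd' _ hg _) (fullyFaithfulProd _ spanInclFF _) h2

/-- The inclusion of exact diagrams is exact. -/
theorem IsStableDerivator.isExact_exMeshι (hD : IsStableDerivator D) (n : ℕ) :
    IsExact (exMeshι n D) := by
  have hE := hD.exMesh n
  have hM := hD.shift (meshCat n)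
  -- Zero objects of `D^{M_n}` are exact diagrams and remain zero in the full subcategory, so they
  -- represent its zero objects.
  have zero {A : Cat.{u, u}} (X : (DerivatorAR.exMesh n D).val A) (hX : Limits.IsZero X) :
      Limits.IsZero (((exMeshι n D).app (op A)).toFunctor.obj X) := by
    obtain ⟨Z, hZ⟩ := (hD.isPointed.hasZeroObject (prodCat (meshCat n) A)).zero
    let Z' : (DerivatorAR.exMesh n D).val A :=
      ⟨Z, (hD.exProp_iff A Z).2 (hD.isExactDiagram_of_isZero hZ)⟩
    have hZ' : Limits.IsZero Z' :=
      Limits.IsZero.of_full_of_faithful_of_isZero ((exProp n D).prop (op A)).ι Z' hZ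
    exact hZ.of_iso (((exMeshι n D).app (op A)).toFunctor.mapIso (hX.iso hZ'))
  -- The Kan extension `Z` formed in all of `D^{M_n}` is again exact, hence is also the Kan
  -- extension inside the exact diagrams and is isomorphic to `Q`.
  have cocart {A : Cat.{u, u}} (Q : (DerivatorAR.exMesh n D).val (prodCat sqCat A))
      (hQ : (DerivatorAR.exMesh n D).IsCocartesian Q) :
      (D.shift (meshCat n)).IsCocartesian (((exMeshι n D).app (op (prodCat sqCat A))).toFunctor.obj Q) := by
    rw [hE.isCocartesian_iff] at hQ
    rw [hM.isCocartesian_iff]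
    let g := prodMap spanIncl.{u} (𝟙 A)
    obtain ⟨Z, hZ, ⟨e⟩⟩ := hM.exists_isLKE (f := g) (fullyFaithfulProd _ spanInclFF A)
      (((D.shift (meshCat n)).res g).obj Q.obj)
    have hZ' : IsExactDiagram n D (prodCat sqCat A) Z :=
      hD.isExactDiagram_of_isLKE (fullyFaithfulProd _ spanInclFF A) hZ
        (((hD.exProp_iff _ _).1 (((DerivatorAR.exMesh n D).res g).obj Q).property).of_iso e.symm)
    let Z' : (DerivatorAR.exMesh n D).val (prodCat sqCat A) := ⟨Z, (hD.exProp_iff _ Z).2 hZ'⟩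
    have hZ'' : (DerivatorAR.exMesh n D).IsLKE g Z' := fun Y => by
      refine ⟨fun a b h => ?_, fun k => ?_⟩
      · exact ObjectProperty.hom_ext _ ((hZ Y.obj).1 congr($(h).hom))
      · obtain ⟨a, ha⟩ := (hZ Y.obj).2 k.hom
        exact ⟨ObjectProperty.homMk a, ObjectProperty.hom_ext _ ha⟩
    obtain ⟨i, -⟩ := hZ''.exists_iso hQ
      (((exProp n D).prop (op (prodCat spanCat A))).isoMk e)
    exact hZ.of_iso (((exMeshι n D).app (op (prodCat sqCat A))).toFunctor.mapIso i)
  refine ⟨fun {A} X ⟨h⟩ => ⟨?_⟩, fun {A} X ⟨h⟩ => ⟨?_⟩, fun {A} Q h => cocart Q h, fun {A} Q h => ?_⟩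
  · have := hE.isPointed.hasZeroObject A
    exact (zero X (isZero_of_unique_to fun Y => ⟨⟨⟨h.to Y⟩, fun f => h.hom_ext _ _⟩⟩)).isInitial
  · have := hE.isPointed.hasZeroObject A
    exact (zero X (isZero_of_unique_from fun Y => ⟨⟨⟨h.from Y⟩, fun f => h.hom_ext _ _⟩⟩)).isTerminal
  -- Both prederivators are stable, so cartesian squares may be treated as cocartesian ones.
  · exact (hM.stable _).1 (cocart Q ((hE.stable Q).2 h))

end

end

section

/-! ### Adjunctions between pseudonatural transformations -/

section Mates

variable {B : Type u₁} [Bicategory.{w₁, v₁} B]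
variable {c d e f : B} {g g' : c ⟶ e} {h h' : d ⟶ f} {l₁ : c ⟶ d} {r₁ : d ⟶ c}
  {l₂ : e ⟶ f} {r₂ : f ⟶ e}
variable (adj₁ : Bicategory.Adjunction l₁ r₁) (adj₂ : Bicategory.Adjunction l₂ r₂)

/-- Compatibility with the units pins down the mate. Evaluated at objects it becomes the equation
that matches mates with base-changed universal arrows. -/
lemma mateEquiv_unit_eq (x : g ≫ l₂ ⟶ l₁ ≫ h) :
    (λ_ _).inv ≫ adj₁.unit ▷ g ≫ (α_ _ _ _).hom ≫ l₁ ◁ Bicategory.mateEquiv adj₁ adj₂ x =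
      (ρ_ _).inv ≫ g ◁ adj₂.unit ≫ (α_ _ _ _).inv ≫ x ▷ r₂ ≫ (α_ _ _ _).hom := by
  have := (Bicategory.mateEquiv_eq_iff adj₁ adj₂ x _).1 rfl
  simpa [Bicategory.Adjunction.homEquiv₁_symm_apply, Bicategory.Adjunction.homEquiv₂_apply]
    using this

lemma mateEquiv_eq_homEquiv (x : g ≫ l₂ ⟶ l₁ ≫ h) :
    Bicategory.mateEquiv adj₁ adj₂ x =
      adj₂.homEquiv₂ ((α_ _ _ _).hom ≫ adj₁.homEquiv₁ x) := by
  rw [Bicategory.mateEquiv_apply', Bicategory.Adjunction.homEquiv₂_apply,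
    Bicategory.Adjunction.homEquiv₁_apply]
  calc
    _ = 𝟙 _ ⊗≫ (r₁ ≫ g) ◁ adj₂.unit ⊗≫ r₁ ◁ x ▷ r₂ ⊗≫ adj₁.counit ▷ h ▷ r₂ ⊗≫ 𝟙 _ := by
      bicategory
    _ = _ := by bicategory

lemma mateEquiv_counit_eq (x : g ≫ l₂ ⟶ l₁ ≫ h) :
    Bicategory.mateEquiv adj₁ adj₂ x ▷ l₂ ≫ (α_ _ _ _).hom ≫ h ◁ adj₂.counit ≫ (ρ_ _).hom =
      (α_ _ _ _).hom ≫ r₁ ◁ x ≫ (α_ _ _ _).inv ≫ adj₁.counit ▷ h ≫ (λ_ _).hom := by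
  have := (Equiv.symm_apply_eq _).2 (mateEquiv_eq_homEquiv adj₁ adj₂ x)
  rwa [Bicategory.Adjunction.homEquiv₂_symm_apply, Bicategory.Adjunction.homEquiv₁_apply] at this

/-- This lemma and the next two, with `Bicategory.mateEquiv_vcomp`, make mates compatible with
pasting 2-cells and with identity squares, so coherence laws can be checked after taking mates. -/
lemma mateEquiv_whiskerRight_comp (β : g' ⟶ g) (x : g ≫ l₂ ⟶ l₁ ≫ h) :
    Bicategory.mateEquiv adj₁ adj₂ (β ▷ l₂ ≫ x) =
      r₁ ◁ β ≫ Bicategory.mateEquiv adj₁ adj₂ x := by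
  rw [Bicategory.mateEquiv_apply', Bicategory.mateEquiv_apply']
  calc
    _ = 𝟙 _ ⊗≫ r₁ ◁ (g' ◁ adj₂.unit ≫ β ▷ (l₂ ≫ r₂)) ⊗≫ r₁ ◁ x ▷ r₂ ⊗≫
          adj₁.counit ▷ h ▷ r₂ ⊗≫ 𝟙 _ := by bicategory
    _ = _ := by rw [whisker_exchange]; bicategory

lemma mateEquiv_comp_whiskerLeft (x : g ≫ l₂ ⟶ l₁ ≫ h) (γ : h ⟶ h') :
    Bicategory.mateEquiv adj₁ adj₂ (x ≫ l₁ ◁ γ) =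
      Bicategory.mateEquiv adj₁ adj₂ x ≫ γ ▷ r₂ := by
  rw [Bicategory.mateEquiv_apply', Bicategory.mateEquiv_apply']
  calc
    _ = 𝟙 _ ⊗≫ r₁ ◁ g ◁ adj₂.unit ⊗≫ r₁ ◁ x ▷ r₂ ⊗≫
          ((r₁ ≫ l₁) ◁ γ ≫ adj₁.counit ▷ h') ▷ r₂ ⊗≫ 𝟙 _ := by bicategory
    _ = _ := by rw [whisker_exchange]; bicategory

lemma mateEquiv_unitors :
    Bicategory.mateEquiv adj₁ adj₁ ((λ_ l₁).hom ≫ (ρ_ l₁).inv) = (ρ_ r₁).hom ≫ (λ_ r₁).inv := by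
  rw [Bicategory.mateEquiv_apply']
  calc
    _ = 𝟙 _ ⊗≫ Bicategory.rightZigzag adj₁.unit adj₁.counit ⊗≫ 𝟙 _ := by bicategory
    _ = _ := by rw [adj₁.right_triangle]; bicategory

lemma isIso_mateEquiv_symm [IsIso adj₁.unit] [IsIso adj₂.counit] (y : r₁ ≫ g ⟶ h ≫ r₂)
    [IsIso y] : IsIso ((Bicategory.mateEquiv adj₁ adj₂).symm y) := by
  rw [Bicategory.mateEquiv_symm_apply, Bicategory.Adjunction.homEquiv₂_symm_apply,
    Bicategory.Adjunction.homEquiv₁_symm_apply]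
  infer_instance

end Mates

section Trans

variable {B : Type u₁} [Bicategory.{w₁, v₁} B] {C : Type u₂} [Bicategory.{w₂, v₂} C]
  {F G : B ⥤ᵖ C}

lemma naturality_inv_comp (η : F ⟶ G) {a b c : B} (f : a ⟶ b) (g : b ⟶ c) :
    (η.naturality (f ≫ g)).inv ≫ (F.mapComp f g).hom ▷ η.app c =
      η.app a ◁ (G.mapComp f g).hom ≫
        Bicategory.rightAdjointSquare.vcomp (η.naturality f).inv (η.naturality g).inv := by
  rw [Pseudofunctor.StrongTrans.naturality_comp_inv]
  simp [Bicategory.rightAdjointSquare.vcomp, ← comp_whiskerRight]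

lemma naturality_hom_comp (η : F ⟶ G) {a b c : B} (f : a ⟶ b) (g : b ⟶ c) :
    (η.naturality (f ≫ g)).hom ≫ η.app a ◁ (G.mapComp f g).hom =
      (F.mapComp f g).hom ▷ η.app c ≫
        Bicategory.leftAdjointSquare.vcomp (η.naturality f).hom (η.naturality g).hom :=
  η.naturality_comp f g

section Left

variable {η : F ⟶ G} {l : ∀ b, G.obj b ⟶ F.obj b}
  (adj : ∀ b, Bicategory.Adjunction (l b) (η.app b))

/-- The mate of the naturality constraint of `η` at `f`. -/
abbrev leftMate {a b : B} (f : a ⟶ b) : G.map f ≫ l b ⟶ l a ≫ F.map f :=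
  (Bicategory.mateEquiv (adj a) (adj b)).symm (η.naturality f).inv

lemma mateEquiv_leftMate {a b : B} (f : a ⟶ b) :
    Bicategory.mateEquiv (adj a) (adj b) (leftMate adj f) = (η.naturality f).inv :=
  Equiv.apply_symm_apply _ _

lemma isIso_leftMate (h₁ : ∀ b, IsIso (adj b).unit) (h₂ : ∀ b, IsIso (adj b).counit) {a b : B}
    (f : a ⟶ b) : IsIso (leftMate adj f) := isIso_mateEquiv_symm _ _ _

variable (h : ∀ {a b : B} (f : a ⟶ b), IsIso (leftMate adj f))

/-- The pseudonatural transformation given by componentwise left adjoints. -/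
def leftTrans : G ⟶ F where
  app := l
  naturality {a b} f := @asIso _ _ _ _ (leftMate adj f) (h f)
  naturality_naturality {a b f g} θ := by
    -- The mate correspondence is injective and turns the naturality constraint of `l` into the
    -- inverse constraint of `η`, for which the law is known.
    apply (Bicategory.mateEquiv (adj a) (adj b)).injective
    change Bicategory.mateEquiv (adj a) (adj b) (_ ▷ _ ≫ leftMate adj g) =
      Bicategory.mateEquiv (adj a) (adj b) (leftMate adj f ≫ _)
    rw [mateEquiv_whiskerRight_comp, mateEquiv_comp_whiskerLeft, mateEquiv_leftMate,
      mateEquiv_leftMate, Iso.eq_inv_comp, ← Category.assoc, Iso.comp_inv_eq]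
    exact (η.naturality_naturality θ).symm
  naturality_id a := by
    apply (Bicategory.mateEquiv (adj a) (adj a)).injective
    change Bicategory.mateEquiv (adj a) (adj a) (leftMate adj (𝟙 a) ≫ _) = _
    rw [mateEquiv_whiskerRight_comp, mateEquiv_comp_whiskerLeft, mateEquiv_leftMate,
      mateEquiv_unitors, Pseudofunctor.StrongTrans.naturality_id_inv]
    simp [← comp_whiskerRight]
  naturality_comp {a b c} f g := by
    apply (Bicategory.mateEquiv (adj a) (adj c)).injective
    change Bicategory.mateEquiv (adj a) (adj c) (leftMate adj (f ≫ g) ≫ _) =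
      Bicategory.mateEquiv (adj a) (adj c) (_ ▷ _ ≫
        Bicategory.leftAdjointSquare.vcomp (leftMate adj f) (leftMate adj g))
    rw [mateEquiv_whiskerRight_comp, mateEquiv_comp_whiskerLeft, mateEquiv_leftMate,
      Bicategory.mateEquiv_vcomp (adj a) (adj b) (adj c), mateEquiv_leftMate, mateEquiv_leftMate]
    exact naturality_inv_comp η f g

/-- Componentwise left adjoints form a left adjoint of a pseudonatural transformation. -/
def leftTransAdj : Bicategory.Adjunction (leftTrans adj h) η where
  unit := ⟨{
    app b := (adj b).unit
    naturality {a b} f := by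
      have h1 := mateEquiv_unit_eq (adj a) (adj b) (leftMate adj f)
      rw [mateEquiv_leftMate] at h1
      change G.map f ◁ (adj b).unit ≫ (α_ _ _ _).inv ≫ leftMate adj f ▷ η.app b ≫ (α_ _ _ _).hom ≫
        l a ◁ (η.naturality f).hom ≫ (α_ _ _ _).inv =
          ((ρ_ _).hom ≫ (λ_ _).inv) ≫ (adj a).unit ▷ G.map f
      rw [← Category.assoc, ← Category.assoc, ← Category.assoc, Category.assoc, Category.assoc,
        ← cancel_epi (ρ_ (G.map f)).inv]
      simp only [Category.assoc]
      simp only [← reassoc_of% h1, Iso.inv_hom_id_assoc, whiskerLeft_inv_hom_assoc,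
        Iso.hom_inv_id, Category.comp_id] }⟩
  counit := ⟨{
    app b := (adj b).counit
    naturality {a b} f := by
      have h1 := mateEquiv_counit_eq (adj a) (adj b) (leftMate adj f)
      rw [mateEquiv_leftMate] at h1
      change F.map f ◁ (adj b).counit ≫ (ρ_ _).hom ≫ (λ_ _).inv =
        ((α_ _ _ _).inv ≫ (η.naturality f).hom ▷ l b ≫ (α_ _ _ _).hom ≫
          η.app a ◁ leftMate adj f ≫ (α_ _ _ _).inv) ≫ (adj a).counit ▷ F.map f
      rw [← Category.assoc, Iso.comp_inv_eq]
      simp only [Category.assoc]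
      rw [← h1]
      simp }⟩
  left_triangle := Pseudofunctor.StrongTrans.homCategory.ext fun b => by
    exact (adj b).left_triangle
  right_triangle := Pseudofunctor.StrongTrans.homCategory.ext fun b => by
    exact (adj b).right_triangle

/-- Componentwise adjoint equivalences form an adjoint equivalence. -/
def equivalenceOfComponents (h₁ : ∀ b, IsIso (adj b).unit) (h₂ : ∀ b, IsIso (adj b).counit) :
    Bicategory.Equivalence G F :=
  let h {a b : B} (f : a ⟶ b) : IsIso (leftMate adj f) := isIso_leftMate adj h₁ h₂ f
  Bicategory.Equivalence.mkOfAdjointifyCounit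
    (f := leftTrans adj h) (g := η)
    (Pseudofunctor.StrongTrans.isoMk (fun b => @asIso _ _ _ _ (adj b).unit (h₁ b))
      fun f => (leftTransAdj adj h).unit.as.naturality f)
    (Pseudofunctor.StrongTrans.isoMk (fun b => @asIso _ _ _ _ (adj b).counit (h₂ b))
      fun f => (leftTransAdj adj h).counit.as.naturality f)

end Left

section Right

variable {η : F ⟶ G} {r : ∀ b, G.obj b ⟶ F.obj b}
  (adj : ∀ b, Bicategory.Adjunction (η.app b) (r b))

/-- The mate of the naturality constraint of `η` at `f`. -/
abbrev rightMate {a b : B} (f : a ⟶ b) : r a ≫ F.map f ⟶ G.map f ≫ r b :=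
  Bicategory.mateEquiv (adj a) (adj b) (η.naturality f).hom

lemma rightMate_naturality {a b : B} {f g : a ⟶ b} (θ : f ⟶ g) :
    rightMate adj f ≫ G.map₂ θ ▷ r b = r a ◁ F.map₂ θ ≫ rightMate adj g := by
  rw [← mateEquiv_whiskerRight_comp, ← mateEquiv_comp_whiskerLeft, η.naturality_naturality]

lemma rightMate_id (a : B) :
    rightMate adj (𝟙 a) ≫ (G.mapId a).hom ▷ r a =
      r a ◁ (F.mapId a).hom ≫ (ρ_ (r a)).hom ≫ (λ_ (r a)).inv := by
  rw [← mateEquiv_comp_whiskerLeft, η.naturality_id, mateEquiv_whiskerRight_comp,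
    mateEquiv_unitors]

lemma rightMate_comp {a b c : B} (f : a ⟶ b) (g : b ⟶ c) :
    rightMate adj (f ≫ g) ≫ (G.mapComp f g).hom ▷ r c =
      r a ◁ (F.mapComp f g).hom ≫
        Bicategory.rightAdjointSquare.vcomp (rightMate adj f) (rightMate adj g) := by
  rw [← mateEquiv_comp_whiskerLeft, naturality_hom_comp, mateEquiv_whiskerRight_comp,
    Bicategory.mateEquiv_vcomp (adj a) (adj b) (adj c)]

variable (h : ∀ {a b : B} (f : a ⟶ b), IsIso (rightMate adj f))

/-- The pseudonatural transformation given by componentwise right adjoints. -/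
def rightTrans : G ⟶ F where
  app := r
  -- For right adjoints the mate points against the naturality constraint, so its inverse is taken.
  naturality {a b} f := (@asIso _ _ _ _ (rightMate adj f) (h f)).symm
  naturality_naturality {a b f g} θ := by
    have := h f
    have := h g
    change _ ≫ inv (rightMate adj g) = inv (rightMate adj f) ≫ _
    rw [IsIso.comp_inv_eq, Category.assoc, IsIso.eq_inv_comp, rightMate_naturality]
  naturality_id a := by
    have := h (𝟙 a)
    change inv (rightMate adj (𝟙 a)) ≫ _ = _
    have h1 := rightMate_id adj a
    rw [← Category.assoc, Iso.eq_comp_inv, ← Iso.comp_inv_eq] at h1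
    rw [IsIso.inv_comp_eq, ← h1]
    simp
  naturality_comp {a b c} f g := by
    have := h f
    have := h g
    have := h (f ≫ g)
    change inv (rightMate adj (f ≫ g)) ≫ _ = _ ▷ _ ≫ _ ≫ _ ◁ inv (rightMate adj g) ≫
      _ ≫ inv (rightMate adj f) ▷ _ ≫ _
    rw [IsIso.inv_comp_eq, reassoc_of% rightMate_comp]
    simp [Bicategory.rightAdjointSquare.vcomp]

/-- Componentwise right adjoints form a right adjoint of a pseudonatural transformation. -/
def rightTransAdj : Bicategory.Adjunction η (rightTrans adj h) where
  unit := ⟨{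
    app b := (adj b).unit
    naturality {a b} f := by
      have := h f
      have h1 := mateEquiv_unit_eq (adj a) (adj b) (η.naturality f).hom
      change F.map f ◁ (adj b).unit ≫ (α_ _ _ _).inv ≫ (η.naturality f).hom ▷ r b ≫
        (α_ _ _ _).hom ≫ η.app a ◁ inv (rightMate adj f) ≫ (α_ _ _ _).inv =
          ((ρ_ _).hom ≫ (λ_ _).inv) ≫ (adj a).unit ▷ F.map f
      rw [← cancel_epi (ρ_ (F.map f)).inv]
      simp only [Category.assoc]
      simp only [← reassoc_of% h1, Iso.inv_hom_id_assoc, ← whiskerLeft_comp_assoc,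
        IsIso.hom_inv_id, Iso.hom_inv_id, Category.comp_id, whiskerLeft_id, Category.id_comp] }⟩
  counit := ⟨{
    app b := (adj b).counit
    naturality {a b} f := by
      have := h f
      have h1 := mateEquiv_counit_eq (adj a) (adj b) (η.naturality f).hom
      change G.map f ◁ (adj b).counit ≫ (ρ_ _).hom ≫ (λ_ _).inv =
        ((α_ _ _ _).inv ≫ inv (rightMate adj f) ▷ η.app b ≫ (α_ _ _ _).hom ≫
          r a ◁ (η.naturality f).hom ≫ (α_ _ _ _).inv) ≫ (adj a).counit ▷ G.map f
      rw [← Category.assoc, Iso.comp_inv_eq]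
      simp only [Category.assoc]
      rw [← h1]
      simp [← comp_whiskerRight_assoc] }⟩
  left_triangle := Pseudofunctor.StrongTrans.homCategory.ext fun b => by
    exact (adj b).left_triangle
  right_triangle := Pseudofunctor.StrongTrans.homCategory.ext fun b => by
    exact (adj b).right_triangle

end Right

end Trans

end

section

/-! ### Kan extensions as adjoints of the restriction morphisms -/

section

variable {D : Prederivator.{u, v, w}} {K L M : Cat.{u, u}}

/-- The constraint of `f^*` in the parameter is the cell of the commuting square `f × g`, so its
mates are controlled by exactness of product squares. -/
lemma shiftRes_naturality_inv_app (f : K ⟶ L) {A A' : Cat.{u, u}} (g : A' ⟶ A)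
    (Z : D.val (prodCat L A)) :
    ((D.shiftRes f).naturality g.op).inv.toNatTrans.app Z =
      sqApp (D := D) (p := prodMap (𝟙 K) g) (f := prodMap f (𝟙 A)) (q := prodMap f (𝟙 A'))
        (g := prodMap (𝟙 L) g) (𝟙 (prodMap f g)) Z := Category.assoc _ _ _

lemma comp_id_comp_id_comp_id {𝒞 : Type*} [Category* 𝒞] {a b c d : 𝒞} (x : a ⟶ b) (y : b ⟶ c)
    (z : c ⟶ d) : x ≫ 𝟙 _ ≫ y ≫ 𝟙 _ ≫ z ≫ 𝟙 _ = x ≫ y ≫ z := by simp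

section Cat

variable {c d e f : Cat.{v, w}} {g : c ⟶ e} {h : d ⟶ f} {l₁ : c ⟶ d} {r₁ : d ⟶ c}
  {l₂ : e ⟶ f} {r₂ : f ⟶ e}
variable (adj₁ : Bicategory.Adjunction l₁ r₁) (adj₂ : Bicategory.Adjunction l₂ r₂)

lemma cat_isIso_of_app {F G : c ⟶ d} (α : F ⟶ G) (h : ∀ X, IsIso (α.toNatTrans.app X)) :
    IsIso α := by
  have : IsIso α.toNatTrans := (NatTrans.isIso_iff_isIso_app _).2 h
  exact (Cat.Hom.isoMk (asIso α.toNatTrans)).isIso_hom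

lemma unit_mateEquiv_app (x : g ≫ l₂ ⟶ l₁ ≫ h) (X : c) :
    g.toFunctor.map (adj₁.unit.toNatTrans.app X) ≫
        (Bicategory.mateEquiv adj₁ adj₂ x).toNatTrans.app (l₁.toFunctor.obj X) =
      adj₂.unit.toNatTrans.app (g.toFunctor.obj X) ≫
        r₂.toFunctor.map (x.toNatTrans.app X) := by
  have := congr(($(mateEquiv_unit_eq adj₁ adj₂ x)).toNatTrans.app X)
  simpa using this

lemma mateEquiv_counit_app (x : g ≫ l₂ ⟶ l₁ ≫ h) (X : d) :
    l₂.toFunctor.map ((Bicategory.mateEquiv adj₁ adj₂ x).toNatTrans.app X) ≫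
        adj₂.counit.toNatTrans.app (h.toFunctor.obj X) =
      x.toNatTrans.app (r₁.toFunctor.obj X) ≫
        h.toFunctor.map (adj₁.counit.toNatTrans.app X) := by
  have := congr(($(mateEquiv_counit_eq adj₁ adj₂ x)).toNatTrans.app X)
  simpa using this

end Cat

/-- Levelwise left adjoints are pseudonatural once the mates are invertible, that is, once Kan
extension along `f` commutes with restriction in the parameter; this is `lexact_prod_left`. -/
lemma IsDerivator.exists_leftAdjoint_shiftRes (hD : IsDerivator D) (f : K ⟶ L) :
    ∃ k : D.shift K ⟶ D.shift L, Nonempty (Bicategory.Adjunction k (D.shiftRes f)) := by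
  have (A : Cat.{u, u}ᵒᵖ) : (D.res (prodMap f (𝟙 A.unop))).IsRightAdjoint := hD.der3_left _
  let adj (A : Cat.{u, u}ᵒᵖ) : Bicategory.Adjunction
    (Functor.leftAdjoint (D.res (prodMap f (𝟙 A.unop)))).toCatHom ((D.shiftRes f).app A) :=
    Adjunction.toCat (CategoryTheory.Adjunction.ofIsRightAdjoint (D.res (prodMap f (𝟙 A.unop))))
  refine ⟨_, ⟨leftTransAdj (η := D.shiftRes f) adj fun {A A'} g => cat_isIso_of_app _ fun X => ?_⟩⟩
  refine IsUniv.isIso_of_comp (isUniv_unit (Adjunction.ofCat (adj A')) _) _ ?_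
  have h1 := unit_mateEquiv_app (adj A) (adj A') (leftMate (η := D.shiftRes f) adj g) X
  have h2 := congr(($(mateEquiv_leftMate (η := D.shiftRes f) adj g)).toNatTrans.app
    ((Functor.leftAdjoint (D.res (prodMap f (𝟙 A.unop)))).obj X))
  exact IsUniv.congr (hD.lexact_prod_left f g.unop _ (isUniv_unit (Adjunction.ofCat (adj A)) X))
    ((congrArg (_ ≫ ·) (h2.trans (shiftRes_naturality_inv_app f g.unop _))).symm.trans h1)

/-- Right Kan extension along `f` commutes with restriction in the parameter because left Kan
extension in the parameter commutes with restriction along `f` (`lexact_prod_right`); the two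
statements are transposes. -/
lemma IsDerivator.exists_rightAdjoint_shiftRes (hD : IsDerivator D) (f : K ⟶ L) :
    ∃ k : D.shift K ⟶ D.shift L, Nonempty (Bicategory.Adjunction (D.shiftRes f) k) := by
  have (A : Cat.{u, u}ᵒᵖ) : (D.res (prodMap f (𝟙 A.unop))).IsLeftAdjoint := hD.der3_right _
  let adj (A : Cat.{u, u}ᵒᵖ) : Bicategory.Adjunction ((D.shiftRes f).app A)
    (Functor.rightAdjoint (D.res (prodMap f (𝟙 A.unop)))).toCatHom :=
    Adjunction.toCat (CategoryTheory.Adjunction.ofIsLeftAdjoint (D.res (prodMap f (𝟙 A.unop))))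
  refine ⟨_, ⟨rightTransAdj (η := D.shiftRes f) adj fun {A A'} g => cat_isIso_of_app _ fun X => ?_⟩⟩
  refine IsCouniv.isIso_of_comp (isCouniv_counit (Adjunction.ofCat (adj A')) _) _ ?_
  have h1 := mateEquiv_counit_app (adj A) (adj A') ((D.shiftRes f).naturality g).hom X
  have h2 := LExact.rexact (hD.lexact_prod_right f g.unop) (hD.der3_left _)
  exact IsCouniv.congr (h2 _ (isCouniv_counit (Adjunction.ofCat (adj A)) X)) h1.symm

/-- The components of an adjunction between morphisms of prederivators. -/
def adjApp {D E : Prederivator.{u, v, w}} {l : D ⟶ E} {r : E ⟶ D} (adj : Bicategory.Adjunction l r)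
    (A : Cat.{u, u}ᵒᵖ) : CategoryTheory.Adjunction (l.app A).toFunctor (r.app A).toFunctor :=
  Adjunction.ofCat
    { unit := adj.unit.as.app A
      counit := adj.counit.as.app A
      left_triangle := congr($(adj.left_triangle).as.app A)
      right_triangle := congr($(adj.right_triangle).as.app A) }

/-- An invertible modification from its components. -/
def transIso {D E : Prederivator.{u, v, w}} {l r : D ⟶ E} (Γ : l ⟶ r)
    (h : ∀ (A : Cat.{u, u}ᵒᵖ) (X : D.obj A), IsIso ((Γ.as.app A).toNatTrans.app X)) : l ≅ r :=
  Pseudofunctor.StrongTrans.isoMk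
    (fun A => @asIso _ _ _ _ (Γ.as.app A) (cat_isIso_of_app _ (h A))) fun f => Γ.as.naturality f

/-- The isomorphism is the counit whiskered with `G`; at an object extended from its restriction,
the counit compares two universal arrows. -/
lemma exists_iso_of_isLKE {P : Prederivator.{u, v, w}} {f : K ⟶ L} {k : D.shift K ⟶ D.shift L}
    (adj : Bicategory.Adjunction k (D.shiftRes f)) (G : P ⟶ D.shift L)
    (h : ∀ (A : Cat.{u, u}) (X : P.val A),
      D.IsLKE (prodMap f (𝟙 A)) ((G.app (op A)).toFunctor.obj X)) :
    Nonempty (G ≅ (G ≫ D.shiftRes f) ≫ k) := by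
  refine ⟨(transIso ((α_ _ _ _).hom ≫ G ◁ adj.counit ≫ (ρ_ _).hom) fun A X => ?_).symm⟩
  change IsIso (𝟙 _ ≫ (adjApp adj A).counit.app ((G.app A).toFunctor.obj X) ≫ 𝟙 _)
  have h1 := (isLKE_iff.1 (h A.unop X))
  have : IsIso ((adjApp adj A).counit.app ((G.app A).toFunctor.obj X)) := by
    refine (isUniv_unit (adjApp adj A) _).isIso_of_comp _ (IsUniv.congr h1 ?_)
    exact ((adjApp adj A).right_triangle_components _).symm
  infer_instance

lemma exists_iso_of_isRKE {P : Prederivator.{u, v, w}} {f : K ⟶ L} {k : D.shift K ⟶ D.shift L}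
    (adj : Bicategory.Adjunction (D.shiftRes f) k) (G : P ⟶ D.shift L)
    (h : ∀ (A : Cat.{u, u}) (X : P.val A),
      D.IsRKE (prodMap f (𝟙 A)) ((G.app (op A)).toFunctor.obj X)) :
    Nonempty (G ≅ (G ≫ D.shiftRes f) ≫ k) := by
  refine ⟨transIso ((ρ_ _).inv ≫ G ◁ adj.unit ≫ (α_ _ _ _).inv) fun A X => ?_⟩
  change IsIso (𝟙 _ ≫ (adjApp adj A).unit.app ((G.app A).toFunctor.obj X) ≫ 𝟙 _)
  have h1 := (isRKE_iff.1 (h A.unop X))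
  have : IsIso ((adjApp adj A).unit.app ((G.app A).toFunctor.obj X)) := by
    refine (isCouniv_counit (adjApp adj A) _).isIso_of_comp _ (IsCouniv.congr h1 ?_)
    exact ((adjApp adj A).left_triangle_components _).symm
  infer_instance

lemma paste_id_prod (f : K ⟶ L) (g : L ⟶ M) {A A' : Cat.{u, u}} (h : A' ⟶ A) :
    paste (p := prodMap g (𝟙 A')) (f := prodMap (𝟙 M) h) (q := prodMap (𝟙 L) h)
      (g := prodMap g (𝟙 A)) (p' := prodMap f (𝟙 A')) (q' := prodMap (𝟙 K) h)
      (g' := prodMap f (𝟙 A)) (𝟙 (prodMap g h)) (𝟙 (prodMap f h)) =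
      𝟙 (prodMap (f ≫ g) h) :=
  Cat.Hom₂.ext (NatTrans.ext (funext fun s => by
    exact (Category.id_comp _).trans (CategoryTheory.Functor.map_id (prodMap g (𝟙 A)).toFunctor
      ((prodMap f h).toFunctor.obj s))))

/-- Restriction along a composite. -/
def shiftResComp (D : Prederivator.{u, v, w}) (f : K ⟶ L) (g : L ⟶ M) :
    D.shiftRes (f ≫ g) ≅ D.shiftRes g ≫ D.shiftRes f :=
  Pseudofunctor.StrongTrans.isoMk
    (fun A => D.mapComp (prodMap g (𝟙 A.unop)).op (prodMap f (𝟙 A.unop)).op)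
    fun {A A'} h => Cat.Hom₂.ext (NatTrans.ext (funext fun Z => by
      have h1 := sqApp_paste (D := D) (p := prodMap g (𝟙 A'.unop)) (f := prodMap (𝟙 M) h.unop)
        (q := prodMap (𝟙 L) h.unop) (g := prodMap g (𝟙 A.unop)) (p' := prodMap f (𝟙 A'.unop))
        (q' := prodMap (𝟙 K) h.unop) (g' := prodMap f (𝟙 A.unop)) (𝟙 (prodMap g h.unop))
        (𝟙 (prodMap f h.unop)) Z
      rw [paste_id_prod] at h1
      exact (comp_id_comp_id_comp_id _ _ _).trans h1))

end

end

section

/-! ### The equivalence -/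

section

variable {n : ℕ}

/-- Inverses are assembled twice by mates: for fixed `D` the inverse functors over all `A` form a
morphism of prederivators, and these morphisms over all `D` form an inverse that is pseudonatural in
exact morphisms. -/
lemma exists_equivalence (n : ℕ) :
    ∃ e : Bicategory.Equivalence (shiftPs.{u, v, w} (chainCat n)) (exPs n),
      e.inv = exι n ≫ resPs (incl n) := by
  have local_adj (D : StableDerivator.{u, v, w}) :
      ∃ (l : D.pre.shift (chainCat n) ⟶ exMesh n D.pre)
        (adj : Bicategory.Adjunction l (exMeshι n D.pre ≫ D.pre.shiftRes (incl n))),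
        IsIso adj.unit ∧ IsIso adj.counit := by
    let ζ := exMeshι n D.pre ≫ D.pre.shiftRes (incl n)
    have (A : Cat.{u, u}ᵒᵖ) : (ζ.app A).toFunctor.IsEquivalence :=
      D.isStable.res_incl_isEquivalence n A.unop
    let adj (A : Cat.{u, u}ᵒᵖ) : Bicategory.Adjunction
      ((ζ.app A).toFunctor.inv).toCatHom (ζ.app A) :=
      Adjunction.toCat (ζ.app A).toFunctor.asEquivalence.symm.toAdjunction
    have h₁ (A) : IsIso (adj A).unit := cat_isIso_of_app _ fun X =>
      ((ζ.app A).toFunctor.asEquivalence.symm.unitIso.app X).isIso_hom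
    have h₂ (A) : IsIso (adj A).counit := cat_isIso_of_app _ fun X =>
      ((ζ.app A).toFunctor.asEquivalence.symm.counitIso.app X).isIso_hom
    have h {A A' : Cat.{u, u}ᵒᵖ} (f : A ⟶ A') : IsIso (leftMate (η := ζ) adj f) := isIso_leftMate (η := ζ) adj h₁ h₂ f
    refine ⟨_, leftTransAdj (η := ζ) adj h, ?_, ?_⟩
    · exact (transIso (leftTransAdj (η := ζ) adj h).unit fun A X =>
        ((ζ.app A).toFunctor.asEquivalence.symm.unitIso.app X).isIso_hom).isIso_hom
    · exact (transIso (leftTransAdj (η := ζ) adj h).counit fun A X =>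
        ((ζ.app A).toFunctor.asEquivalence.symm.counitIso.app X).isIso_hom).isIso_hom
  choose l adj h₁ h₂ using local_adj
  exact ⟨equivalenceOfComponents (η := exι n ≫ resPs (incl n)) adj h₁ h₂, rfl⟩

/-- The composite of the four Kan extensions is isomorphic to any inverse of `i^*`. -/
lemma exists_iso_kan {D : Prederivator.{u, v, w}} (hD : IsStableDerivator D)
    {F : D.shift (chainCat n) ⟶ exMesh n D}
    (u : F ≫ exMeshι n D ≫ D.shiftRes (incl n) ≅ 𝟙 _)
    {k₁ : D.shift (chainCat n) ⟶ D.shift (catK₁ n)}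
    {k₂ : D.shift (catK₁ n) ⟶ D.shift (catK₂ n)}
    {k₃ : D.shift (catK₂ n) ⟶ D.shift (catK₃ n)}
    {k₄ : D.shift (catK₃ n) ⟶ D.shift (meshCat n)}
    (adj₁ : Bicategory.Adjunction (D.shiftRes (incl₁ n)) k₁)
    (adj₂ : Bicategory.Adjunction k₂ (D.shiftRes (incl₂ n)))
    (adj₃ : Bicategory.Adjunction k₃ (D.shiftRes (incl₃ n)))
    (adj₄ : Bicategory.Adjunction (D.shiftRes (incl₄ n)) k₄) :
    Nonempty (F ≫ exMeshι n D ≅ k₁ ≫ k₂ ≫ k₃ ≫ k₄) := by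
  have kan (A : Cat.{u, u}) (X : (D.shift (chainCat n)).val A) : MeshKan n (D.shiftRight A)
      (((F ≫ exMeshι n D).app (op A)).toFunctor.obj X) :=
    (hD.isExactDiagram_iff_meshKan _).1
      ((hD.exProp_iff A _).1 ((F.app (op A)).toFunctor.obj X).property)
  let G := F ≫ exMeshι n D
  -- Each stage recovers a diagram from its restriction to the next smaller shape. At the bottom the
  -- restriction to `A_n` is the identity by `u`, and substituting back builds the composite of the
  -- four extensions.
  obtain ⟨e₄⟩ := exists_iso_of_isRKE adj₄ G fun A X => (kan A X).kan₄
  obtain ⟨e₃⟩ := exists_iso_of_isLKE adj₃ (G ≫ D.shiftRes (incl₄ n)) fun A X => (kan A X).kan₃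
  obtain ⟨e₂⟩ := exists_iso_of_isLKE adj₂ ((G ≫ D.shiftRes (incl₄ n)) ≫ D.shiftRes (incl₃ n))
    fun A X => (kan A X).kan₂
  obtain ⟨e₁⟩ := exists_iso_of_isRKE adj₁
    (((G ≫ D.shiftRes (incl₄ n)) ≫ D.shiftRes (incl₃ n)) ≫ D.shiftRes (incl₂ n))
    fun A X => (kan A X).kan₁
  let c : D.shiftRes (incl n) ≅ D.shiftRes (incl₄ n) ≫ D.shiftRes (incl₃ n) ≫
      D.shiftRes (incl₂ n) ≫ D.shiftRes (incl₁ n) :=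
    shiftResComp D (incl₁ n ≫ incl₂ n ≫ incl₃ n) (incl₄ n) ≪≫
      whiskerLeftIso _ (shiftResComp D (incl₁ n ≫ incl₂ n) (incl₃ n) ≪≫
        whiskerLeftIso _ (shiftResComp D (incl₁ n) (incl₂ n)))
  let d : (((G ≫ D.shiftRes (incl₄ n)) ≫ D.shiftRes (incl₃ n)) ≫ D.shiftRes (incl₂ n)) ≫
      D.shiftRes (incl₁ n) ≅ 𝟙 _ :=
    α_ _ _ _ ≪≫ α_ _ _ _ ≪≫ α_ _ _ _ ≪≫ whiskerLeftIso G c.symm ≪≫ α_ _ _ _ ≪≫ u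
  let d₁ := e₁ ≪≫ whiskerRightIso d k₁ ≪≫ λ_ k₁
  let d₂ := e₂ ≪≫ whiskerRightIso d₁ k₂
  let d₃ := e₃ ≪≫ whiskerRightIso d₂ k₃
  exact ⟨e₄ ≪≫ whiskerRightIso d₃ k₄ ≪≫ α_ _ _ _ ≪≫ α_ _ _ _⟩

end

end

end DerivatorAR

end

open DerivatorAR

theorem mainTheorem2 (n : ℕ) :
    (∀ D : StableDerivator.{u, v, w},
      IsStableDerivator (D.pre.shift (chainCat n)) ∧
      (∀ (A : Cat.{u, u}) (X : D.pre.val (prodCat (meshCat n) A)),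
        (exProp n D.pre).prop (op A) X ↔ IsExactDiagram n D.pre A X) ∧
      IsStableDerivator (exMesh n D.pre) ∧
      IsExact (exMeshι n D.pre)) ∧
    ∃ e : Bicategory.Equivalence (shiftPs.{u, v, w} (chainCat n)) (exPs n),
      e.inv = exι n ≫ resPs (incl n) ∧
      ∀ D : StableDerivator.{u, v, w},
        ∃ (k₁ : D.pre.shift (chainCat n) ⟶ D.pre.shift (catK₁ n))
          (k₂ : D.pre.shift (catK₁ n) ⟶ D.pre.shift (catK₂ n))
          (k₃ : D.pre.shift (catK₂ n) ⟶ D.pre.shift (catK₃ n))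
          (k₄ : D.pre.shift (catK₃ n) ⟶ D.pre.shift (meshCat n)),
          Nonempty (Bicategory.Adjunction (D.pre.shiftRes (incl₁ n)) k₁) ∧
          Nonempty (Bicategory.Adjunction k₂ (D.pre.shiftRes (incl₂ n))) ∧
          Nonempty (Bicategory.Adjunction k₃ (D.pre.shiftRes (incl₃ n))) ∧
          Nonempty (Bicategory.Adjunction (D.pre.shiftRes (incl₄ n)) k₄) ∧
          Nonempty (e.hom.app D ≫ exMeshι n D.pre ≅ k₁ ≫ k₂ ≫ k₃ ≫ k₄) := by
  obtain ⟨e, he⟩ := exists_equivalence.{u, v, w} n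
  refine ⟨fun D => ⟨D.isStable.shift _, D.isStable.exProp_iff, D.isStable.exMesh n,
    D.isStable.isExact_exMeshι n⟩, e, he, fun D => ?_⟩
  obtain ⟨k₁, ⟨adj₁⟩⟩ := D.isStable.exists_rightAdjoint_shiftRes (incl₁ n)
  obtain ⟨k₂, ⟨adj₂⟩⟩ := D.isStable.exists_leftAdjoint_shiftRes (incl₂ n)
  obtain ⟨k₃, ⟨adj₃⟩⟩ := D.isStable.exists_leftAdjoint_shiftRes (incl₃ n)
  obtain ⟨k₄, ⟨adj₄⟩⟩ := D.isStable.exists_rightAdjoint_shiftRes (incl₄ n)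
  -- Evaluating the unit of the 2-natural equivalence at `D` identifies `F` followed by `i^*` with
  -- the identity, which is the only property of `F` needed.
  have u : 𝟙 (shiftPs (chainCat n)) ≅ e.hom ≫ exι n ≫ resPs (incl n) :=
    e.unit ≪≫ whiskerLeftIso e.hom (eqToIso he)
  let u' : e.hom.app D ≫ exMeshι n D.pre ≫ D.pre.shiftRes (incl n) ≅ 𝟙 _ :=
    { hom := u.inv.as.app D
      inv := u.hom.as.app D
      hom_inv_id := congr($(u.inv_hom_id).as.app D)
      inv_hom_id := congr($(u.hom_inv_id).as.app D) }
  exact ⟨k₁, k₂, k₃, k₄, ⟨adj₁⟩, ⟨adj₂⟩, ⟨adj₃⟩, ⟨adj₄⟩,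
    exists_iso_kan D.isStable u' adj₁ adj₂ adj₃ adj₄⟩
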